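/- Setting. Let $\Omega\subset\mathbb R^2$ be a bounded convex polygonal domain, let $k\ge 0$ be an integer, and let $\mathcal T_h$ be a conforming decomposition of $\Omega$ into finitely many polygons $K$, each star-shaped with respect to a ball (hanging nodes count as vertices). Let $\mathbb P_m(D)$ denote the polynomials of degree at most $m$ on $D$, with $\mathbb P_{-1}(D)=\{0\}$. Let $\boldsymbol\Pi^{0}_{k}$, $\Pi^{0}_{k+1}$ be the elementwise $L^2$-projections onto $[\mathbb P_k(K)]^2$ and $\mathbb P_{k+1}(K)$, let $\Pi^0_0$ denote the mean value over $K$, and let $\Pi^{\nabla}_{k+1}:H^1(K)\to\mathbb P_{k+1}(K)$ be defined by $(\nabla\Pi^\nabla_{k+1}z,\nabla p)_K=(\nabla z,\nabla p)_K$ for all $p\in\mathbb P_{k+1}(K)$ and $\int_{\partial K}\Pi^\nabla_{k+1}z=\int_{\partial K}z$. The local spaces are $$\boldsymbol V_h(K)=\{\boldsymbol v\in H(\mathrm{div};K)\cap H(\mathrm{rot};K):\ \boldsymbol v\cdot\boldsymbol n|_e\in\mathbb P_k(e)\ \forall e\subset\partial K,\ \mathrm{div}\,\boldsymbol v\in\mathbb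 P_k(K),\ \mathrm{rot}\,\boldsymbol v\in\mathbb P_{k-1}(K)\},$$ $$Z_h(K)=\Big\{z\in H^1(K):\ z|_{\partial K}\in C^0(\partial K),\ z|_e\in\mathbb P_{k+1}(e)\ \forall e\subset\partial K,\ \Delta z\in\mathbb P_{k+1}(K),\ \int_K zp=\int_K(\Pi^\nabla_{k+1}z)p\ \ \forall p\in\mathbb P_{k+1}(K),\ p\perp_{L^2(K)}\mathbb P_{k-1}(K)\Big\},$$ and the global spaces are $\boldsymbol V_h=\{\boldsymbol v\in H(\mathrm{div};\Omega):\boldsymbol v\cdot\boldsymbol n=0\text{ on }\partial\Omega,\ \boldsymbol v|_K\in\boldsymbol V_h(K)\ \forall K\}$, $Q_h=\{q\in L^2(\Omega):\int_\Omega q=0,\ q|_K\in\mathbb P_k(K)\ \forall K\}$, $Z_h=\{z\in H^1(\Omega):z|_K\in Z_h(K)\ \forall K\}$. Data. Let $\phi$ (porosity) and $a=a(c,\boldsymbol x)$ be measurable with $0<\phi_*\le\phi\le\phi^*$ and $0<a_*\le a(c,\boldsymbol x)\le a^*$ for all $c\in\mathbb R$, $\boldsymbol x\in\Omega$; put $A(c)=1/a(c,\cdot)$.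 Let $0<d_m\le d_t\le d_\ell$ and $$D(\boldsymbol u)=\phi\,[d_mI+|\boldsymbol u|(d_\ell E(\boldsymbol u)+d_t(I-E(\boldsymbol u)))],\qquad E(\boldsymbol u)=\boldsymbol u\boldsymbol u^T/|\boldsymbol u|^2 .$$ Let $\boldsymbol\gamma:\mathbb R\to\mathbb R^2$. For $\tau>0$, $N\ge 0$ and $t_n=n\tau$, let $q^{\pm,n}=q^\pm(t_n)$ and $\hat c^n=\hat c(t_n)$ be functions on $\Omega$ with $q^{\pm,n}\ge 0$, $q^{+,n}\in L^\infty(\Omega)$, $G^n:=q^{+,n}-q^{-,n}\in L^\infty(\Omega)$, $\hat c^n\in L^2(\Omega)$ for $0\le n\le N$. On every element let $S^K_{\mathcal M},S^K_{\mathcal D}$ (on $Z_h(K)$) and $S^K_{\mathcal A}$ (on $\boldsymbol V_h(K)$) be symmetric bilinear forms such that, with positive constants independent of $K$, $S^K_{\mathcal M}(z,z)$ is bounded above and below by multiples of $\|z\|_{0,K}^2$ on $Z_h(K)\cap\ker\Pi^0_{k+1}$, $S^K_{\mathcal D}(z,z)$ by multiples of $\|\nabla z\|_{0,K}^2$ on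 $Z_h(K)\cap\ker\Pi^\nabla_{k+1}$, and $S^K_{\mathcal A}(\boldsymbol v,\boldsymbol v)$ by multiples of $\|\boldsymbol v\|_{0,K}^2$ on $\boldsymbol V_h(K)\cap\ker\boldsymbol\Pi^0_k$. Forms. Let $\nu_{\mathcal M}^K=|\Pi^0_0\phi|$, $\nu_{\mathcal D}^K(\boldsymbol u)=\nu^K_{\mathcal M}(d_m+d_t|\Pi^0_0\boldsymbol u|)$, $\nu^K_{\mathcal A}(c)=|\Pi^0_0[A(\Pi^0_0c)]|$, and $$\mathcal M_h(c,z)=\sum_K\Big[\int_K\phi\,\Pi^0_{k+1}c\,\Pi^0_{k+1}z+\nu^K_{\mathcal M}S^K_{\mathcal M}((I-\Pi^0_{k+1})c,(I-\Pi^0_{k+1})z)\Big],$$ $$\mathcal D_h(\boldsymbol u;c,z)=\sum_K\Big[\int_KD(\boldsymbol\Pi^0_k\boldsymbol u)\boldsymbol\Pi^0_k\nabla c\cdot\boldsymbol\Pi^0_k\nabla z+\nu^K_{\mathcal D}(\boldsymbol u)S^K_{\mathcal D}((I-\Pi^\nabla_{k+1})c,(I-\Pi^\nabla_{k+1})z)\Big],$$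 $$\mathcal A_h(c;\boldsymbol u,\boldsymbol v)=\sum_K\Big[\int_KA(\Pi^0_{k+1}c)\boldsymbol\Pi^0_k\boldsymbol u\cdot\boldsymbol\Pi^0_k\boldsymbol v+\nu^K_{\mathcal A}(c)S^K_{\mathcal A}((I-\boldsymbol\Pi^0_k)\boldsymbol u,(I-\boldsymbol\Pi^0_k)\boldsymbol v)\Big],$$ $$\Theta^n_h(\boldsymbol u;c,z)=\tfrac12\sum_K\int_K\big[\boldsymbol\Pi^0_k\boldsymbol u\cdot\boldsymbol\Pi^0_k\nabla c\,\Pi^0_{k+1}z+(q^{+,n}+q^{-,n})\Pi^0_{k+1}c\,\Pi^0_{k+1}z-\Pi^0_{k+1}c\,\boldsymbol\Pi^0_k\boldsymbol u\cdot\boldsymbol\Pi^0_k\nabla z\big],$$ $$B(\boldsymbol v,q)=-(\mathrm{div}\,\boldsymbol v,q)_{0,\Omega},\qquad (\boldsymbol\gamma(c),\boldsymbol v)_h=\sum_K\int_K\boldsymbol\gamma(\Pi^0_{k+1}c)\cdot\boldsymbol\Pi^0_k\boldsymbol v,\qquad (q^{+,n}\hat c^n,z)_h=\sum_K\int_Kq^{+,n}\hat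 c^n\,\Pi^0_{k+1}z .$$ Scheme. Given $C^0=c_{0,h}\in Z_h$, find $C^n\in Z_h$ ($1\le n\le N$) and $(\boldsymbol U^n,P^n)\in\boldsymbol V_h\times Q_h$ ($0\le n\le N$) such that, for $n\ge 1$, $$\mathcal M_h\Big(\frac{C^n-C^{n-1}}\tau,z\Big)+\Theta^n_h(\boldsymbol U^{n-1};C^n,z)+\mathcal D_h(\boldsymbol U^{n-1};C^n,z)=(q^{+,n}\hat c^n,z)_h\quad\forall z\in Z_h,\tag{1}$$ and, for $n\ge 0$, $$\mathcal A_h(C^n;\boldsymbol U^n,\boldsymbol v)+B(\boldsymbol v,P^n)=(\boldsymbol\gamma(C^n),\boldsymbol v)_h\ \ \forall\boldsymbol v\in\boldsymbol V_h,\qquad B(\boldsymbol U^n,q)=-(G^n,q)_{0,\Omega}\ \ \forall q\in Q_h.\tag{2}$$ Claim. For every $\tau>0$ and every $N$: (i) for every $0\le n\le N$ and every $C^n\in Z_h$ with $\boldsymbol\gamma(\Pi^0_{k+1}C^n)\in[L^2(\Omega)]^2$, problem (2) has exactly one solution $(\boldsymbol U^n,P^n)\in\boldsymbol V_h\times Q_h$;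 (ii) for every $1\le n\le N$, every $C^{n-1}\in Z_h$ and every $\boldsymbol U^{n-1}\in\boldsymbol V_h$, problem (1) has exactly one solution $C^n\in Z_h$; (iii) if $\boldsymbol\gamma(\Pi^0_{k+1}C^m)\in[L^2(\Omega)]^2$ for every $m\le N$ and every iterate $C^m$ that the scheme produces when run from $C^0=c_{0,h}$ up to the concentration step $m$, then the whole scheme has exactly one solution $(C^n,\boldsymbol U^n,P^n)_{0\le n\le N}$ with $C^0=c_{0,h}$. -/

import Mathlib

open MeasureTheory Set
open scoped ContDiff

noncomputable section

namespace MiscibleVEM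

/-! ### The plane, `L²` spaces and test functions -/

/-- The Euclidean plane. -/
abbrev E2 : Type := EuclideanSpace ℝ (Fin 2)

/-- `L²(S)`. -/
abbrev L2 (S : Set E2) : Type := Lp ℝ 2 (volume.restrict S)

/-- `[L²(S)]²`. -/
abbrev L2v (S : Set E2) : Type := Lp E2 2 (volume.restrict S)

/-- Restriction of an `L²` function from `T` to a subset `S`. -/
def restrictL2 {F : Type} [NormedAddCommGroup F] {S T : Set E2} (h : S ⊆ T)
    (f : Lp F 2 (volume.restrict T)) : Lp F 2 (volume.restrict S) :=
  MemLp.toLp f ((Lp.memLp f).mono_measure (Measure.restrict_mono_set _ h))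

/-- Smooth functions on the plane with compact support contained in `U`. For `U = univ`, their
restrictions to a bounded Lipschitz domain are the functions that are smooth up to the boundary. -/
def IsTest (U : Set E2) (f : E2 → ℝ) : Prop :=
  ContDiff ℝ ∞ f ∧ HasCompactSupport f ∧ tsupport f ⊆ U

/-- The vector `(∂₂ f, -∂₁ f)`. -/
def curl (f : E2 → ℝ) (x : E2) : E2 :=
  !₂[gradient f x 1, -gradient f x 0]

/-- The determinant of two plane vectors. -/
def cross (u v : E2) : ℝ := u 0 * v 1 - u 1 * v 0

/-! ### Polygons and meshes -/

/-- A bounded convex polygonal domain: the nonempty interior of the convex hull of finitely many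
points. -/
def IsConvexPolygonalDomain (Ω : Set E2) : Prop :=
  Ω.Nonempty ∧ ∃ s : Finset E2, Ω = interior (convexHull ℝ (s : Set E2))

/-- A (not necessarily convex) open polygon that is star-shaped with respect to a ball: the domain
bounded by a simple closed polygonal line. The vertices are listed counterclockwise, indices are
cyclic, and consecutive edges may be collinear (hanging nodes count as vertices). -/
structure Polygon where
  m : ℕ
  vertex : Fin (m + 3) → E2
  carrier : Set E2
  center : E2
  radius : ℝ
  vertex_injective : Function.Injective vertex
  adjacent_edges : ∀ i, segment ℝ (vertex i) (vertex (i + 1)) ∩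
    segment ℝ (vertex (i + 1)) (vertex (i + 1 + 1)) = {vertex (i + 1)}
  nonadjacent_edges : ∀ i j, j ≠ i → j ≠ i + 1 → i ≠ j + 1 →
    Disjoint (segment ℝ (vertex i) (vertex (i + 1))) (segment ℝ (vertex j) (vertex (j + 1)))
  isOpen_carrier : IsOpen carrier
  isConnected_carrier : IsConnected carrier
  isBounded_carrier : Bornology.IsBounded carrier
  frontier_carrier : frontier carrier = ⋃ i, segment ℝ (vertex i) (vertex (i + 1))
  radius_pos : 0 < radius
  ball_subset : Metric.ball center radius ⊆ carrier
  starConvex : ∀ y ∈ Metric.ball center radius, StarConvex ℝ y carrier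
  counterclockwise : ∀ i, 0 < cross (vertex i - center) (vertex (i + 1) - center)

namespace Polygon

/-- Length of the `i`-th edge. -/
def edgeLength (K : Polygon) (i : Fin (K.m + 3)) : ℝ := dist (K.vertex i) (K.vertex (i + 1))

/-- The point with parameter `s ∈ [0, 1]` on the `i`-th edge. -/
def edgePoint (K : Polygon) (i : Fin (K.m + 3)) (s : ℝ) : E2 :=
  K.vertex i + s • (K.vertex (i + 1) - K.vertex i)

/-- The outward unit normal on the `i`-th edge. -/
def normal (K : Polygon) (i : Fin (K.m + 3)) : E2 :=
  (K.edgeLength i)⁻¹ •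
    !₂[(K.vertex (i + 1) - K.vertex i) 1, -(K.vertex (i + 1) - K.vertex i) 0]

/-- The arclength integral over the `i`-th edge of `g f`, where `g` is given as a function of the
edge parameter in `[0, 1]` and `f` as a function on the plane. -/
def edgeIntegral (K : Polygon) (i : Fin (K.m + 3)) (g : ℝ → ℝ) (f : E2 → ℝ) : ℝ :=
  K.edgeLength i * ∫ s in (0 : ℝ)..1, g s * f (K.edgePoint i s)

end Polygon

/-- A conforming decomposition of `Ω` into finitely many polygons: the elements are pairwise
disjoint, their closures cover `Ω`, and every edge of an element either lies on `∂Ω` or is also an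
edge of another element (which, lying on the other side, runs through it in the opposite
direction). -/
structure Mesh (Ω : Set E2) where
  card : ℕ
  elem : Fin card → Polygon
  subset : ∀ K, (elem K).carrier ⊆ Ω
  disjoint : ∀ K L, K ≠ L → Disjoint (elem K).carrier (elem L).carrier
  cover : Ω ⊆ ⋃ K, closure (elem K).carrier
  conforming : ∀ K i,
    segment ℝ ((elem K).vertex i) ((elem K).vertex (i + 1)) ⊆ frontier Ω ∨
    ∃ L, L ≠ K ∧ ∃ j, (elem L).vertex j = (elem K).vertex (i + 1) ∧
      (elem L).vertex (j + 1) = (elem K).vertex i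

/-! ### Polynomials and `L²` projections

Degrees are integers, so that there is no nonzero polynomial of degree at most `-1`. -/

/-- `ℙ_m(S)` as a subspace of `L²(S)`, spanned by the monomials. -/
def polyL2 (S : Set E2) (m : ℤ) : Submodule ℝ (L2 S) :=
  Submodule.span ℝ {f | ∃ i j : ℕ, (i + j : ℤ) ≤ m ∧
    f =ᵐ[volume.restrict S] fun x => x 0 ^ i * x 1 ^ j}

/-- `[ℙ_m(S)]²` as a subspace of `[L²(S)]²`. -/
def polyL2v (S : Set E2) (m : ℤ) : Submodule ℝ (L2v S) :=
  Submodule.span ℝ {f | ∃ (l : Fin 2) (i j : ℕ), (i + j : ℤ) ≤ m ∧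
    f =ᵐ[volume.restrict S] fun x => EuclideanSpace.single l (x 0 ^ i * x 1 ^ j)}

/-- The pairs `(p, ∇p)` with `p ∈ ℙ_m(S)`. -/
def polyGraph (S : Set E2) (m : ℤ) : Submodule ℝ (L2 S × L2v S) :=
  Submodule.span ℝ {f | ∃ i j : ℕ, (i + j : ℤ) ≤ m ∧
    (f.1 =ᵐ[volume.restrict S] fun x => x 0 ^ i * x 1 ^ j) ∧
    f.2 =ᵐ[volume.restrict S] gradient fun x : E2 => x 0 ^ i * x 1 ^ j}

theorem finite_index (m : ℤ) : {p : ℕ × ℕ | (p.1 + p.2 : ℤ) ≤ m}.Finite := by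
  refine ((Set.finite_Iic m.toNat).prod (Set.finite_Iic m.toNat)).subset ?_
  rintro ⟨i, j⟩ h
  simp only [Set.mem_ofPred_eq] at h
  simp only [Set.mem_prod, Set.mem_Iic]
  omega

instance (S : Set E2) (m : ℤ) : FiniteDimensional ℝ (polyL2 S m) := by
  refine FiniteDimensional.span_of_finite ℝ ?_
  refine Set.Finite.subset ((finite_index m).biUnion (t := fun p =>
    {f : L2 S | f =ᵐ[volume.restrict S] fun x => x 0 ^ p.1 * x 1 ^ p.2}) fun p _ => ?_) ?_
  · refine Set.Subsingleton.finite fun f hf g hg => ?_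
    rw [Set.mem_ofPred_eq] at hf hg
    exact Lp.ext (hf.trans hg.symm)
  · rintro f ⟨i, j, h, hf⟩
    exact Set.mem_biUnion (x := (i, j)) h hf

instance (S : Set E2) (m : ℤ) : FiniteDimensional ℝ (polyL2v S m) := by
  refine FiniteDimensional.span_of_finite ℝ ?_
  refine Set.Finite.subset (Set.finite_iUnion fun l : Fin 2 => (finite_index m).biUnion
    (t := fun p => {f : L2v S | f =ᵐ[volume.restrict S]
      fun x => EuclideanSpace.single l (x 0 ^ p.1 * x 1 ^ p.2)}) fun p _ => ?_) ?_
  · refine Set.Subsingleton.finite fun f hf g hg => ?_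
    rw [Set.mem_ofPred_eq] at hf hg
    exact Lp.ext (hf.trans hg.symm)
  · rintro f ⟨l, i, j, h, hf⟩
    exact Set.mem_iUnion.2 ⟨l, Set.mem_biUnion (x := (i, j)) h hf⟩

/-- The `L²` projector `Π⁰_m : L²(S) → ℙ_m(S)`. -/
def proj (S : Set E2) (m : ℤ) (f : L2 S) : L2 S := (polyL2 S m).starProjection f

/-- The `L²` projector `Π⁰_m : [L²(S)]² → [ℙ_m(S)]²`. -/
def projv (S : Set E2) (m : ℤ) (f : L2v S) : L2v S := (polyL2v S m).starProjection f

/-! ### Function spaces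

A function `z ∈ H¹` is represented by the pair `(z, ∇z)`, and a field `v ∈ H(div)` by the pair
`(v, div v)`; the second component is determined by the first one. -/

/-- `H¹(Ω)`: the pairs `(z, g)` with `g` the weak gradient of `z` in the open set `Ω`. -/
def H1 (Ω : Set E2) : Set (L2 Ω × L2v Ω) :=
  {z | ∀ f, IsTest Ω f →
    ∫ x in Ω, z.1 x • gradient f x = -∫ x in Ω, f x • z.2 x}

/-- `{v ∈ H(div; Ω) : v · n = 0 on ∂Ω}`: the pairs `(v, d)` with `d` the weak divergence of `v` and
vanishing normal trace, both expressed by Green's formula. -/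
def V (Ω : Set E2) : Set (L2v Ω × L2 Ω) :=
  {v | ∀ f, IsTest univ f → ∫ x in Ω, (inner ℝ (v.1 x) (gradient f x) + v.2 x * f x) = 0}

/-- `L²₀(Ω)`. -/
def Q (Ω : Set E2) : Set (L2 Ω) := {q | ∫ x in Ω, q x = 0}

/-- `t` is the trace on `∂K` of `z = (z, ∇z) ∈ H¹(K)`: the family `t` consists of square-integrable
functions of the edge parameters and
`∫_K (z ∇f + f ∇z) = ∫_{∂K} t f n` for all `f` smooth up to the boundary. This also says that the
second component of `z` is the weak gradient of the first. -/
def HasTrace (K : Polygon) (z : L2 K.carrier × L2v K.carrier) (t : Fin (K.m + 3) → ℝ → ℝ) : Prop :=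
  (∀ i, MemLp (t i) 2 (volume.restrict (Icc (0 : ℝ) 1))) ∧
  ∀ f, IsTest univ f →
    ∫ x in K.carrier, (z.1 x • gradient f x + f x • z.2 x) =
      ∑ i, K.edgeIntegral i (t i) f • K.normal i

open Classical in
/-- `∫_{∂K} z ds`, the boundary integral of the (unique) trace of `z`. -/
def boundaryIntegral (K : Polygon) (z : L2 K.carrier × L2v K.carrier) : ℝ :=
  if h : ∃ t, HasTrace K z t then ∑ i, K.edgeIntegral i (h.choose i) (fun _ => 1) else 0

/-- The projector `Π^∇_m : H¹(K) → ℙ_m(K)` (for `m ≥ 0`): the polynomial `p`, as a pair `(p, ∇p)`,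
with `(∇p, ∇q)_K = (∇z, ∇q)_K` for all `q ∈ ℙ_m(K)` and with the same mean over `∂K` as `z`. -/
def projGrad (K : Polygon) (m : ℤ) (z : L2 K.carrier × L2v K.carrier) :
    L2 K.carrier × L2v K.carrier :=
  Classical.epsilon fun p => p ∈ polyGraph K.carrier m ∧
    (∀ q ∈ polyGraph K.carrier m, inner ℝ p.2 q.2 = inner ℝ z.2 q.2) ∧
    boundaryIntegral K p = boundaryIntegral K z

/-- The local velocity space `V_h(K)`: fields `v ∈ H(div; K) ∩ H(rot; K)` with
`v · n ∈ ℙ_k(e)` on every edge, `div v ∈ ℙ_k(K)` and `rot v ∈ ℙ_{k-1}(K)`. -/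
def VhLoc (k : ℕ) (K : Polygon) : Set (L2v K.carrier × L2 K.carrier) :=
  {v | v.2 ∈ polyL2 K.carrier k ∧
    (∃ g : Fin (K.m + 3) → Polynomial ℝ, (∀ i, (g i).natDegree ≤ k) ∧
      ∀ f, IsTest univ f →
        ∫ x in K.carrier, (inner ℝ (v.1 x) (gradient f x) + v.2 x * f x) =
          ∑ i, K.edgeIntegral i (fun s => (g i).eval s) f) ∧
    ∃ r ∈ polyL2 K.carrier ((k : ℤ) - 1), ∀ f, IsTest K.carrier f →
      ∫ x in K.carrier, inner ℝ (v.1 x) (curl f x) = ∫ x in K.carrier, r x * f x}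

/-- The local enhanced concentration space `Z_h(K)`: functions `z ∈ H¹(K)` whose trace is continuous
on `∂K` and in `ℙ_{k+1}(e)` on every edge, with `Δz ∈ ℙ_{k+1}(K)` and with
`∫_K z p = ∫_K (Π^∇_{k+1} z) p` for all `p ∈ ℙ_{k+1}(K)` that are `L²`-orthogonal to `ℙ_{k-1}(K)`. -/
def ZhLoc (k : ℕ) (K : Polygon) : Set (L2 K.carrier × L2v K.carrier) :=
  {z | (∃ g : Fin (K.m + 3) → Polynomial ℝ, (∀ i, (g i).natDegree ≤ k + 1) ∧
      (∀ i, (g i).eval 1 = (g (i + 1)).eval 0) ∧ HasTrace K z fun i s => (g i).eval s) ∧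
    (∃ d ∈ polyL2 K.carrier ((k : ℤ) + 1), ∀ f, IsTest K.carrier f →
      ∫ x in K.carrier, inner ℝ (z.2 x) (gradient f x) = -∫ x in K.carrier, d x * f x) ∧
    ∀ p ∈ polyL2 K.carrier ((k : ℤ) + 1), (∀ q ∈ polyL2 K.carrier ((k : ℤ) - 1), inner ℝ p q = 0) →
      (inner ℝ z.1 p : ℝ) = inner ℝ (projGrad K ((k : ℤ) + 1) z).1 p}

section Global

variable {Ω : Set E2}

/-- Restriction of a scalar function to an element. -/
def Mesh.res (M : Mesh Ω) (K : Fin M.card) (f : L2 Ω) : L2 (M.elem K).carrier :=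
  restrictL2 (M.subset K) f

/-- Restriction of a vector field to an element. -/
def Mesh.resv (M : Mesh Ω) (K : Fin M.card) (f : L2v Ω) : L2v (M.elem K).carrier :=
  restrictL2 (M.subset K) f

/-- The discrete velocity space `V_h`. -/
def Vh (k : ℕ) (M : Mesh Ω) : Set (L2v Ω × L2 Ω) :=
  {v | v ∈ V Ω ∧ ∀ K, (M.resv K v.1, M.res K v.2) ∈ VhLoc k (M.elem K)}

/-- The discrete pressure space `Q_h`. -/
def Qh (k : ℕ) (M : Mesh Ω) : Set (L2 Ω) :=
  {q | q ∈ Q Ω ∧ ∀ K, M.res K q ∈ polyL2 (M.elem K).carrier k}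

/-- The discrete concentration space `Z_h`. -/
def Zh (k : ℕ) (M : Mesh Ω) : Set (L2 Ω × L2v Ω) :=
  {z | z ∈ H1 Ω ∧ ∀ K, (M.res K z.1, M.resv K z.2) ∈ ZhLoc k (M.elem K)}

/-! ### Data -/

/-- Data of the porous medium and the fluid that do not depend on time: porosity `φ(x)`, the
coefficient `a(c, x)` (permeability over viscosity), the gravity force density `γ(c)` and the
diffusion and dispersion coefficients. -/
structure Medium (Ω : Set E2) where
  φ : E2 → ℝ
  a : ℝ → E2 → ℝ
  γ : ℝ → E2
  dm : ℝ
  dl : ℝ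
  dt : ℝ
  measurable_φ : AEMeasurable φ (volume.restrict Ω)
  measurable_a : Measurable (Function.uncurry a)
  bounds_φ : ∃ lo hi : ℝ, 0 < lo ∧ ∀ x ∈ Ω, lo ≤ φ x ∧ φ x ≤ hi
  bounds_a : ∃ lo hi : ℝ, 0 < lo ∧ ∀ c, ∀ x ∈ Ω, lo ≤ a c x ∧ a c x ≤ hi
  dm_pos : 0 < dm
  dm_le_dt : dm ≤ dt
  dt_le_dl : dt ≤ dl

/-- The diffusion tensor
`D(u)(x) = φ(x) [d_m I + |u| (d_ℓ E(u) + d_t (I - E(u)))]`, `E(u) = u uᵀ / |u|²`. -/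
def Medium.diffusion (med : Medium Ω) (x u : E2) : Matrix (Fin 2) (Fin 2) ℝ :=
  let E : Matrix (Fin 2) (Fin 2) ℝ := Matrix.of fun i j => u i * u j / ‖u‖ ^ 2
  med.φ x • (med.dm • (1 : Matrix (Fin 2) (Fin 2) ℝ) + ‖u‖ • (med.dl • E + med.dt • (1 - E)))

/-- The stabilizations of the three forms: on every element, symmetric bilinear forms on the local
discrete spaces that are equivalent to the respective (semi)norms on the kernels of the projectors
(hence positive definite there). A bilinear form on a subspace is represented here by any bilinear
extension of it to `L²(K)`, and nothing is required of it outside the local discrete space. -/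
structure Stabilization (k : ℕ) (M : Mesh Ω) where
  SM : ∀ K, L2 (M.elem K).carrier →ₗ[ℝ] L2 (M.elem K).carrier →ₗ[ℝ] ℝ
  SD : ∀ K, L2 (M.elem K).carrier →ₗ[ℝ] L2 (M.elem K).carrier →ₗ[ℝ] ℝ
  SA : ∀ K, L2v (M.elem K).carrier →ₗ[ℝ] L2v (M.elem K).carrier →ₗ[ℝ] ℝ
  symm_SM : ∀ K, ∀ z ∈ ZhLoc k (M.elem K), ∀ w ∈ ZhLoc k (M.elem K), SM K z.1 w.1 = SM K w.1 z.1
  symm_SD : ∀ K, ∀ z ∈ ZhLoc k (M.elem K), ∀ w ∈ ZhLoc k (M.elem K), SD K z.1 w.1 = SD K w.1 z.1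
  symm_SA : ∀ K, ∀ v ∈ VhLoc k (M.elem K), ∀ w ∈ VhLoc k (M.elem K), SA K v.1 w.1 = SA K w.1 v.1
  bounds_SM : ∃ M₀ M₁ : ℝ, 0 < M₀ ∧ 0 < M₁ ∧ ∀ K, ∀ z ∈ ZhLoc k (M.elem K),
    proj (M.elem K).carrier ((k : ℤ) + 1) z.1 = 0 →
      M₀ * ‖z.1‖ ^ 2 ≤ SM K z.1 z.1 ∧ SM K z.1 z.1 ≤ M₁ * ‖z.1‖ ^ 2
  bounds_SD : ∃ M₀ M₁ : ℝ, 0 < M₀ ∧ 0 < M₁ ∧ ∀ K, ∀ z ∈ ZhLoc k (M.elem K),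
    projGrad (M.elem K) ((k : ℤ) + 1) z = 0 →
      M₀ * ‖z.2‖ ^ 2 ≤ SD K z.1 z.1 ∧ SD K z.1 z.1 ≤ M₁ * ‖z.2‖ ^ 2
  bounds_SA : ∃ M₀ M₁ : ℝ, 0 < M₀ ∧ 0 < M₁ ∧ ∀ K, ∀ v ∈ VhLoc k (M.elem K),
    projv (M.elem K).carrier k v.1 = 0 →
      M₀ * ‖v.1‖ ^ 2 ≤ SA K v.1 v.1 ∧ SA K v.1 v.1 ≤ M₁ * ‖v.1‖ ^ 2

/-! ### Discrete forms -/

/-- The elementwise projection `Π⁰_{k+1} c` on the element `K`. -/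
def Mesh.pr (M : Mesh Ω) (k : ℕ) (K : Fin M.card) (c : L2 Ω) : L2 (M.elem K).carrier :=
  proj (M.elem K).carrier ((k : ℤ) + 1) (M.res K c)

/-- The elementwise projection `Π⁰_k v` of a vector field on the element `K`. -/
def Mesh.prv (M : Mesh Ω) (k : ℕ) (K : Fin M.card) (v : L2v Ω) : L2v (M.elem K).carrier :=
  projv (M.elem K).carrier k (M.resv K v)

/-- `ν_M^K(φ) = |Π⁰_0 φ|`; the projection onto constants is the mean value. -/
def nuM (M : Mesh Ω) (med : Medium Ω) (K : Fin M.card) : ℝ :=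
  |⨍ x in (M.elem K).carrier, med.φ x|

/-- `ν_D^K(u) = ν_M^K(φ) (d_m + d_t |Π⁰_0 u|)`. -/
def nuD (M : Mesh Ω) (med : Medium Ω) (K : Fin M.card) (u : L2v Ω) : ℝ :=
  nuM M med K * (med.dm + med.dt * ‖⨍ x in (M.elem K).carrier, u x‖)

/-- `ν_A^K(c) = |A(Π⁰_0 c)|`, `A = 1 / a`; since `A` may also depend on `x`, its mean value over the
element is taken. -/
def nuA (M : Mesh Ω) (med : Medium Ω) (K : Fin M.card) (c : L2 Ω) : ℝ :=
  |⨍ x in (M.elem K).carrier, (med.a (⨍ y in (M.elem K).carrier, c y) x)⁻¹|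

/-- The form `M_h(c, z)`. -/
def Mh (k : ℕ) (M : Mesh Ω) (med : Medium Ω) (S : Stabilization k M) (c z : L2 Ω × L2v Ω) : ℝ :=
  ∑ K, ((∫ x in (M.elem K).carrier, med.φ x * M.pr k K c.1 x * M.pr k K z.1 x) +
    nuM M med K * S.SM K (M.res K c.1 - M.pr k K c.1) (M.res K z.1 - M.pr k K z.1))

/-- The form `D_h(u; c, z)`. -/
def Dh (k : ℕ) (M : Mesh Ω) (med : Medium Ω) (S : Stabilization k M) (u : L2v Ω)
    (c z : L2 Ω × L2v Ω) : ℝ :=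
  ∑ K, ((∫ x in (M.elem K).carrier,
      (med.diffusion x (M.prv k K u x)).mulVec (M.prv k K c.2 x) ⬝ᵥ (M.prv k K z.2 x)) +
    nuD M med K u * S.SD K
      (M.res K c.1 - (projGrad (M.elem K) ((k : ℤ) + 1) (M.res K c.1, M.resv K c.2)).1)
      (M.res K z.1 - (projGrad (M.elem K) ((k : ℤ) + 1) (M.res K z.1, M.resv K z.2)).1))

/-- The form `Θ_h(u; c, z)` with source terms `q⁺`, `q⁻`. -/
def Thetah (k : ℕ) (M : Mesh Ω) (qp qm : E2 → ℝ) (u : L2v Ω) (c z : L2 Ω × L2v Ω) : ℝ :=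
  1 / 2 * ((∑ K, ∫ x in (M.elem K).carrier,
        (inner ℝ (M.prv k K u x) (M.prv k K c.2 x) : ℝ) * M.pr k K z.1 x) +
    (∑ K, ∫ x in (M.elem K).carrier, (qp x + qm x) * M.pr k K c.1 x * M.pr k K z.1 x) -
    ∑ K, ∫ x in (M.elem K).carrier,
        M.pr k K c.1 x * (inner ℝ (M.prv k K u x) (M.prv k K z.2 x) : ℝ))

/-- The right-hand side `(q⁺ ĉ, z)_h`. -/
def sourceh (k : ℕ) (M : Mesh Ω) (qp chat : E2 → ℝ) (z : L2 Ω × L2v Ω) : ℝ :=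
  ∑ K, ∫ x in (M.elem K).carrier, qp x * chat x * M.pr k K z.1 x

/-- The form `A_h(c; u, v)`. -/
def Ah (k : ℕ) (M : Mesh Ω) (med : Medium Ω) (S : Stabilization k M) (c : L2 Ω)
    (u v : L2v Ω × L2 Ω) : ℝ :=
  ∑ K, ((∫ x in (M.elem K).carrier, (med.a (M.pr k K c x) x)⁻¹ *
      (inner ℝ (M.prv k K u.1 x) (M.prv k K v.1 x) : ℝ)) +
    nuA M med K c * S.SA K (M.resv K u.1 - M.prv k K u.1) (M.resv K v.1 - M.prv k K v.1))

/-- The form `B(v, q) = -(div v, q)`. -/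
def B (v : L2v Ω × L2 Ω) (q : L2 Ω) : ℝ := -∫ x in Ω, v.2 x * q x

/-- The right-hand side `(γ(c), v)_h`. -/
def gammah (k : ℕ) (M : Mesh Ω) (med : Medium Ω) (c : L2 Ω) (v : L2v Ω × L2 Ω) : ℝ :=
  ∑ K, ∫ x in (M.elem K).carrier, (inner ℝ (med.γ (M.pr k K c x)) (M.prv k K v.1 x) : ℝ)

/-- The gravity term `γ(Π⁰_{k+1} c)`, as it enters the scheme, is in `[L²(Ω)]²`. -/
def GravityL2 (k : ℕ) (M : Mesh Ω) (med : Medium Ω) (c : L2 Ω) : Prop :=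
  ∀ K, MemLp (fun x => med.γ (M.pr k K c x)) 2 (volume.restrict (M.elem K).carrier)

/-! ### The fully discrete scheme -/

/-- `(u, p)` solves the mixed problem with concentration `c` and source terms `q⁺`, `q⁻`. -/
def SolvesMixed (k : ℕ) (M : Mesh Ω) (med : Medium Ω) (S : Stabilization k M) (qp qm : E2 → ℝ)
    (c : Zh k M) (u : Vh k M) (p : Qh k M) : Prop :=
  (∀ v : Vh k M, Ah k M med S c.1.1 u v + B v.1 p.1 = gammah k M med c.1.1 v) ∧
  ∀ q : Qh k M, B u.1 q.1 = -∫ x in Ω, (qp x - qm x) * q.1 x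

/-- `c` solves the concentration equation with time step `τ`, previous concentration `c'`, previous
velocity `u'`, source terms `q⁺`, `q⁻` and injected concentration `ĉ`. -/
def SolvesConcentration (k : ℕ) (M : Mesh Ω) (med : Medium Ω) (S : Stabilization k M) (τ : ℝ)
    (qp qm chat : E2 → ℝ) (c' : Zh k M) (u' : Vh k M) (c : Zh k M) : Prop :=
  ∀ z : Zh k M,
    Mh k M med S (τ⁻¹ • (c.1 - c'.1)) z + Thetah k M qp qm u'.1.1 c z +
      Dh k M med S u'.1.1 c z = sourceh k M qp chat z

end Global

end MiscibleVEM

end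

noncomputable section

namespace MiscibleVEM

/-! ### The cone parametrization of a star-shaped polygon -/

/-- The open unit square. -/
def unitSquare : Set E2 := {p | p 0 ∈ Ioo (0 : ℝ) 1 ∧ p 1 ∈ Ioo (0 : ℝ) 1}

theorem isOpen_unitSquare : IsOpen unitSquare := by
  refine IsOpen.inter (isOpen_Ioo.preimage ?_) (isOpen_Ioo.preimage ?_) <;> fun_prop

theorem E2.ext {x y : E2} (h0 : x 0 = y 0) (h1 : x 1 = y 1) : x = y := by
  ext i; fin_cases i <;> assumption

theorem E2.inner_eq (x y : E2) : (inner ℝ x y : ℝ) = x 0 * y 0 + x 1 * y 1 := by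
  simp [PiLp.inner_apply, Fin.sum_univ_two]; ring

theorem integral_unitSquare {F : Type*} [NormedAddCommGroup F] [NormedSpace ℝ F] (f : ℝ → ℝ → F) :
    ∫ p in unitSquare, f (p 0) (p 1) =
      ∫ q in Ioo (0 : ℝ) 1 ×ˢ Ioo (0 : ℝ) 1, f q.1 q.2 := by
  have h := ((volume_preserving_finTwoArrow ℝ).comp
    (EuclideanSpace.volume_preserving_symm_measurableEquiv_toLp (Fin 2)))
  rw [← h.setIntegral_preimage_emb]
  · rfl
  · exact (MeasurableEquiv.measurableEmbedding _).comp (MeasurableEquiv.measurableEmbedding _)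

namespace Polygon

variable (K : Polygon)

/-- The `i`-th edge vector. -/
def edgeVec (i : Fin (K.m + 3)) : E2 := K.vertex (i + 1) - K.vertex i

/-- The parametrization of the triangle spanned by the center and the `i`-th edge. -/
def cone (i : Fin (K.m + 3)) (p : E2) : E2 := K.center + p 0 • (K.edgePoint i (p 1) - K.center)

/-- Twice the area of the triangle spanned by the center and the `i`-th edge. -/
def coneArea (i : Fin (K.m + 3)) : ℝ :=
  cross (K.vertex i - K.center) (K.vertex (i + 1) - K.center)

/-- The open triangle spanned by the center and the `i`-th edge. -/
def triangle (i : Fin (K.m + 3)) : Set E2 := K.cone i '' unitSquare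

theorem coneArea_pos (i : Fin (K.m + 3)) : 0 < K.coneArea i := K.counterclockwise i

theorem edgePoint_zero (i : Fin (K.m + 3)) : K.edgePoint i 0 = K.vertex i := by simp [edgePoint]

theorem edgePoint_one (i : Fin (K.m + 3)) : K.edgePoint i 1 = K.vertex (i + 1) := by
  simp [edgePoint]

theorem edgePoint_mem_segment (i : Fin (K.m + 3)) {s : ℝ} (hs : s ∈ Icc (0 : ℝ) 1) :
    K.edgePoint i s ∈ segment ℝ (K.vertex i) (K.vertex (i + 1)) := by
  rw [segment_eq_image']; exact ⟨s, hs, rfl⟩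

theorem exists_edgePoint {i : Fin (K.m + 3)} {x : E2}
    (hx : x ∈ segment ℝ (K.vertex i) (K.vertex (i + 1))) :
    ∃ s ∈ Icc (0 : ℝ) 1, K.edgePoint i s = x := by
  rw [segment_eq_image'] at hx; exact hx

theorem edgePoint_mem_frontier (i : Fin (K.m + 3)) {s : ℝ} (hs : s ∈ Icc (0 : ℝ) 1) :
    K.edgePoint i s ∈ frontier K.carrier := by
  rw [K.frontier_carrier]; exact mem_iUnion.2 ⟨i, K.edgePoint_mem_segment i hs⟩

theorem center_mem : K.center ∈ K.carrier := K.ball_subset (Metric.mem_ball_self K.radius_pos)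

theorem succ_ne (i : Fin (K.m + 3)) : i + 1 ≠ i := by
  simp

theorem vertex_succ_ne (i : Fin (K.m + 3)) : K.vertex (i + 1) ≠ K.vertex i :=
  fun h => K.succ_ne i (K.vertex_injective h)

theorem edgeVec_ne_zero (i : Fin (K.m + 3)) : K.edgeVec i ≠ 0 := sub_ne_zero.2 (K.vertex_succ_ne i)

theorem edgeLength_pos (i : Fin (K.m + 3)) : 0 < K.edgeLength i :=
  dist_pos.2 (K.vertex_succ_ne i).symm

theorem edgePoint_injective (i : Fin (K.m + 3)) : Function.Injective (K.edgePoint i) := by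
  intro s t h
  simp only [edgePoint, add_right_inj] at h
  exact smul_left_injective ℝ (K.edgeVec_ne_zero i) h

/-- Contractions towards points near the center map the closure of a polygon into its interior. -/
theorem contract_mem {x e : E2} (hx : x ∈ closure K.carrier) {r : ℝ} (h0 : 0 ≤ r) (h1 : r < 1)
    (he : ‖e‖ < (1 - r) * K.radius) : K.center + r • (x - K.center) + e ∈ K.carrier := by
  have h1' : 0 < 1 - r := by linarith
  set δ := (1 - r) * K.radius - ‖e‖ with hδ
  have hδ0 : 0 < δ := by linarith
  obtain ⟨y, hy, hxy⟩ := Metric.mem_closure_iff.1 hx δ hδ0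
  set b := K.center + (1 - r)⁻¹ • (r • (x - y) + e) with hb
  have hbb : b ∈ Metric.ball K.center K.radius := by
    rw [Metric.mem_ball, dist_eq_norm, hb, add_sub_cancel_left, norm_smul, norm_inv,
      Real.norm_of_nonneg h1'.le, inv_mul_lt_iff₀ h1']
    have : ‖r • (x - y)‖ ≤ ‖x - y‖ := by
      rw [norm_smul, Real.norm_of_nonneg h0]
      exact mul_le_of_le_one_left (norm_nonneg _) h1.le
    rw [dist_eq_norm] at hxy
    calc _ ≤ ‖r • (x - y)‖ + ‖e‖ := norm_add_le _ _
      _ < _ := by linarith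
  have := K.starConvex b hbb hy h1'.le h0 (by ring)
  convert this using 1
  rw [hb, smul_add, smul_inv_smul₀ h1'.ne']
  module

theorem ray_mem {x : E2} (hx : x ∈ closure K.carrier) {r : ℝ} (h0 : 0 ≤ r) (h1 : r < 1) :
    K.center + r • (x - K.center) ∈ K.carrier := by
  have := K.contract_mem (e := 0) hx h0 h1
    (by rw [norm_zero]; exact mul_pos (by linarith) K.radius_pos)
  simpa using this

theorem not_mem_of_frontier {x : E2} (hx : x ∈ frontier K.carrier) : x ∉ K.carrier := by
  rw [K.isOpen_carrier.frontier_eq] at hx; exact hx.2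

theorem triangle_subset (i : Fin (K.m + 3)) : K.triangle i ⊆ K.carrier := by
  rintro _ ⟨p, ⟨h0, h1⟩, rfl⟩
  exact K.ray_mem (frontier_subset_closure (K.edgePoint_mem_frontier i (Ioo_subset_Icc_self h1)))
    h0.1.le h0.2

theorem edgePoint_eq_imp {i j : Fin (K.m + 3)} {s t : ℝ} (hs : s ∈ Ioo (0 : ℝ) 1)
    (ht : t ∈ Icc (0 : ℝ) 1) (h : K.edgePoint i s = K.edgePoint j t) : i = j := by
  have hs' := Ioo_subset_Icc_self hs
  by_contra hij
  by_cases h1 : j = i + 1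
  · subst h1
    have : K.edgePoint i s ∈ ({K.vertex (i + 1)} : Set E2) := by
      rw [← K.adjacent_edges i]
      exact ⟨K.edgePoint_mem_segment i hs', h ▸ K.edgePoint_mem_segment _ ht⟩
    rw [mem_singleton_iff, ← K.edgePoint_one] at this
    exact hs.2.ne (K.edgePoint_injective i this)
  by_cases h2 : i = j + 1
  · subst h2
    have : K.edgePoint (j + 1) s ∈ ({K.vertex (j + 1)} : Set E2) := by
      rw [← K.adjacent_edges j]
      exact ⟨h ▸ K.edgePoint_mem_segment _ ht, K.edgePoint_mem_segment _ hs'⟩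
    rw [mem_singleton_iff, ← K.edgePoint_zero (j + 1)] at this
    exact hs.1.ne' (K.edgePoint_injective _ this)
  exact (K.nonadjacent_edges i j (Ne.symm hij) h1 h2).ne_of_mem (K.edgePoint_mem_segment i hs')
    (K.edgePoint_mem_segment j ht) h

theorem cone_eq_imp {i j : Fin (K.m + 3)} {p q : E2} (hp : p ∈ unitSquare) (hq : q ∈ unitSquare)
    (h : K.cone i p = K.cone j q) : p 0 = q 0 ∧ K.edgePoint i (p 1) = K.edgePoint j (q 1) := by
  have key : ∀ (i j : Fin (K.m + 3)) (p q : E2), p ∈ unitSquare → q ∈ unitSquare →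
      K.cone i p = K.cone j q → p 0 ≤ q 0 := by
    intro i j p q hp hq h
    by_contra! hlt
    refine K.not_mem_of_frontier (K.edgePoint_mem_frontier i (Ioo_subset_Icc_self hp.2)) ?_
    have hp0 := hp.1.1
    have hq0 := hq.1.1
    have := K.ray_mem (frontier_subset_closure (K.edgePoint_mem_frontier j
      (Ioo_subset_Icc_self hq.2))) (div_nonneg hq0.le hp0.le) ((div_lt_one hp0).2 hlt)
    convert this using 1
    simp only [cone, add_right_inj] at h
    rw [div_eq_inv_mul, mul_smul, ← h, inv_smul_smul₀ hp0.ne']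
    abel
  have h0 := le_antisymm (key i j p q hp hq h) (key j i q p hq hp h.symm)
  refine ⟨h0, ?_⟩
  simp only [cone, add_right_inj, h0] at h
  exact sub_left_injective (smul_right_injective E2 hq.1.1.ne' h)

theorem cone_injOn (i : Fin (K.m + 3)) : InjOn (K.cone i) unitSquare := by
  intro p hp q hq h
  obtain ⟨h0, h1⟩ := K.cone_eq_imp hp hq h
  exact E2.ext h0 (K.edgePoint_injective i h1)

theorem triangle_disjoint {i j : Fin (K.m + 3)} (hij : i ≠ j) :
    Disjoint (K.triangle i) (K.triangle j) := by
  rw [Set.disjoint_left]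
  rintro _ ⟨p, hp, rfl⟩ ⟨q, hq, h⟩
  exact hij (K.edgePoint_eq_imp hp.2 (Ioo_subset_Icc_self hq.2) (K.cone_eq_imp hq hp h).2.symm)

theorem exists_ray_frontier {x : E2} (hx : x ∈ K.carrier) (hne : x ≠ K.center) :
    ∃ r ∈ Ioo (0 : ℝ) 1, ∃ y ∈ frontier K.carrier, x = K.center + r • (y - K.center) := by
  obtain ⟨R, hR⟩ := K.isBounded_carrier.subset_closedBall K.center
  set g : ℝ → E2 := fun t => K.center + t • (x - K.center) with hg
  have hgc : Continuous g := by fun_prop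
  have hnorm : 0 < ‖x - K.center‖ := norm_pos_iff.2 (sub_ne_zero.2 hne)
  obtain ⟨T, hT1, hT⟩ : ∃ T, 1 ≤ T ∧ g T ∉ K.carrier := by
    refine ⟨max 1 ((|R| + 1) / ‖x - K.center‖), le_max_left _ _, fun h => ?_⟩
    have := hR h
    rw [Metric.mem_closedBall, dist_eq_norm] at this
    simp only [hg, add_sub_cancel_left, norm_smul] at this
    rw [Real.norm_of_nonneg (by positivity)] at this
    have h2 : (|R| + 1) ≤ max 1 ((|R| + 1) / ‖x - K.center‖) * ‖x - K.center‖ := by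
      rw [← div_le_iff₀ hnorm]; exact le_max_right _ _
    linarith [le_abs_self R]
  have hpre : IsPreconnected (g '' Icc 1 T) := isPreconnected_Icc.image _ hgc.continuousOn
  have h1 : g 1 = x := by simp [hg]
  obtain ⟨t, ht, hy⟩ : ∃ t ∈ Icc 1 T, g t ∈ frontier K.carrier := by
    by_contra! hcon
    obtain ⟨z, -, hz, hz'⟩ := hpre K.carrier (closure K.carrier)ᶜ K.isOpen_carrier
      isClosed_closure.isOpen_compl (by
        rintro _ ⟨t, ht, rfl⟩
        by_contra h
        simp only [mem_union, mem_compl_iff, not_or, not_not] at h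
        exact hcon t ht (K.isOpen_carrier.frontier_eq ▸ ⟨h.2, h.1⟩))
      ⟨x, ⟨1, ⟨le_rfl, hT1⟩, h1⟩, hx⟩
      ⟨g T, ⟨T, ⟨hT1, le_rfl⟩, rfl⟩, fun h => hcon T ⟨hT1, le_rfl⟩
        (K.isOpen_carrier.frontier_eq ▸ ⟨h, hT⟩)⟩
    exact hz' (subset_closure hz)
  have ht1 : 1 < t := by
    refine lt_of_le_of_ne ht.1 ?_
    rintro rfl
    rw [h1] at hy
    exact K.not_mem_of_frontier hy hx
  refine ⟨t⁻¹, ⟨by positivity, inv_lt_one_of_one_lt₀ ht1⟩, g t, hy, ?_⟩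
  simp only [hg, add_sub_cancel_left]
  rw [inv_smul_smul₀ (by positivity)]
  abel

theorem volume_line (a b : E2) : volume (range fun t : ℝ => a + t • b) = 0 := by
  have hne : AffineSubspace.mk' a (Submodule.span ℝ {b}) ≠ ⊤ := by
    intro h
    have h2 := congrArg AffineSubspace.direction h
    rw [AffineSubspace.direction_mk', AffineSubspace.direction_top] at h2
    have h3 := finrank_span_le_card (R := ℝ) ({b} : Set E2)
    rw [h2] at h3
    simp at h3
  refine measure_mono_null ?_ (Measure.addHaar_affineSubspace volume _ hne)
  rintro _ ⟨t, rfl⟩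
  simp only [SetLike.mem_coe, AffineSubspace.mem_mk', vsub_eq_sub, add_sub_cancel_left]
  exact Submodule.smul_mem _ _ (Submodule.mem_span_singleton_self b)

theorem carrier_subset : K.carrier ⊆ (⋃ i, K.triangle i) ∪
    ⋃ i, range fun t : ℝ => K.center + t • (K.vertex i - K.center) := by
  intro x hx
  by_cases hc : x = K.center
  · exact Or.inr (mem_iUnion.2 ⟨0, 0, by simp [hc]⟩)
  obtain ⟨r, hr, y, hy, rfl⟩ := K.exists_ray_frontier hx hc
  rw [K.frontier_carrier] at hy
  obtain ⟨i, hi⟩ := mem_iUnion.1 hy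
  obtain ⟨s, hs, rfl⟩ := K.exists_edgePoint hi
  rcases hs.1.eq_or_lt with rfl | h0
  · exact Or.inr (mem_iUnion.2 ⟨i, r, by rw [edgePoint_zero]⟩)
  rcases hs.2.eq_or_lt with rfl | h1
  · exact Or.inr (mem_iUnion.2 ⟨i + 1, r, by rw [edgePoint_one]⟩)
  exact Or.inl (mem_iUnion.2 ⟨i, !₂[r, s], ⟨by simpa using hr, by simpa using ⟨h0, h1⟩⟩,
    by simp [cone]⟩)

theorem carrier_ae_eq : K.carrier =ᵐ[volume] ⋃ i, K.triangle i := by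
  refine Filter.EventuallyLE.antisymm ?_ (LE.le.eventuallyLE (iUnion_subset K.triangle_subset))
  rw [ae_le_set]
  refine measure_mono_null (sdiff_subset_iff.2 K.carrier_subset) ?_
  exact measure_iUnion_null fun i => volume_line _ _

theorem volume_frontier : volume (frontier K.carrier) = 0 := by
  rw [K.frontier_carrier]
  refine measure_iUnion_null fun i =>
    measure_mono_null ?_ (volume_line (K.vertex i) (K.vertex (i + 1) - K.vertex i))
  rw [segment_eq_image']
  exact image_subset_range _ _

/-- The derivative of the cone parametrization. -/
def coneDeriv (i : Fin (K.m + 3)) (p : E2) : E2 →L[ℝ] E2 :=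
  p 0 • ((EuclideanSpace.proj 1 : E2 →L[ℝ] ℝ).smulRight (K.edgeVec i)) +
    (EuclideanSpace.proj 0 : E2 →L[ℝ] ℝ).smulRight (K.edgePoint i (p 1) - K.center)

theorem hasFDerivAt_cone (i : Fin (K.m + 3)) (p : E2) :
    HasFDerivAt (K.cone i) (K.coneDeriv i p) p := by
  have h0 : HasFDerivAt (fun p : E2 => p 0) (EuclideanSpace.proj 0 : E2 →L[ℝ] ℝ) p :=
    (EuclideanSpace.proj 0 : E2 →L[ℝ] ℝ).hasFDerivAt
  have h1 : HasFDerivAt (fun p : E2 => p 1) (EuclideanSpace.proj 1 : E2 →L[ℝ] ℝ) p :=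
    (EuclideanSpace.proj 1 : E2 →L[ℝ] ℝ).hasFDerivAt
  exact (h0.smul (((h1.smul_const (K.edgeVec i)).const_add (K.vertex i)).sub_const
    K.center)).const_add K.center

theorem coneDeriv_det (i : Fin (K.m + 3)) (p : E2) :
    (K.coneDeriv i p).det = p 0 * K.coneArea i := by
  rw [ContinuousLinearMap.det, ← LinearMap.det_toMatrix (EuclideanSpace.basisFun (Fin 2) ℝ).toBasis,
    Matrix.det_fin_two]
  simp [LinearMap.toMatrix_apply, coneDeriv, edgePoint, edgeVec, coneArea, cross]
  ring

theorem measurableSet_triangle (i : Fin (K.m + 3)) : MeasurableSet (K.triangle i) :=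
  measurable_image_of_fderivWithin isOpen_unitSquare.measurableSet
    (fun p _ => (K.hasFDerivAt_cone i p).hasFDerivWithinAt) (K.cone_injOn i)

theorem abs_det_coneDeriv (i : Fin (K.m + 3)) {p : E2} (hp : p ∈ unitSquare) :
    |(K.coneDeriv i p).det| = K.coneArea i * p 0 := by
  rw [coneDeriv_det, abs_of_pos (mul_pos hp.1.1 (K.coneArea_pos i)), mul_comm]

theorem setIntegral_eq_sum_cone {F : Type*} [NormedAddCommGroup F] [NormedSpace ℝ F] {f : E2 → F}
    (hf : IntegrableOn f K.carrier) :
    ∫ x in K.carrier, f x =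
      ∑ i, ∫ p in unitSquare, (K.coneArea i * p 0) • f (K.cone i p) := by
  rw [setIntegral_congr_set K.carrier_ae_eq, integral_iUnion_fintype K.measurableSet_triangle
    (fun i j h => K.triangle_disjoint h) fun i => hf.mono_set (K.triangle_subset i)]
  refine Finset.sum_congr rfl fun i _ => ?_
  rw [triangle, integral_image_eq_integral_abs_det_fderiv_smul volume
    isOpen_unitSquare.measurableSet (fun p _ => (K.hasFDerivAt_cone i p).hasFDerivWithinAt)
    (K.cone_injOn i)]
  exact setIntegral_congr_fun isOpen_unitSquare.measurableSet fun p hp => by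
    simp only [K.abs_det_coneDeriv i hp]

end Polygon

end MiscibleVEM

end


noncomputable section

namespace MiscibleVEM

theorem integral_unitSquare_eq_left {F : Type*} [NormedAddCommGroup F] [NormedSpace ℝ F]
    {f : ℝ → ℝ → F} (hf : Continuous (Function.uncurry f)) :
    ∫ p in unitSquare, f (p 0) (p 1) = ∫ r in (0 : ℝ)..1, ∫ s in (0 : ℝ)..1, f r s := by
  rw [integral_unitSquare, Measure.volume_eq_prod, setIntegral_prod]
  · simp only [intervalIntegral.integral_of_le zero_le_one, integral_Ioc_eq_integral_Ioo]
  · exact (hf.continuousOn.integrableOn_compact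
      (isCompact_Icc (a := (0 : ℝ)) (b := 1) |>.prod isCompact_Icc)).mono_set
      (prod_mono Ioo_subset_Icc_self Ioo_subset_Icc_self)

theorem integral_unitSquare_eq_right {F : Type*} [NormedAddCommGroup F] [NormedSpace ℝ F]
    {f : ℝ → ℝ → F} (hf : Continuous (Function.uncurry f)) :
    ∫ p in unitSquare, f (p 0) (p 1) = ∫ s in (0 : ℝ)..1, ∫ r in (0 : ℝ)..1, f r s := by
  rw [integral_unitSquare, Measure.volume_eq_prod, ← Measure.prod_restrict, integral_prod_symm]
  · simp only [intervalIntegral.integral_of_le zero_le_one, integral_Ioc_eq_integral_Ioo]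
  · rw [Measure.prod_restrict, ← Measure.volume_eq_prod]
    exact (hf.continuousOn.integrableOn_compact
      (isCompact_Icc (a := (0 : ℝ)) (b := 1) |>.prod isCompact_Icc)).mono_set
      (prod_mono Ioo_subset_Icc_self Ioo_subset_Icc_self)

theorem integrableOn_unitSquare_of_continuous {F : Type*} [NormedAddCommGroup F]
    {f : E2 → F} (hf : Continuous f) : IntegrableOn f unitSquare := by
  refine (hf.continuousOn.integrableOn_compact (isCompact_closedBall (0 : E2) 2)).mono_set ?_
  rintro p ⟨h0, h1⟩
  rw [mem_closedBall_zero_iff, EuclideanSpace.norm_eq, Fin.sum_univ_two, Real.norm_eq_abs,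
    Real.norm_eq_abs, sq_abs, sq_abs]
  refine Real.sqrt_le_iff.2 ⟨by norm_num, ?_⟩
  nlinarith [h0.1, h0.2, h1.1, h1.2]

namespace Polygon

variable (K : Polygon)

theorem continuous_edgePoint (i : Fin (K.m + 3)) : Continuous (K.edgePoint i) := by
  unfold edgePoint; fun_prop

/-- Integration by parts on the triangles of a star-shaped polygon for a field with radial
component `a` and tangential component `b` which is divergence-free (`b' = -a`) and has matching
fluxes across the sides that meet in the center. -/
theorem sum_cone_integral {a b : Fin (K.m + 3) → ℝ → ℝ} (ha : ∀ i, Continuous (a i))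
    (hb : ∀ i s, HasDerivAt (b i) (-a i s) s) (hab : ∀ i, b i 1 = b (i + 1) 0)
    {f : E2 → ℝ} (hf : ContDiff ℝ 1 f) :
    ∑ i, ∫ p in unitSquare, p 0 * (a i (p 1) *
        fderiv ℝ f (K.cone i p) (K.edgePoint i (p 1) - K.center) +
        b i (p 1) * fderiv ℝ f (K.cone i p) (K.edgeVec i)) =
      ∑ i, ∫ s in (0 : ℝ)..1, a i s * f (K.edgePoint i s) := by
  have hbc : ∀ i, Continuous (b i) := fun i =>
    continuous_iff_continuousAt.2 fun s => (hb i s).continuousAt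
  have hfd : Continuous (fderiv ℝ f) := hf.continuous_fderiv one_ne_zero
  have hfdiff : Differentiable ℝ f := hf.differentiable one_ne_zero
  have hfc := hf.continuous
  set γ := K.edgePoint with hγ
  have hγc : ∀ i, Continuous (γ i) := K.continuous_edgePoint
  set x : Fin (K.m + 3) → ℝ → ℝ → E2 := fun i r s => K.center + r • (γ i s - K.center) with hx
  have hxc : ∀ i, Continuous (Function.uncurry (x i)) := fun i => by
    have := hγc i
    simp only [hx, Function.uncurry_def]; fun_prop
  have hxr : ∀ i s, Continuous fun r => x i r s := fun i s => by
    simp only [hx]; fun_prop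
  have hxs : ∀ i r, Continuous fun s => x i r s := fun i r => by
    have := hγc i
    simp only [hx]; fun_prop
  have hdr : ∀ i r s, HasDerivAt (fun r => f (x i r s))
      (fderiv ℝ f (x i r s) (γ i s - K.center)) r := fun i r s => by
    have h1 : HasDerivAt (fun r => x i r s) (γ i s - K.center) r := by
      exact (((hasDerivAt_id r).smul_const (γ i s - K.center)).const_add K.center).congr_deriv
        (one_smul _ _)
    exact (hfdiff _).hasFDerivAt.comp_hasDerivAt r h1
  have hds : ∀ i r s, HasDerivAt (fun s => f (x i r s))
      (fderiv ℝ f (x i r s) (r • K.edgeVec i)) s := fun i r s => by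
    have h1 : HasDerivAt (fun s => x i r s) (r • K.edgeVec i) s := by
      exact (((((hasDerivAt_id s).smul_const (K.edgeVec i)).const_add
        (K.vertex i)).sub_const K.center).const_smul r).const_add K.center |>.congr_deriv
        (by rw [one_smul])
    exact (hfdiff _).hasFDerivAt.comp_hasDerivAt s h1
  have hF : ∀ i, Continuous (Function.uncurry fun r s => a i s * f (x i r s)) := fun i => by
    have := ha i; have := hxc i
    simp only [Function.uncurry_def] at this ⊢; fun_prop
  have hA : ∀ i, Continuous (Function.uncurry fun r s =>
      r * (a i s * fderiv ℝ f (x i r s) (γ i s - K.center))) := fun i => by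
    have := ha i; have := hxc i; have := hγc i
    simp only [Function.uncurry_def] at *; fun_prop
  have hB : ∀ i, Continuous (Function.uncurry fun r s =>
      r * (b i s * fderiv ℝ f (x i r s) (K.edgeVec i))) := fun i => by
    have := hbc i; have := hxc i
    simp only [Function.uncurry_def] at *; fun_prop
  -- the radial part
  have I1 : ∀ i, ∫ p in unitSquare, p 0 * (a i (p 1) *
      fderiv ℝ f (K.cone i p) (γ i (p 1) - K.center)) =
      (∫ s in (0 : ℝ)..1, a i s * f (γ i s)) -
        ∫ p in unitSquare, a i (p 1) * f (K.cone i p) := fun i => by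
    have e1 := integral_unitSquare_eq_right (hA i)
    have e2 := integral_unitSquare_eq_right (hF i)
    simp only [hx] at e1 e2
    change _ = _ at e1
    unfold cone
    rw [e1, e2, ← intervalIntegral.integral_sub]
    · refine intervalIntegral.integral_congr fun s _ => ?_
      have h3 := intervalIntegral.integral_mul_deriv_eq_deriv_mul (a := 0) (b := 1)
        (u := fun r : ℝ => r) (u' := fun _ => 1) (v := fun r => f (x i r s))
        (v' := fun r => fderiv ℝ f (x i r s) (γ i s - K.center))
        (fun r _ => hasDerivAt_id r) (fun r _ => hdr i r s)
        intervalIntegrable_const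
        (Continuous.intervalIntegrable (by have := hxr i s; fun_prop) _ _)
      have h4 : ∀ r, r * (a i s * fderiv ℝ f (x i r s) (γ i s - K.center)) =
        a i s * (r * fderiv ℝ f (x i r s) (γ i s - K.center)) := fun r => by ring
      simp only [hx] at h3 h4 ⊢
      simp only [h4, intervalIntegral.integral_const_mul, h3]
      simp
      ring
    · exact Continuous.intervalIntegrable (by have := ha i; have := hγc i; fun_prop) _ _
    · refine Continuous.intervalIntegrable ?_ _ _
      exact intervalIntegral.continuous_parametric_intervalIntegral_of_continuous'
        (f := fun s r => a i s * f (x i r s)) ((hF i).comp continuous_swap) 0 1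
  -- the tangential part
  have I2 : ∀ i, ∫ p in unitSquare, p 0 * (b i (p 1) *
      fderiv ℝ f (K.cone i p) (K.edgeVec i)) =
      (∫ r in (0 : ℝ)..1, (b i 1 * f (x i r 1) - b i 0 * f (x i r 0))) +
        ∫ p in unitSquare, a i (p 1) * f (K.cone i p) := fun i => by
    have e1 := integral_unitSquare_eq_left (hB i)
    have e2 := integral_unitSquare_eq_left (hF i)
    simp only [hx] at e1 e2
    unfold cone
    rw [e1, e2, ← intervalIntegral.integral_add]
    · refine intervalIntegral.integral_congr fun r _ => ?_
      have h3 := intervalIntegral.integral_mul_deriv_eq_deriv_mul (a := 0) (b := 1)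
        (u := b i) (u' := fun s => -a i s) (v := fun s => f (x i r s))
        (v' := fun s => fderiv ℝ f (x i r s) (r • K.edgeVec i))
        (fun s _ => hb i s) (fun s _ => hds i r s)
        (Continuous.intervalIntegrable (by have := ha i; fun_prop) _ _)
        (Continuous.intervalIntegrable (by have := hxs i r; fun_prop) _ _)
      have h4 : ∀ s, r * (b i s * fderiv ℝ f (x i r s) (K.edgeVec i)) =
        b i s * fderiv ℝ f (x i r s) (r • K.edgeVec i) := fun s => by
          rw [map_smul, smul_eq_mul]; ring
      simp only [hx] at h3 h4 ⊢
      simp only [h4, h3, neg_mul, intervalIntegral.integral_neg]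
      ring
    · exact Continuous.intervalIntegrable (by have := hxr i 0; have := hxr i 1; fun_prop) _ _
    · refine Continuous.intervalIntegrable ?_ _ _
      exact intervalIntegral.continuous_parametric_intervalIntegral_of_continuous'
        (f := fun r s => a i s * f (x i r s)) (hF i) 0 1
  have hsplit : ∀ i, ∫ p in unitSquare, p 0 * (a i (p 1) *
        fderiv ℝ f (K.cone i p) (γ i (p 1) - K.center) +
        b i (p 1) * fderiv ℝ f (K.cone i p) (K.edgeVec i)) =
      (∫ s in (0 : ℝ)..1, a i s * f (γ i s)) +
      ∫ r in (0 : ℝ)..1, (b i 1 * f (x i r 1) - b i 0 * f (x i r 0)) := fun i => by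
    simp only [mul_add]
    have hcc : Continuous (K.cone i) :=
      continuous_iff_continuousAt.2 fun p => (K.hasFDerivAt_cone i p).continuousAt
    have := ha i; have := hbc i; have := hγc i
    rw [integral_add, I1, I2]
    · ring
    · exact integrableOn_unitSquare_of_continuous (by fun_prop)
    · exact integrableOn_unitSquare_of_continuous (by fun_prop)
  rw [Finset.sum_congr rfl fun i _ => hsplit i, Finset.sum_add_distrib, add_eq_left]
  have h5 : ∀ i, ∫ r in (0 : ℝ)..1, (b i 1 * f (x i r 1) - b i 0 * f (x i r 0)) =
      (∫ r in (0 : ℝ)..1, b (i + 1) 0 * f (x (i + 1) r 0)) -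
        ∫ r in (0 : ℝ)..1, b i 0 * f (x i r 0) := fun i => by
    rw [← intervalIntegral.integral_sub]
    · simp only [hab, hx, hγ, edgePoint_one, edgePoint_zero]
    · exact Continuous.intervalIntegrable (by have := hxr (i + 1) 0; fun_prop) _ _
    · exact Continuous.intervalIntegrable (by have := hxr i 0; fun_prop) _ _
  rw [Finset.sum_congr rfl fun i _ => h5 i, Finset.sum_sub_distrib, sub_eq_zero]
  exact Equiv.sum_comp (Equiv.addRight (1 : Fin (K.m + 3)))
    fun i => ∫ r in (0 : ℝ)..1, b i 0 * f (x i r 0)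

theorem volume_carrier_lt_top : volume K.carrier < ⊤ := K.isBounded_carrier.measure_lt_top

instance : IsFiniteMeasure (volume.restrict K.carrier) :=
  ⟨by rw [Measure.restrict_apply_univ]; exact K.volume_carrier_lt_top⟩

theorem volume_carrier_pos : 0 < volume K.carrier :=
  K.isOpen_carrier.measure_pos volume ⟨_, K.center_mem⟩

theorem integrableOn_of_continuous {F : Type*} [NormedAddCommGroup F] {f : E2 → F}
    (hf : Continuous f) : IntegrableOn f K.carrier :=
  (hf.continuousOn.integrableOn_compact K.isBounded_carrier.isCompact_closure).mono_set
    subset_closure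

theorem cross_edgeVec_eq (i : Fin (K.m + 3)) (e : E2) :
    cross e (K.edgeVec i) = K.edgeLength i * inner ℝ e (K.normal i) := by
  simp only [normal, inner_smul_right, mul_inv_cancel_left₀ (K.edgeLength_pos i).ne', cross, edgeVec,
    E2.inner_eq]
  simp
  ring

/-- Gauss' theorem on a star-shaped polygon. -/
theorem integral_fderiv {f : E2 → ℝ} (hf : ContDiff ℝ 1 f) (e : E2) :
    ∫ x in K.carrier, fderiv ℝ f x e =
      ∑ i, K.edgeIntegral i (fun _ => inner ℝ e (K.normal i)) f := by
  have hfd : Continuous (fderiv ℝ f) := hf.continuous_fderiv one_ne_zero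
  rw [K.setIntegral_eq_sum_cone (K.integrableOn_of_continuous (by fun_prop))]
  have key := K.sum_cone_integral (a := fun i _ => cross e (K.edgeVec i))
    (b := fun i s => cross (K.edgePoint i s - K.center) e) (fun i => continuous_const)
    (fun i s => ?_) (fun i => by rw [edgePoint_one, edgePoint_zero]) hf
  · rw [Finset.sum_congr rfl fun i _ => ?_, key]
    · refine Finset.sum_congr rfl fun i _ => ?_
      simp only [edgeIntegral, intervalIntegral.integral_const_mul, cross_edgeVec_eq]
      ring
    · refine setIntegral_congr_fun isOpen_unitSquare.measurableSet fun p hp => ?_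
      simp only [smul_eq_mul]
      rw [mul_comm (K.coneArea i), mul_assoc]
      congr 1
      simp only [← smul_eq_mul, ← map_smul, ← map_add]
      congr 1
      apply E2.ext <;>
      · simp [coneArea, cross, edgePoint, edgeVec]
        ring
  · have h : HasDerivAt (fun s => K.edgePoint i s - K.center) (K.edgeVec i) s := by
      exact ((((hasDerivAt_id s).smul_const (K.edgeVec i)).const_add
        (K.vertex i)).sub_const K.center).congr_deriv (one_smul _ _)
    have hj : ∀ j : Fin 2, HasDerivAt (fun s => (K.edgePoint i s - K.center) j) (K.edgeVec i j) s :=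
      fun j => (EuclideanSpace.proj j : E2 →L[ℝ] ℝ).hasFDerivAt.comp_hasDerivAt s h
    have := ((hj 0).mul_const (e 1)).sub ((hj 1).mul_const (e 0))
    exact this.congr_deriv (by simp [cross]; ring)

/-- For edge fluxes with vanishing sum there is a bounded field in the polygon that is
divergence-free and has these fluxes. -/
theorem exists_divFree_field {a : Fin (K.m + 3) → ℝ → ℝ} (ha : ∀ i, Continuous (a i))
    (hsum : ∑ i, ∫ s in (0 : ℝ)..1, a i s = 0) :
    ∃ u : L2v K.carrier, ∀ f : E2 → ℝ, ContDiff ℝ 1 f →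
      ∫ x in K.carrier, (inner ℝ (u x) (gradient f x) : ℝ) =
        ∑ i, ∫ s in (0 : ℝ)..1, a i s * f (K.edgePoint i s) := by
  obtain ⟨β, hβ⟩ : ∃ β : Fin (K.m + 3) → ℝ, ∀ i, β i - ∫ s in (0 : ℝ)..1, a i s = β (i + 1) := by
    set A : Fin (K.m + 3) → ℝ := fun i => ∫ s in (0 : ℝ)..1, a i s with hA
    refine ⟨fun i => -∑ j ∈ Finset.univ.filter (fun j => j < i), A j, fun i => ?_⟩
    rcases eq_or_ne i (Fin.last _) with rfl | hi
    · have h1 : Fin.last (K.m + 2) + 1 = 0 := by simp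
      rw [h1]
      have h2 : Finset.univ.filter (fun j : Fin (K.m + 3) => j < 0) = ∅ := by
        ext j; simp
      have h3 : Finset.univ.filter (fun j => j < Fin.last (K.m + 2)) =
          Finset.univ.erase (Fin.last (K.m + 2)) := by
        ext j; simp [Fin.lt_last_iff_ne_last]
      dsimp only
      rw [h2, h3, Finset.sum_empty, neg_zero, sub_eq_zero, neg_eq_iff_add_eq_zero]
      rw [Finset.sum_erase_add _ _ (Finset.mem_univ _)]
      exact hsum
    · have h3 : Finset.univ.filter (fun j => j < i + 1) =
          insert i (Finset.univ.filter (fun j => j < i)) := by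
        ext j
        have : ((i + 1 : Fin (K.m + 3)) : ℕ) = i + 1 := Fin.val_add_one_of_lt (Fin.lt_last_iff_ne_last.2 hi)
        simp only [Finset.mem_filter, Finset.mem_univ, true_and, Finset.mem_insert, Fin.lt_def,
          Fin.ext_iff, this]
        omega
      dsimp only
      rw [h3, Finset.sum_insert (by simp)]
      ring
  set b : Fin (K.m + 3) → ℝ → ℝ := fun i s => β i - ∫ t in (0 : ℝ)..s, a i t with hb
  have hbd : ∀ i s, HasDerivAt (b i) (-a i s) s := fun i s =>
    ((ha i).integral_hasStrictDerivAt 0 s).hasDerivAt.const_sub (β i)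
  have hbc : ∀ i, Continuous (b i) := fun i =>
    continuous_iff_continuousAt.2 fun s => (hbd i s).continuousAt
  set G : Fin (K.m + 3) → ℝ → E2 := fun i s =>
    (K.coneArea i)⁻¹ • (a i s • (K.edgePoint i s - K.center) + b i s • K.edgeVec i) with hG
  have hGc : ∀ i, Continuous (G i) := fun i => by
    have := ha i; have := hbc i; have := K.continuous_edgePoint i
    simp only [hG]; fun_prop
  have hext : ∀ i, ∃ w : E2 → E2, Measurable w ∧ ∀ p ∈ unitSquare, w (K.cone i p) = G i (p 1) := by
    intro i
    have hm := measurableEmbedding_of_fderivWithin isOpen_unitSquare.measurableSet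
      (fun p _ => (K.hasFDerivAt_cone i p).hasFDerivWithinAt) (K.cone_injOn i)
    obtain ⟨w, hw, hw'⟩ := hm.exists_measurable_extend (g := fun p => G i (p.1 1))
      (by have := hGc i; fun_prop) (fun _ => ⟨0⟩)
    exact ⟨w, hw, fun p hp => congrFun hw' ⟨p, hp⟩⟩
  choose w hw hwG using hext
  set u : E2 → E2 := fun x => ∑ i, (K.triangle i).indicator (w i) x with hu
  have hum : Measurable u := Finset.measurable_sum _ fun i _ =>
    (hw i).indicator (K.measurableSet_triangle i)
  have hucone : ∀ i, ∀ p ∈ unitSquare, u (K.cone i p) = G i (p 1) := by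
    intro i p hp
    simp only [hu]
    rw [Finset.sum_eq_single i]
    · rw [indicator_of_mem (show K.cone i p ∈ K.triangle i from mem_image_of_mem _ hp), hwG i p hp]
    · intro j _ hj
      exact indicator_of_notMem (Set.disjoint_left.1 (K.triangle_disjoint hj.symm)
        (mem_image_of_mem _ hp)) _
    · simp
  have hbound : ∀ i, ∃ C, ∀ x, ‖(K.triangle i).indicator (w i) x‖ ≤ C := by
    intro i
    obtain ⟨C, hC⟩ := isCompact_Icc.exists_bound_of_continuousOn (s := Icc (0 : ℝ) 1)
      (hGc i).continuousOn
    refine ⟨C, fun x => ?_⟩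
    by_cases hx : x ∈ K.triangle i
    · rw [indicator_of_mem hx]
      obtain ⟨p, hp, rfl⟩ := hx
      rw [hwG i p hp]
      exact hC _ (Ioo_subset_Icc_self hp.2)
    · rw [indicator_of_notMem hx, norm_zero]
      exact (norm_nonneg _).trans (hC 0 ⟨le_rfl, zero_le_one⟩)
  choose C hC using hbound
  have huC : ∀ x, ‖u x‖ ≤ ∑ i, C i := fun x =>
    (norm_sum_le _ _).trans (Finset.sum_le_sum fun i _ => hC i x)
  have hmem : MemLp u 2 (volume.restrict K.carrier) :=
    MemLp.of_bound hum.aestronglyMeasurable _ (Filter.Eventually.of_forall huC)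
  refine ⟨hmem.toLp u, fun f hf => ?_⟩
  have hfd : Continuous (fderiv ℝ f) := hf.continuous_fderiv one_ne_zero
  have e1 : ∫ x in K.carrier, (inner ℝ (hmem.toLp u x) (gradient f x) : ℝ) =
      ∫ x in K.carrier, fderiv ℝ f x (u x) := by
    refine integral_congr_ae ?_
    filter_upwards [hmem.coeFn_toLp] with x hx
    rw [hx, real_inner_comm, inner_gradient_left]
  have hint : IntegrableOn (fun x => fderiv ℝ f x (u x)) K.carrier := by
    obtain ⟨D, hD⟩ := K.isBounded_carrier.isCompact_closure.exists_bound_of_continuousOn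
      hfd.continuousOn
    refine Measure.integrableOn_of_bounded (M := D * ∑ i, C i) K.volume_carrier_lt_top.ne ?_ ?_
    · exact isBoundedBilinearMap_apply.continuous.comp_aestronglyMeasurable₂
        hfd.aestronglyMeasurable hum.aestronglyMeasurable
    · refine (ae_restrict_iff' K.isOpen_carrier.measurableSet).2 (Filter.Eventually.of_forall
        fun x hx => ?_)
      exact ((fderiv ℝ f x).le_opNorm _).trans (mul_le_mul (hD x (subset_closure hx)) (huC x)
        (norm_nonneg _) ((norm_nonneg _).trans (hD x (subset_closure hx))))
  rw [e1, K.setIntegral_eq_sum_cone hint, ← K.sum_cone_integral ha hbd (fun i => by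
    simp only [hb, hβ i, intervalIntegral.integral_same, sub_zero]) hf]
  refine Finset.sum_congr rfl fun i _ => setIntegral_congr_fun isOpen_unitSquare.measurableSet
    fun p hp => ?_
  simp only [hucone i p hp, hG, map_smul, map_add, smul_eq_mul]
  have := (K.coneArea_pos i).ne'
  field_simp

end Polygon

end MiscibleVEM

end


noncomputable section

namespace MiscibleVEM

open Filter Topology

theorem gradient_apply (f : E2 → ℝ) (x : E2) (i : Fin 2) :
    gradient f x i = fderiv ℝ f x (EuclideanSpace.single i 1) := by
  rw [← inner_gradient_left, EuclideanSpace.inner_single_right]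
  simp

/-- The affine map with scaling factor `l⁻¹` that sends `c + a` to `c`. -/
def scaling (c : E2) (l : ℝ) (a x : E2) : E2 := c + l⁻¹ • (x - a - c)

theorem map_scaling_le (c : E2) {l : ℝ} (h0 : 0 < l) (h1 : l ≤ 1) (a : E2) :
    (volume : Measure E2).map (scaling c l a) ≤ volume := by
  have e : scaling c l a = (fun x => c + x) ∘ (fun x => l⁻¹ • x) ∘ fun x => x - (a + c) := by
    funext x; simp only [scaling, Function.comp, sub_sub]
  rw [e, ← Measure.map_map (by fun_prop) (by fun_prop),
    ← Measure.map_map (by fun_prop) (by fun_prop), map_sub_right_eq_self,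
    Measure.map_addHaar_smul volume (inv_ne_zero h0.ne'), Measure.map_smul, map_add_left_eq_self]
  refine Measure.le_iff.2 fun s _ => ?_
  rw [Measure.smul_apply, smul_eq_mul]
  refine mul_le_of_le_one_left zero_le ?_
  rw [← ENNReal.ofReal_one]
  refine ENNReal.ofReal_le_ofReal ?_
  rw [inv_pow, inv_inv, abs_of_nonneg (by positivity)]
  exact pow_le_one₀ h0.le h1

theorem measurable_scaling (c : E2) (l : ℝ) (a : E2) : Measurable (scaling c l a) := by
  unfold scaling; fun_prop

theorem eLpNorm_comp_scaling_le {f : E2 → E2} (hf : AEStronglyMeasurable f volume) (c : E2) {l : ℝ}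
    (h0 : 0 < l) (h1 : l ≤ 1) (a : E2) :
    eLpNorm (f ∘ scaling c l a) 2 volume ≤ eLpNorm f 2 volume := by
  rw [← eLpNorm_map_measure (hf.mono_measure (map_scaling_le c h0 h1 a))
    (measurable_scaling c l a).aemeasurable]
  exact eLpNorm_mono_measure _ (map_scaling_le c h0 h1 a)

theorem quasiMeasurePreserving_scaling (c : E2) {l : ℝ} (h0 : 0 < l) (h1 : l ≤ 1) (a : E2) :
    Measure.QuasiMeasurePreserving (scaling c l a) volume volume :=
  ⟨measurable_scaling c l a, Measure.absolutelyContinuous_of_le (map_scaling_le c h0 h1 a)⟩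

theorem MemLp.comp_scaling {f : E2 → E2} (hf : MemLp f 2 volume) (c : E2) {l : ℝ}
    (h0 : 0 < l) (h1 : l ≤ 1) (a : E2) : MemLp (f ∘ scaling c l a) 2 volume :=
  ⟨hf.1.comp_quasiMeasurePreserving (quasiMeasurePreserving_scaling c h0 h1 a),
    (eLpNorm_comp_scaling_le hf.1 c h0 h1 a).trans_lt hf.2⟩

theorem tendsto_eLpNorm_comp_scaling_sub_of_continuous {g : E2 → E2} (hg : Continuous g)
    (hg' : HasCompactSupport g) (c : E2) :
    Tendsto (fun q : ℝ × E2 => eLpNorm (g ∘ scaling c q.1 q.2 - g) 2 volume)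
      (𝓝[Ioc 0 1 ×ˢ univ] (1, 0)) (𝓝 0) := by
  obtain ⟨R, hR⟩ := hg'.isCompact.isBounded.subset_closedBall c
  obtain ⟨M, hM⟩ := hg'.exists_bound_of_continuous hg
  have hgR : ∀ x, R < ‖x - c‖ → g x = 0 := fun x hx => by
    by_contra h
    have := hR (subset_tsupport g h)
    rw [Metric.mem_closedBall, dist_eq_norm] at this
    linarith
  have hnear : ∀ᶠ q : ℝ × E2 in 𝓝[Ioc 0 1 ×ˢ univ] (1, 0), q.1 ∈ Ioc (0 : ℝ) 1 ∧ ‖q.2‖ < 1 := by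
    have h1 : ∀ᶠ q : ℝ × E2 in 𝓝 (1, 0), ‖q.2‖ < 1 := by
      have : Continuous fun q : ℝ × E2 => ‖q.2‖ := by fun_prop
      exact this.continuousAt.eventually_lt continuousAt_const (by simp)
    filter_upwards [self_mem_nhdsWithin, mem_nhdsWithin_of_mem_nhds h1] with q hq hq'
    exact ⟨hq.1, hq'⟩
  have hlin : Tendsto (fun q : ℝ × E2 => ∫⁻ x, ‖g (scaling c q.1 q.2 x) - g x‖ₑ ^ (2 : ℝ))
      (𝓝[Ioc 0 1 ×ˢ univ] (1, 0)) (𝓝 (∫⁻ _ : E2, 0)) := by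
    refine tendsto_lintegral_filter_of_dominated_convergence
      ((Metric.closedBall c (|R| + 1)).indicator fun _ => (ENNReal.ofReal (M + M)) ^ (2 : ℝ)) ?_ ?_ ?_ ?_
    · refine Eventually.of_forall fun q => ?_
      have := measurable_scaling c q.1 q.2
      have hgm := hg.measurable
      fun_prop
    · filter_upwards [hnear] with q hq
      refine Eventually.of_forall fun x => ?_
      by_cases hx : x ∈ Metric.closedBall c (|R| + 1)
      · rw [indicator_of_mem hx]
        refine ENNReal.rpow_le_rpow ?_ (by norm_num)
        rw [← ofReal_norm]
        exact ENNReal.ofReal_le_ofReal ((norm_sub_le _ _).trans (add_le_add (hM _) (hM _)))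
      · rw [indicator_of_notMem hx]
        rw [Metric.mem_closedBall, dist_eq_norm, not_le] at hx
        have h1 : g x = 0 := hgR x (by linarith [le_abs_self R])
        have h2 : g (scaling c q.1 q.2 x) = 0 := by
          refine hgR _ ?_
          rw [scaling, add_sub_cancel_left, norm_smul, norm_inv, Real.norm_of_nonneg hq.1.1.le]
          have h3 : |R| < ‖x - q.2 - c‖ := by
            have : ‖x - c‖ ≤ ‖x - q.2 - c‖ + ‖q.2‖ := by
              have h4 := norm_add_le (x - q.2 - c) q.2
              rwa [show x - q.2 - c + q.2 = x - c by abel] at h4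
            linarith [hq.2]
          calc R ≤ |R| := le_abs_self R
            _ < ‖x - q.2 - c‖ := h3
            _ ≤ _ := le_mul_of_one_le_left (norm_nonneg _) ((one_le_inv₀ hq.1.1).2 hq.1.2)
        simp [h1, h2]
    · rw [lintegral_indicator measurableSet_closedBall, setLIntegral_const]
      exact ENNReal.mul_ne_top (by simp) measure_closedBall_lt_top.ne
    · refine Eventually.of_forall fun x => ?_
      have hc : ContinuousAt (fun q : ℝ × E2 => ‖g (scaling c q.1 q.2 x) - g x‖ₑ ^ (2 : ℝ)) (1, 0) := by
        have h1 : ContinuousAt (fun q : ℝ × E2 => scaling c q.1 q.2 x) (1, 0) := by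
          unfold scaling
          have : ContinuousAt (fun q : ℝ × E2 => q.1⁻¹) (1, 0) :=
            continuousAt_fst.inv₀ one_ne_zero
          fun_prop
        have h2 : ContinuousAt (fun q : ℝ × E2 => g (scaling c q.1 q.2 x) - g x) (1, 0) :=
          (hg.continuousAt.comp h1).sub continuousAt_const
        exact (ENNReal.continuous_rpow_const.continuousAt).comp h2.enorm
      have := hc.tendsto
      simp only [scaling, inv_one, one_smul, sub_zero, add_sub_cancel, sub_self, enorm_zero] at this
      rw [ENNReal.zero_rpow_of_pos (by norm_num)] at this
      exact this.mono_left nhdsWithin_le_nhds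
  rw [lintegral_zero] at hlin
  have h2 : ∀ q : ℝ × E2, eLpNorm (g ∘ scaling c q.1 q.2 - g) 2 volume =
      (∫⁻ x, ‖g (scaling c q.1 q.2 x) - g x‖ₑ ^ (2 : ℝ)) ^ (1 / 2 : ℝ) := fun q => by
    rw [eLpNorm_eq_lintegral_rpow_enorm_toReal (by norm_num) (by norm_num)]
    simp
  simp only [h2]
  have := (ENNReal.continuous_rpow_const (y := (1 / 2 : ℝ))).tendsto 0 |>.comp hlin
  rwa [ENNReal.zero_rpow_of_pos (by norm_num)] at this

theorem tendsto_eLpNorm_comp_scaling_sub {f : E2 → E2} (hf : MemLp f 2 volume) (c : E2) :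
    Tendsto (fun q : ℝ × E2 => eLpNorm (f ∘ scaling c q.1 q.2 - f) 2 volume)
      (𝓝[Ioc 0 1 ×ˢ univ] (1, 0)) (𝓝 0) := by
  rw [ENNReal.tendsto_nhds_zero]
  intro ε hε
  have hε3 : ε / 3 ≠ 0 := (ENNReal.div_pos hε.ne' (by norm_num)).ne'
  obtain ⟨g, hgs, hfg, hgc, hg⟩ := hf.exists_hasCompactSupport_eLpNorm_sub_le (by norm_num) hε3
  filter_upwards [self_mem_nhdsWithin, ENNReal.tendsto_nhds_zero.1
    (tendsto_eLpNorm_comp_scaling_sub_of_continuous hgc hgs c) _ (pos_iff_ne_zero.2 hε3)]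
    with q hq hgq
  have e : f ∘ scaling c q.1 q.2 - f = ((f - g) ∘ scaling c q.1 q.2 +
      (g ∘ scaling c q.1 q.2 - g)) - (f - g) := by
    funext x; simp only [Pi.sub_apply, Pi.add_apply, Function.comp]; abel
  have m1 : AEStronglyMeasurable (f - g) volume := hf.1.sub hg.1
  have m2 := m1.comp_quasiMeasurePreserving (quasiMeasurePreserving_scaling c hq.1.1 hq.1.2 q.2)
  have m3 := (hg.1.comp_quasiMeasurePreserving
    (quasiMeasurePreserving_scaling c hq.1.1 hq.1.2 q.2)).sub hg.1
  rw [e]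
  calc _ ≤ eLpNorm ((f - g) ∘ scaling c q.1 q.2) 2 volume +
        eLpNorm (g ∘ scaling c q.1 q.2 - g) 2 volume + eLpNorm (f - g) 2 volume :=
        (eLpNorm_sub_le (m2.add m3) m1 (by norm_num)).trans
          (add_le_add_left (eLpNorm_add_le m2 m3 (by norm_num)) _)
    _ ≤ ε / 3 + ε / 3 + ε / 3 := by
        gcongr
        exact (eLpNorm_comp_scaling_le m1 c hq.1.1 hq.1.2 q.2).trans hfg
    _ = ε := ENNReal.add_thirds ε

/-- The inner product of `f` with a slightly scaled and translated copy of it is positive. -/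
theorem exists_forall_inner_comp_scaling_pos {f : E2 → E2} (hf : MemLp f 2 volume)
    (hf0 : eLpNorm f 2 volume ≠ 0) (c : E2) :
    ∃ l ∈ Ioo (0 : ℝ) 1, ∃ δ > 0, ∀ a : E2, ‖a‖ < δ →
      0 < ∫ x, (inner ℝ (f x) (f (scaling c l a x)) : ℝ) := by
  have h1 := (tendsto_eLpNorm_comp_scaling_sub hf c).eventually_lt_const (pos_iff_ne_zero.2 hf0)
  rw [eventually_nhdsWithin_iff, Metric.eventually_nhds_iff] at h1
  obtain ⟨δ, hδ, h⟩ := h1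
  refine ⟨max (1 / 2) (1 - δ / 2), ⟨by positivity, by rw [max_lt_iff]; constructor <;> linarith⟩, δ, hδ,
    fun a ha => ?_⟩
  set l := max (1 / 2) (1 - δ / 2)
  have hl0 : 0 < l := by positivity
  have hl1 : l < 1 := by rw [max_lt_iff]; constructor <;> linarith
  have hl2 : 1 - l < δ := by have : 1 - δ / 2 ≤ l := le_max_right _ _; linarith
  have h2 := h (y := (l, a)) (by
    rw [Prod.dist_eq, max_lt_iff, Real.dist_eq, dist_zero_right, abs_sub_comm,
      abs_of_pos (by linarith)]
    exact ⟨hl2, ha⟩) ⟨⟨hl0, hl1.le⟩, mem_univ _⟩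
  set g := f ∘ scaling c l a with hg
  have hgm : MemLp g 2 volume := MemLp.comp_scaling hf c hl0 hl1.le a
  set F := hf.toLp f
  set G := hgm.toLp g
  have h3 : ‖G - F‖ < ‖F‖ := by
    rw [← MemLp.toLp_sub, Lp.norm_toLp, Lp.norm_toLp]
    exact (ENNReal.toReal_lt_toReal (hgm.sub hf).2.ne hf.2.ne).2 h2
  have h4 : 0 < (inner ℝ F G : ℝ) := by
    have e := norm_sub_sq_real G F
    rw [real_inner_comm] at e
    nlinarith [norm_nonneg (G - F), norm_nonneg F, sq_nonneg ‖G‖]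
  rw [L2.inner_def] at h4
  refine h4.trans_eq (integral_congr_ae ?_)
  filter_upwards [hf.coeFn_toLp, hgm.coeFn_toLp] with x hx hx'
  rw [hx, hx']
  rfl

end MiscibleVEM

end


noncomputable section

namespace MiscibleVEM

open Filter Topology

theorem isPreconnected_far (c : E2) {R : ℝ} (hR : 0 ≤ R) : IsPreconnected {x : E2 | R < ‖x - c‖} := by
  have hr : 1 < Module.rank ℝ E2 := by
    apply Module.one_lt_rank_of_one_lt_finrank
    simp
  have h := (isConnected_compl_singleton_of_one_lt_rank hr (0 : E2)).isPreconnected.image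
    (fun y => c + (R / ‖y‖ + 1) • y) ?_
  · convert h using 1
    ext x
    simp only [mem_ofPred_eq, mem_image, mem_compl_iff, mem_singleton_iff]
    constructor
    · intro hx
      have hx0 : 0 < ‖x - c‖ := hR.trans_lt hx
      have hx1 : 0 < 1 - R / ‖x - c‖ := by rw [sub_pos, div_lt_one hx0]; exact hx
      refine ⟨(1 - R / ‖x - c‖) • (x - c), smul_ne_zero hx1.ne' (norm_pos_iff.1 hx0), ?_⟩
      rw [norm_smul, Real.norm_of_nonneg hx1.le, smul_smul]
      have : (R / ((1 - R / ‖x - c‖) * ‖x - c‖) + 1) * (1 - R / ‖x - c‖) = 1 := by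
        have : ‖x - c‖ - R ≠ 0 := by linarith
        field_simp
        ring
      rw [this, one_smul]
      abel
    · rintro ⟨y, hy, rfl⟩
      have hy0 := norm_pos_iff.2 hy
      rw [add_sub_cancel_left, norm_smul, Real.norm_of_nonneg (by positivity)]
      have : (R / ‖y‖ + 1) * ‖y‖ = R + ‖y‖ := by field_simp
      linarith
  · refine ContinuousOn.add continuousOn_const (ContinuousOn.smul (ContinuousOn.add
      (ContinuousOn.div continuousOn_const continuousOn_id.norm ?_) continuousOn_const) continuousOn_id)
    intro x hx
    exact (norm_pos_iff.2 hx).ne'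

/-- A smooth divergence-free field that vanishes outside a bounded closed set which is star-shaped
about `c` is the curl of a smooth function that vanishes there as well. -/
theorem exists_curl_eq {w : E2 → E2} (hw : ContDiff ℝ ∞ w)
    (hdiv : ∀ x, fderiv ℝ w x (EuclideanSpace.single 0 1) 0 +
      fderiv ℝ w x (EuclideanSpace.single 1 1) 1 = 0)
    {S : Set E2} (hS : IsClosed S) (hSb : Bornology.IsBounded S) {c : E2}
    (hstar : ∀ x ∈ S, ∀ r ∈ Ioc (0 : ℝ) 1, c + r • (x - c) ∈ S) (hwS : ∀ x ∉ S, w x = 0) :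
    ∃ ψ : E2 → ℝ, ContDiff ℝ ∞ ψ ∧ (∀ x ∉ S, ψ x = 0) ∧ ∀ x, curl ψ x = w x := by
  set P : Fin 2 → E2 →L[ℝ] ℝ := fun j => EuclideanSpace.proj j with hP
  set η : E2 → E2 →L[ℝ] ℝ := fun x => w x 0 • P 1 - w x 1 • P 0 with hη
  have hwd : Differentiable ℝ w := hw.differentiable (by simp)
  have hwj : ∀ j x, HasFDerivAt (fun x => w x j) ((P j).comp (fderiv ℝ w x)) x := fun j x =>
    (P j).hasFDerivAt.comp x (hwd x).hasFDerivAt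
  have hηd : ∀ x, HasFDerivAt η (((P 0).comp (fderiv ℝ w x)).smulRight (P 1) -
      ((P 1).comp (fderiv ℝ w x)).smulRight (P 0)) x := fun x =>
    ((hwj 0 x).smul_const (P 1)).sub ((hwj 1 x).smul_const (P 0))
  have hwc : ∀ j, ContDiff ℝ ∞ fun x => w x j := fun j => (P j).contDiff.comp hw
  have hηc : ContDiff ℝ ∞ η := ((hwc 0).smul contDiff_const).sub ((hwc 1).smul contDiff_const)
  have hexp : ∀ x (h : E2), fderiv ℝ w x h = h 0 • fderiv ℝ w x (EuclideanSpace.single 0 1) +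
      h 1 • fderiv ℝ w x (EuclideanSpace.single 1 1) := fun x h => by
    rw [← map_smul, ← map_smul, ← map_add]
    congr 1
    apply E2.ext <;> simp
  obtain ⟨ψ, hψ⟩ : ∃ ψ : E2 → ℝ, ∀ x ∈ univ, HasFDerivAt ψ (η x) x :=
    Convex.exists_forall_hasFDerivAt_of_fderiv_symmetric (𝕜 := ℝ) convex_univ isOpen_univ (fun x _ => (hηd x).differentiableAt.differentiableWithinAt) (by
      intro x _ h k
      rw [(hηd x).fderiv]
      simp only [sub_apply, ContinuousLinearMap.smulRight_apply,
        ContinuousLinearMap.comp_apply, smul_apply, smul_eq_mul, hP,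
        PiLp.proj_apply, hexp x h, hexp x k, PiLp.add_apply, PiLp.smul_apply]
      linear_combination (h 0 * k 1 - h 1 * k 0) * hdiv x)
  have hψ' : ∀ x, HasFDerivAt ψ (η x) x := fun x => hψ x (mem_univ x)
  have hψd : fderiv ℝ ψ = η := funext fun x => (hψ' x).fderiv
  have hψdiff : Differentiable ℝ ψ := fun x => (hψ' x).differentiableAt
  have hψc : ContDiff ℝ ∞ ψ := by
    rw [contDiff_infty_iff_fderiv, hψd]
    exact ⟨hψdiff, hηc⟩
  obtain ⟨R, hR⟩ := hSb.subset_closedBall c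
  have hη0 : ∀ x ∉ S, η x = 0 := fun x hx => by simp [hη, hwS x hx]
  have hfarS : ∀ x, |R| < ‖x - c‖ → x ∉ S := fun x hx h => by
    have := hR h
    rw [Metric.mem_closedBall, dist_eq_norm] at this
    linarith [le_abs_self R]
  have hfar : ∀ x y : E2, |R| < ‖x - c‖ → |R| < ‖y - c‖ → ψ x = ψ y := fun x y hx hy =>
    IsOpen.is_const_of_fderiv_eq_zero (𝕜 := ℝ) (s := {x : E2 | |R| < ‖x - c‖})
      (isOpen_lt continuous_const (by fun_prop)) (isPreconnected_far c (abs_nonneg R))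
      hψdiff.differentiableOn (fun z hz => by rw [hψd, hη0 z (hfarS z hz)]; rfl) hx hy
  have hray : ∀ x ∉ S, ∀ T : ℝ, 1 ≤ T → ψ (c + T • (x - c)) = ψ x := fun x hx T hT => by
    have hd : ∀ t, HasDerivAt (fun t : ℝ => ψ (c + t • (x - c))) (η (c + t • (x - c)) (x - c)) t :=
      fun t => (hψ' _).comp_hasDerivAt t
        ((((hasDerivAt_id t).smul_const (x - c)).const_add c).congr_deriv (one_smul _ _))
    have h := constant_of_has_deriv_right_zero (a := 1) (b := T)
      (f := fun t : ℝ => ψ (c + t • (x - c)))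
      (fun t _ => (hd t).continuousAt.continuousWithinAt) (fun t ht => by
        have hn : c + t • (x - c) ∉ S := fun hmem => hx (by
          have h0 : 0 < t := by linarith [ht.1]
          have := hstar _ hmem t⁻¹ ⟨inv_pos.2 h0, inv_le_one_of_one_le₀ ht.1⟩
          rwa [add_sub_cancel_left, inv_smul_smul₀ h0.ne', add_sub_cancel] at this)
        have := (hd t).hasDerivWithinAt (s := Ici t)
        rwa [hη0 _ hn] at this) T ⟨hT, le_rfl⟩
    simpa using h
  set z : E2 := c + EuclideanSpace.single 0 (|R| + 1) with hz
  have hzfar : |R| < ‖z - c‖ := by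
    rw [hz, add_sub_cancel_left, PiLp.norm_single, Real.norm_of_nonneg (by positivity)]
    linarith
  have hfar' : ∀ x, |R| < ‖x - c‖ → x ≠ c := fun x hx h => by
    rw [h, sub_self, norm_zero] at hx; exact absurd hx (not_lt.2 (abs_nonneg R))
  have hgrad : ∀ (κ : ℝ) x j, gradient (fun x => ψ x - κ) x j = η x (EuclideanSpace.single j 1) :=
    fun κ x j => by rw [gradient_apply, fderiv_sub_const, hψd]
  have hcurl : ∀ (κ : ℝ) x, curl (fun x => ψ x - κ) x = w x := fun κ x => by
    apply E2.ext <;> simp [curl, hgrad, hη, hP]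
  by_cases hcS : c ∈ S
  · refine ⟨fun x => ψ x - ψ z, hψc.sub contDiff_const, fun x hx => ?_, hcurl _⟩
    have hxc : 0 < ‖x - c‖ := norm_pos_iff.2 (sub_ne_zero.2 (by rintro rfl; exact hx hcS))
    rw [sub_eq_zero, ← hray x hx (max 1 ((|R| + 1) / ‖x - c‖)) (le_max_left _ _)]
    refine hfar _ _ ?_ hzfar
    rw [add_sub_cancel_left, norm_smul, Real.norm_of_nonneg (by positivity)]
    calc |R| < (|R| + 1) / ‖x - c‖ * ‖x - c‖ := by rw [div_mul_cancel₀ _ hxc.ne']; linarith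
      _ ≤ _ := by gcongr; exact le_max_right _ _
  · have hSe : ∀ x, x ∉ S := by
      intro x hx
      refine hcS (hS.mem_of_tendsto (b := 𝓝[>] (0 : ℝ)) (f := fun r : ℝ => c + r • (x - c)) ?_ ?_)
      · have : Continuous fun r : ℝ => c + r • (x - c) := by fun_prop
        have := this.tendsto 0
        simp only [zero_smul, add_zero] at this
        exact this.mono_left nhdsWithin_le_nhds
      · filter_upwards [Ioc_mem_nhdsGT (zero_lt_one' ℝ)] with r hr using hstar x hx r hr
    refine ⟨fun _ => 0, contDiff_const, fun _ _ => rfl, fun x => ?_⟩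
    rw [hwS x (hSe x)]
    apply E2.ext <;> simp [curl]

/-- A field in a star-shaped polygon with vanishing divergence, normal trace and rotation is
zero. -/
theorem eq_zero_of_divFree_of_rotFree (K : Polygon) (v : L2v K.carrier)
    (hdiv : ∀ f, IsTest univ f → ∫ x in K.carrier, (inner ℝ (v x) (gradient f x) : ℝ) = 0)
    (hrot : ∀ f, IsTest K.carrier f → ∫ x in K.carrier, (inner ℝ (v x) (curl f x) : ℝ) = 0) :
    v = 0 := by
  set c := K.center with hc
  set V : E2 → E2 := K.carrier.indicator v with hV
  have hKm := K.isOpen_carrier.measurableSet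
  have hVm : StronglyMeasurable V := (Lp.stronglyMeasurable v).indicator hKm
  have hV2 : MemLp V 2 volume := (memLp_indicator_iff_restrict hKm).2 (Lp.memLp v)
  have hV0 : ∀ x ∉ K.carrier, V x = 0 := fun x hx => indicator_of_notMem hx _
  have hVint : ∀ F : E2 → E2, ∫ x, (inner ℝ (V x) (F x) : ℝ) = ∫ x in K.carrier, inner ℝ (v x) (F x) :=
    fun F => by
      rw [← integral_indicator hKm]
      refine integral_congr_ae (Eventually.of_forall fun x => ?_)
      by_cases hx : x ∈ K.carrier
      · simp only [hV, indicator_of_mem hx]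
      · simp only [hV, indicator_of_notMem hx, inner_zero_left]
  by_contra hne
  have hVne : eLpNorm V 2 volume ≠ 0 := by
    rw [hV, eLpNorm_indicator_eq_eLpNorm_restrict hKm]
    intro h
    rw [eLpNorm_eq_zero_iff (Lp.aestronglyMeasurable v) (by norm_num)] at h
    exact hne ((Lp.eq_zero_iff_ae_eq_zero).2 h)
  obtain ⟨l, ⟨hl0, hl1⟩, δ, hδ, hpos⟩ := exists_forall_inner_comp_scaling_pos hV2 hVne c
  set μ := (1 + l) / 2 with hμ
  have hμ0 : 0 < μ := by positivity
  have hμ1 : μ < 1 := by rw [hμ]; linarith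
  have hlμ : l < μ := by rw [hμ]; linarith
  set ε := min δ ((μ - l) * K.radius) with hε
  have hε0 : 0 < ε := lt_min hδ (mul_pos (by linarith) K.radius_pos)
  set φ : ContDiffBump (0 : E2) := ⟨ε / 2, ε, half_pos hε0, half_lt_self hε0⟩ with hφ
  set Vl : E2 → E2 := V ∘ scaling c l 0 with hVl
  have hVl2 : MemLp Vl 2 volume := MemLp.comp_scaling hV2 c hl0 hl1.le 0
  have hVlint : LocallyIntegrable Vl volume := hVl2.locallyIntegrable (by norm_num)
  have hVls : ∀ x t, Vl (x - t) = V (scaling c l t x) := fun x t => by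
    simp only [hVl, Function.comp, scaling, sub_zero]
  set L : ℝ →L[ℝ] E2 →L[ℝ] E2 := ContinuousLinearMap.lsmul ℝ ℝ with hL
  set w : E2 → E2 := convolution φ Vl L volume with hw
  have hφs : HasCompactSupport φ := φ.hasCompactSupport
  have hφc : ContDiff ℝ ∞ φ := φ.contDiff
  have hwc : ContDiff ℝ ∞ w := hφs.contDiff_convolution_left L hφc hVlint
  have hwx : ∀ x, w x = ∫ t, φ t • V (scaling c l t x) := fun x => by
    simp only [hw, convolution, hL, ContinuousLinearMap.lsmul_apply, hVls]
  have hwd : ∀ x, HasFDerivAt w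
      (convolution (fderiv ℝ φ) Vl (L.precompL E2) volume x) x := fun x =>
    hφs.hasFDerivAt_convolution_left L (φ.contDiff) hVlint x
  -- the convolution is divergence-free
  have hwdiv : ∀ x, fderiv ℝ w x (EuclideanSpace.single 0 1) 0 +
      fderiv ℝ w x (EuclideanSpace.single 1 1) 1 = 0 := by
    intro x
    rw [(hwd x).fderiv]
    have hex : Integrable (fun t => L.precompL E2 (fderiv ℝ φ t) (Vl (x - t))) volume :=
      (HasCompactSupport.convolutionExists_left (L.precompL E2) (hφs.fderiv (𝕜 := ℝ))
        (hφc.continuous_fderiv (by simp)) hVlint x)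
    set T : (E2 →L[ℝ] E2) →L[ℝ] ℝ :=
      (EuclideanSpace.proj 0 : E2 →L[ℝ] ℝ).comp
        (ContinuousLinearMap.apply ℝ E2 (EuclideanSpace.single 0 1 : E2)) +
      (EuclideanSpace.proj 1 : E2 →L[ℝ] ℝ).comp
        (ContinuousLinearMap.apply ℝ E2 (EuclideanSpace.single 1 1 : E2)) with hT
    change T (convolution (fderiv ℝ φ) Vl (L.precompL E2) volume x) = 0
    rw [convolution, ← T.integral_comp_comm hex]
    have e1 : ∀ t, T (L.precompL E2 (fderiv ℝ φ t) (Vl (x - t))) =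
        inner ℝ (Vl (x - t)) (gradient φ t) := fun t => by
      rw [E2.inner_eq, gradient_apply, gradient_apply]
      simp [hT, hL, ContinuousLinearMap.precompL_apply]
      ring
    simp only [e1]
    rw [← integral_sub_left_eq_self _ volume x]
    simp only [sub_sub_cancel]
    -- change of variables `y = c + l (z - c)`
    set Ψ : E2 → ℝ := fun z => inner ℝ (V (c + z)) (gradient φ (x - (c + l • z))) with hΨ
    have e2 : ∀ y, (inner ℝ (Vl y) (gradient φ (x - y)) : ℝ) = Ψ (l⁻¹ • (y - c)) := fun y => by
      simp only [hΨ, hVl, Function.comp, scaling, sub_zero]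
      rw [smul_inv_smul₀ hl0.ne', add_sub_cancel]
    have e3 : ∫ y, Ψ (l⁻¹ • (y - c)) = ∫ y, Ψ (l⁻¹ • y) :=
      integral_sub_right_eq_self (fun y => Ψ (l⁻¹ • y)) c
    have e4 : ∫ z, Ψ z = ∫ z, (inner ℝ (V z) (gradient φ (x - (c + l • (z - c)))) : ℝ) := by
      rw [← integral_add_left_eq_self
        (fun z => (inner ℝ (V z) (gradient φ (x - (c + l • (z - c)))) : ℝ)) c]
      simp only [add_sub_cancel_left, hΨ]
    simp only [e2]
    rw [e3, Measure.integral_comp_smul, e4, smul_eq_mul, mul_eq_zero]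
    right
    rw [hVint]
    set f : E2 → ℝ := fun z => φ (x - (c + l • (z - c))) with hf
    have hfg : ∀ z, gradient φ (x - (c + l • (z - c))) = (-l⁻¹) • gradient f z := fun z => by
      have hφd : HasFDerivAt φ (fderiv ℝ φ (x - (c + l • (z - c)))) (x - (c + l • (z - c))) :=
        ((hφc.differentiable (by simp)) _).hasFDerivAt
      have hA : HasFDerivAt (fun z => x - (c + l • (z - c))) (-(l • ContinuousLinearMap.id ℝ E2)) z :=
        ((((hasFDerivAt_id z).sub_const c).const_smul l).const_add c).const_sub x
      have hfd : fderiv ℝ f z = _ := (HasFDerivAt.comp (g := (φ : E2 → ℝ)) z hφd hA).fderiv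
      have : ∀ j, gradient φ (x - (c + l • (z - c))) j = ((-l⁻¹) • gradient f z) j := fun j => by
        rw [PiLp.smul_apply, gradient_apply, gradient_apply, hfd]
        simp only [ContinuousLinearMap.comp_apply, neg_apply,
          smul_apply, ContinuousLinearMap.id_apply, map_neg, map_smul, smul_eq_mul]
        field_simp
      exact E2.ext (this 0) (this 1)
    simp only [hfg, inner_smul_right, integral_const_mul]
    rw [hdiv f ⟨?_, ?_, subset_univ _⟩]
    · simp
    · exact hφc.comp (by fun_prop)
    · refine HasCompactSupport.of_support_subset_isCompact (hφs.isCompact.image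
        (f := fun y => c + l⁻¹ • (x - y - c)) (by fun_prop)) ?_
      intro z hz
      refine ⟨x - (c + l • (z - c)), subset_tsupport _ hz, ?_⟩
      simp only [sub_sub_cancel, add_sub_cancel_left, inv_smul_smul₀ hl0.ne', add_sub_cancel]
  -- it is supported in the polygon
  set S : Set E2 := {x | c + μ⁻¹ • (x - c) ∈ closure K.carrier} with hS
  have hSclosed : IsClosed S := isClosed_closure.preimage (by fun_prop)
  have hSmem : ∀ x ∈ S, ∃ y ∈ closure K.carrier, x = c + μ • (y - c) := fun x hx =>
    ⟨_, hx, by rw [add_sub_cancel_left, smul_inv_smul₀ hμ0.ne', add_sub_cancel]⟩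
  have hSK : S ⊆ K.carrier := fun x hx => by
    obtain ⟨y, hy, rfl⟩ := hSmem x hx
    exact K.ray_mem hy hμ0.le hμ1
  have hSb : Bornology.IsBounded S := K.isBounded_carrier.subset hSK
  have hwS : ∀ x ∉ S, w x = 0 := by
    intro x hx
    rw [hwx]
    refine integral_eq_zero_of_ae (Eventually.of_forall fun t => ?_)
    by_contra hnz
    simp only [Pi.zero_apply] at hnz
    have h1 : φ t ≠ 0 := fun h => hnz (by rw [h, zero_smul])
    have h2 : V (scaling c l t x) ≠ 0 := fun h => hnz (by rw [h, smul_zero])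
    have h3 : ‖t‖ < ε := by
      have : t ∈ Function.support φ := h1
      rw [φ.support_eq] at this
      simpa using this
    have h4 : scaling c l t x ∈ K.carrier := by
      by_contra h; exact h2 (hV0 _ h)
    refine hx (subset_closure ?_)
    have h5 := K.contract_mem (subset_closure h4) (r := l / μ) (e := μ⁻¹ • t) (by positivity)
      ((div_lt_one hμ0).2 hlμ) (by
        rw [norm_smul, norm_inv, Real.norm_of_nonneg hμ0.le, inv_mul_lt_iff₀ hμ0]
        calc ‖t‖ < (μ - l) * K.radius := h3.trans_le (min_le_right _ _)
          _ = _ := by field_simp)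
    convert h5 using 1
    rw [scaling, add_sub_cancel_left, smul_smul, show l / μ * l⁻¹ = μ⁻¹ by field_simp, add_assoc,
      ← smul_add]
    congr 2
    abel
  obtain ⟨ψ, hψc, hψS, hψw⟩ := exists_curl_eq hwc hwdiv hSclosed hSb (c := c) (by
    intro x hx r hr
    simp only [hS, mem_ofPred_eq, add_sub_cancel_left] at hx ⊢
    rcases hr.2.eq_or_lt with rfl | h1
    · simpa using hx
    · have := subset_closure (K.ray_mem hx hr.1.le h1)
      rwa [add_sub_cancel_left, smul_comm] at this) hwS
  have hsupp : tsupport ψ ⊆ S := closure_minimal (fun x hx => by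
    by_contra h; exact hx (hψS x h)) hSclosed
  have hψt : IsTest K.carrier ψ :=
    ⟨hψc, (Metric.isCompact_of_isClosed_isBounded hSclosed hSb).of_isClosed_subset
      (isClosed_tsupport _) hsupp, hsupp.trans hSK⟩
  have h0 : ∫ x, (inner ℝ (V x) (w x) : ℝ) = 0 := by
    rw [hVint, ← hrot ψ hψt]
    simp only [hψw]
  -- Fubini
  have hφm : StronglyMeasurable φ := φ.continuous.stronglyMeasurable
  have hsm : StronglyMeasurable (fun q : E2 × E2 => scaling c l q.2 q.1) := by
    unfold scaling
    exact Continuous.stronglyMeasurable (by fun_prop)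
  have hjm : StronglyMeasurable (fun q : E2 × E2 => φ q.2 * (inner ℝ (V q.1) (V (scaling c l q.2 q.1)) : ℝ)) :=
    (hφm.comp_measurable measurable_snd).mul ((hVm.comp_measurable measurable_fst).inner
      (hVm.comp_measurable hsm.measurable))
  have hφi : Integrable φ volume := φ.continuous.integrable_of_hasCompactSupport hφs
  have hsq : Integrable (fun x => ‖V x‖ ^ 2) volume := hV2.integrable_norm_pow (by norm_num)
  have hsql : Integrable (fun x => ‖Vl x‖ ^ 2) volume := hVl2.integrable_norm_pow (by norm_num)
  have hji : Integrable (fun q : E2 × E2 => φ q.2 * (inner ℝ (V q.1) (V (scaling c l q.2 q.1)) : ℝ))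
      (volume.prod volume) := by
    have i1 : Integrable (fun q : E2 × E2 => ‖V q.1‖ ^ 2 * φ q.2) (volume.prod volume) :=
      hsq.mul_prod hφi
    have i2 : Integrable (fun q : E2 × E2 => φ q.2 * ‖Vl (q.1 - q.2)‖ ^ 2) (volume.prod volume) :=
      hφi.convolution_integrand (ContinuousLinearMap.mul ℝ ℝ) hsql
    refine (i1.add i2).mono' hjm.aestronglyMeasurable (Eventually.of_forall fun q => ?_)
    simp only [Pi.add_apply, hVls]
    rw [norm_mul, Real.norm_of_nonneg φ.nonneg, mul_comm (‖V q.1‖ ^ 2), ← mul_add]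
    refine mul_le_mul_of_nonneg_left ?_ φ.nonneg
    refine (norm_inner_le_norm (𝕜 := ℝ) _ _).trans ?_
    nlinarith [sq_nonneg (‖V q.1‖ - ‖V (scaling c l q.2 q.1)‖), sq_nonneg (‖V q.1‖),
      sq_nonneg (‖V (scaling c l q.2 q.1)‖)]
  have h1 : ∫ x, (inner ℝ (V x) (w x) : ℝ) =
      ∫ t, φ t * ∫ x, (inner ℝ (V x) (V (scaling c l t x)) : ℝ) := by
    have e1 : ∀ t, φ t * ∫ x, (inner ℝ (V x) (V (scaling c l t x)) : ℝ) =
        ∫ x, φ t * (inner ℝ (V x) (V (scaling c l t x)) : ℝ) := fun t => by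
      rw [integral_const_mul]
    simp only [e1]
    rw [← integral_integral_swap hji]
    refine integral_congr_ae (Eventually.of_forall fun x => ?_)
    simp only
    have hex : Integrable (fun t => φ t • V (scaling c l t x)) volume := by
      have := HasCompactSupport.convolutionExists_left L hφs φ.continuous hVlint x
      simp only [ConvolutionExistsAt, hL, ContinuousLinearMap.lsmul_apply, hVls] at this
      exact this
    rw [hwx, ← integral_inner hex]
    simp only [inner_smul_right]
  have h2 : Integrable (fun t => φ t * ∫ x, (inner ℝ (V x) (V (scaling c l t x)) : ℝ)) volume := by
    have := hji.integral_prod_right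
    simpa only [integral_const_mul] using this
  have h3 : 0 < ∫ t, φ t * ∫ x, (inner ℝ (V x) (V (scaling c l t x)) : ℝ) := by
    rw [integral_pos_iff_support_of_nonneg _ h2]
    · refine (Metric.measure_ball_pos volume (0 : E2) (half_pos hε0)).trans_le (measure_mono ?_)
      intro t ht
      have ht' : ‖t‖ < ε / 2 := by simpa using ht
      have h5 : φ t = 1 := φ.one_of_mem_closedBall (by simpa using ht'.le)
      rw [Function.mem_support, h5, one_mul]
      exact (hpos t (by have := min_le_left δ ((μ - l) * K.radius); linarith)).ne'
    · intro t
      by_cases ht : ‖t‖ < δ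
      · exact mul_nonneg φ.nonneg (hpos t ht).le
      · have : φ t = 0 := φ.zero_of_le_dist (by
          rw [dist_zero_right]; exact (min_le_left _ _).trans (not_lt.1 ht))
        simp [this]
  rw [← h1, h0] at h3
  exact lt_irrefl _ h3

end MiscibleVEM

end


noncomputable section

namespace MiscibleVEM

/-! ### Integrability on bounded sets -/

theorem memLp_of_continuous {F : Type*} [NormedAddCommGroup F] {S : Set E2}
    (hS : Bornology.IsBounded S) {f : E2 → F} (hf : Continuous f) (p : ENNReal) :
    MemLp f p (volume.restrict S) := by
  obtain ⟨C, hC⟩ := hS.isCompact_closure.exists_bound_of_continuousOn hf.continuousOn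
  have : IsFiniteMeasure (volume.restrict S) :=
    ⟨by rw [Measure.restrict_apply_univ]; exact hS.measure_lt_top⟩
  have h : ∀ᵐ x ∂(volume.restrict S), ‖f x‖ ≤ C :=
    (ae_restrict_mem isClosed_closure.measurableSet).filter_mono
      (ae_mono (Measure.restrict_mono subset_closure le_rfl)) |>.mono hC
  exact MemLp.of_bound hf.aestronglyMeasurable.restrict C h

theorem integrable_inner_of_memLp {μ : Measure E2} {f g : E2 → E2} (hf : MemLp f 2 μ)
    (hg : MemLp g 2 μ) : Integrable (fun x => (inner ℝ (f x) (g x) : ℝ)) μ := by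
  refine (L2.integrable_inner (𝕜 := ℝ) (hf.toLp f) (hg.toLp g)).congr ?_
  filter_upwards [hf.coeFn_toLp, hg.coeFn_toLp] with x h1 h2
  rw [h1, h2]

theorem integrable_mul_of_memLp {μ : Measure E2} {f g : E2 → ℝ} (hf : MemLp f 2 μ)
    (hg : MemLp g 2 μ) : Integrable (fun x => f x * g x) μ :=
  hf.integrable_mul hg

theorem integrable_smul_of_memLp {μ : Measure E2} {f : E2 → ℝ} {g : E2 → E2} (hf : MemLp f 2 μ)
    (hg : MemLp g 2 μ) : Integrable (fun x => f x • g x) μ :=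
  memLp_one_iff_integrable.1 (hg.smul hf)

theorem continuous_gradient {f : E2 → ℝ} (hf : ContDiff ℝ 1 f) : Continuous (gradient f) := by
  unfold gradient
  exact (InnerProductSpace.toDual ℝ E2).symm.continuous.comp (hf.continuous_fderiv one_ne_zero)

theorem continuous_curl {f : E2 → ℝ} (hf : ContDiff ℝ 1 f) : Continuous (curl f) := by
  have := continuous_gradient hf
  unfold curl
  refine (PiLp.continuous_toLp 2 _).comp (continuous_pi fun i => ?_)
  fin_cases i <;> simp <;> fun_prop

theorem IsTest.contDiff_one {U : Set E2} {f : E2 → ℝ} (hf : IsTest U f) : ContDiff ℝ 1 f :=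
  hf.1.of_le (by simp)

theorem E2.integral_apply {μ : Measure E2} {f : E2 → E2} (hf : Integrable f μ) (j : Fin 2) :
    (∫ x, f x ∂μ) j = ∫ x, f x j ∂μ :=
  ((EuclideanSpace.proj j : E2 →L[ℝ] ℝ).integral_comp_comm hf).symm

/-! ### Polynomial functions -/

/-- Polynomial functions of degree at most `m` on the plane. -/
def polyFun (m : ℤ) : Submodule ℝ (E2 → ℝ) :=
  Submodule.span ℝ {f | ∃ i j : ℕ, (i + j : ℤ) ≤ m ∧ f = fun x => x 0 ^ i * x 1 ^ j}

theorem monomial_mem_polyFun {m : ℤ} {i j : ℕ} (h : (i + j : ℤ) ≤ m) :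
    (fun x : E2 => x 0 ^ i * x 1 ^ j) ∈ polyFun m := Submodule.subset_span ⟨i, j, h, rfl⟩

theorem polyFun_mono {m n : ℤ} (h : m ≤ n) : polyFun m ≤ polyFun n := by
  refine Submodule.span_mono ?_
  rintro f ⟨i, j, hij, rfl⟩
  exact ⟨i, j, hij.trans h, rfl⟩

theorem const_mem_polyFun {m : ℤ} (hm : 0 ≤ m) (a : ℝ) : (fun _ : E2 => a) ∈ polyFun m := by
  have := (polyFun m).smul_mem a (monomial_mem_polyFun (i := 0) (j := 0) (by simpa using hm))
  convert this using 1
  funext x; simp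

theorem polyFun_induction {m : ℤ} {p : (E2 → ℝ) → Prop}
    (mon : ∀ i j : ℕ, (i + j : ℤ) ≤ m → p fun x => x 0 ^ i * x 1 ^ j) (zero : p fun _ => 0)
    (add : ∀ f ∈ polyFun m, ∀ g ∈ polyFun m, p f → p g → p fun x => f x + g x)
    (smul : ∀ (a : ℝ), ∀ f ∈ polyFun m, p f → p fun x => a * f x) {f : E2 → ℝ} (hf : f ∈ polyFun m) :
    p f := by
  induction hf using Submodule.span_induction with
  | mem f h => obtain ⟨i, j, h, rfl⟩ := h; exact mon i j h
  | zero => exact zero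
  | add f g hf hg h1 h2 => exact add f hf g hg h1 h2
  | smul a f hf h => exact smul a f hf h

theorem contDiff_of_mem_polyFun {m : ℤ} {f : E2 → ℝ} (hf : f ∈ polyFun m) : ContDiff ℝ ∞ f := by
  refine polyFun_induction (fun i j _ => by fun_prop) contDiff_const
    (fun f _ g _ h1 h2 => h1.add h2) (fun a f _ h => contDiff_const.mul h) hf

theorem differentiable_of_mem_polyFun {m : ℤ} {f : E2 → ℝ} (hf : f ∈ polyFun m) :
    Differentiable ℝ f := (contDiff_of_mem_polyFun hf).differentiable (by simp)

theorem continuous_of_mem_polyFun {m : ℤ} {f : E2 → ℝ} (hf : f ∈ polyFun m) : Continuous f :=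
  (contDiff_of_mem_polyFun hf).continuous

theorem gradient_add_apply {f g : E2 → ℝ} (hf : Differentiable ℝ f) (hg : Differentiable ℝ g)
    (x : E2) : gradient (fun x => f x + g x) x = gradient f x + gradient g x := by
  unfold gradient
  rw [← map_add]
  congr 1
  exact fderiv_fun_add (hf x) (hg x)

theorem gradient_const_mul {f : E2 → ℝ} (hf : Differentiable ℝ f) (a : ℝ) (x : E2) :
    gradient (fun x => a * f x) x = a • gradient f x := by
  unfold gradient
  rw [fderiv_const_mul (hf x)]
  exact map_smul _ _ _

theorem gradient_mul {f g : E2 → ℝ} (hf : Differentiable ℝ f) (hg : Differentiable ℝ g) (x : E2) :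
    gradient (fun x => f x * g x) x = f x • gradient g x + g x • gradient f x := by
  unfold gradient
  rw [fderiv_fun_mul (hf x) (hg x), map_add]
  congr 1 <;> exact map_smul _ _ _

theorem gradient_monomial (i j : ℕ) (x : E2) :
    gradient (fun x : E2 => x 0 ^ i * x 1 ^ j) x =
      !₂[(i : ℝ) * x 0 ^ (i - 1) * x 1 ^ j, (j : ℝ) * (x 0 ^ i * x 1 ^ (j - 1))] := by
  have h : ∀ l, HasFDerivAt (fun x : E2 => x l) (EuclideanSpace.proj l : E2 →L[ℝ] ℝ) x := fun l =>
    (EuclideanSpace.proj l : E2 →L[ℝ] ℝ).hasFDerivAt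
  have h2 := (((h 0).pow i).mul ((h 1).pow j)).fderiv
  have h3 : fderiv ℝ (fun x : E2 => x 0 ^ i * x 1 ^ j) x = _ := h2
  apply E2.ext <;> rw [gradient_apply, h3] <;> simp <;> ring

theorem gradient_mem_polyFun {m : ℤ} {f : E2 → ℝ} (hf : f ∈ polyFun m) (l : Fin 2) :
    (fun x => gradient f x l) ∈ polyFun (m - 1) := by
  refine polyFun_induction (p := fun f => (fun x => gradient f x l) ∈ polyFun (m - 1))
    (fun i j h => ?_) ?_ (fun f hf g hg h1 h2 => ?_) (fun a f hf h => ?_) hf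
  · simp only [gradient_monomial]
    fin_cases l
    · simp only [Fin.zero_eta, Matrix.cons_val_zero, mul_assoc]
      rcases Nat.eq_zero_or_pos i with rfl | hi
      · simp only [Nat.cast_zero, zero_mul]; exact Submodule.zero_mem _
      · exact Submodule.smul_mem _ (i : ℝ) (monomial_mem_polyFun (by push_cast [hi]; omega))
    · simp only [Fin.mk_one, Matrix.cons_val_one]
      rcases Nat.eq_zero_or_pos j with rfl | hj
      · simp only [Nat.cast_zero, zero_mul]; exact Submodule.zero_mem _
      · exact Submodule.smul_mem _ (j : ℝ) (monomial_mem_polyFun (by push_cast [hj]; omega))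
  · have : (fun x => gradient (fun _ : E2 => (0 : ℝ)) x l) = 0 := by
      funext x; rw [gradient_apply]; simp
    rw [this]; exact Submodule.zero_mem _
  · simp only [gradient_add_apply (differentiable_of_mem_polyFun hf) (differentiable_of_mem_polyFun hg)]
    exact Submodule.add_mem _ h1 h2
  · simp only [gradient_const_mul (differentiable_of_mem_polyFun hf)]
    exact Submodule.smul_mem _ a h

theorem exists_antideriv_polyFun {m : ℤ} {f : E2 → ℝ} (hf : f ∈ polyFun m) :
    ∃ g ∈ polyFun (m + 1), ∀ x, gradient g x 0 = f x := by
  refine polyFun_induction (p := fun f => ∃ g ∈ polyFun (m + 1), ∀ x, gradient g x 0 = f x)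
    (fun i j h => ?_) ?_ (fun f hf g hg h1 h2 => ?_) (fun a f hf h => ?_) hf
  · have hm := monomial_mem_polyFun (m := m + 1) (i := i + 1) (j := j) (by push_cast; omega)
    refine ⟨fun x => ((i : ℝ) + 1)⁻¹ * (x 0 ^ (i + 1) * x 1 ^ j), Submodule.smul_mem _ _ hm,
      fun x => ?_⟩
    rw [gradient_const_mul (differentiable_of_mem_polyFun hm), gradient_monomial]
    simp
    field_simp
  · refine ⟨fun _ => 0, Submodule.zero_mem _, fun x => ?_⟩
    rw [gradient_apply]; simp
  · obtain ⟨F, hF, hF'⟩ := h1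
    obtain ⟨G, hG, hG'⟩ := h2
    refine ⟨fun x => F x + G x, Submodule.add_mem _ hF hG, fun x => ?_⟩
    rw [gradient_add_apply (differentiable_of_mem_polyFun hF) (differentiable_of_mem_polyFun hG),
      PiLp.add_apply, hF', hG']
  · obtain ⟨F, hF, hF'⟩ := h
    refine ⟨fun x => a * F x, Submodule.smul_mem _ a hF, fun x => ?_⟩
    rw [gradient_const_mul (differentiable_of_mem_polyFun hF), PiLp.smul_apply, hF', smul_eq_mul]

theorem exists_polynomial_edge (K : Polygon) (i : Fin (K.m + 3)) {n : ℕ} {f : E2 → ℝ}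
    (hf : f ∈ polyFun n) :
    ∃ g : Polynomial ℝ, g.natDegree ≤ n ∧ ∀ s, f (K.edgePoint i s) = g.eval s := by
  refine polyFun_induction (p := fun f => ∃ g : Polynomial ℝ, g.natDegree ≤ n ∧
    ∀ s, f (K.edgePoint i s) = g.eval s)
    (fun a b h => ?_) ⟨0, by simp, by simp⟩ (fun f _ g _ h1 h2 => ?_) (fun a f _ h => ?_) hf
  · set q : Fin 2 → Polynomial ℝ := fun l =>
      Polynomial.C (K.vertex i l) + Polynomial.X * Polynomial.C ((K.vertex (i + 1) - K.vertex i) l)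
      with hq
    have hd : ∀ l, (q l).natDegree ≤ 1 := fun l => by simp only [hq]; compute_degree
    refine ⟨q 0 ^ a * q 1 ^ b, ?_, fun s => ?_⟩
    · have h1 := Polynomial.natDegree_pow_le_of_le a (hd 0)
      have h2 := Polynomial.natDegree_pow_le_of_le b (hd 1)
      have h3 := Polynomial.natDegree_mul_le_of_le h1 h2
      omega
    · simp [hq, Polygon.edgePoint]
  · obtain ⟨p, hp, hp'⟩ := h1
    obtain ⟨q, hq, hq'⟩ := h2
    exact ⟨p + q, Polynomial.natDegree_add_le_of_degree_le hp hq, fun s => by simp [hp', hq']⟩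
  · obtain ⟨p, hp, hp'⟩ := h
    exact ⟨Polynomial.C a * p, (Polynomial.natDegree_C_mul_le _ _).trans hp, fun s => by simp [hp']⟩

/-! ### Polynomials as elements of the `L²` spaces -/

theorem exists_polyFun_of_mem_polyL2 {S : Set E2} {m : ℤ} {f : L2 S} (hf : f ∈ polyL2 S m) :
    ∃ P ∈ polyFun m, f =ᵐ[volume.restrict S] P := by
  induction hf using Submodule.span_induction with
  | mem f h => obtain ⟨i, j, h, h'⟩ := h; exact ⟨_, monomial_mem_polyFun h, h'⟩
  | zero => exact ⟨0, Submodule.zero_mem _, Lp.coeFn_zero _ _ _⟩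
  | add f g _ _ h1 h2 =>
    obtain ⟨P, hP, hP'⟩ := h1
    obtain ⟨Q, hQ, hQ'⟩ := h2
    exact ⟨P + Q, Submodule.add_mem _ hP hQ, (Lp.coeFn_add f g).trans (hP'.add hQ')⟩
  | smul a f _ h =>
    obtain ⟨P, hP, hP'⟩ := h
    exact ⟨a • P, Submodule.smul_mem _ a hP, (Lp.coeFn_smul a f).trans (hP'.const_smul a)⟩

theorem exists_mem_polyL2 {S : Set E2} (hS : Bornology.IsBounded S) {m : ℤ} {P : E2 → ℝ}
    (hP : P ∈ polyFun m) : ∃ f ∈ polyL2 S m, f =ᵐ[volume.restrict S] P := by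
  refine polyFun_induction (p := fun P => ∃ f ∈ polyL2 S m, f =ᵐ[volume.restrict S] P)
    (fun i j h => ?_) ⟨0, Submodule.zero_mem _, Lp.coeFn_zero _ _ _⟩ (fun P _ Q _ h1 h2 => ?_)
    (fun a f _ h => ?_) hP
  · have hm := memLp_of_continuous hS (f := fun x : E2 => x 0 ^ i * x 1 ^ j) (by fun_prop) 2
    exact ⟨hm.toLp _, Submodule.subset_span ⟨i, j, h, hm.coeFn_toLp⟩, hm.coeFn_toLp⟩
  · obtain ⟨f, hf, hf'⟩ := h1
    obtain ⟨g, hg, hg'⟩ := h2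
    exact ⟨f + g, Submodule.add_mem _ hf hg, (Lp.coeFn_add f g).trans (hf'.add hg')⟩
  · obtain ⟨f, hf, hf'⟩ := h
    exact ⟨a • f, Submodule.smul_mem _ a hf, (Lp.coeFn_smul a f).trans (hf'.const_smul a)⟩

theorem mem_polyL2_of_ae_eq {S : Set E2} (hS : Bornology.IsBounded S) {m : ℤ} {P : E2 → ℝ}
    (hP : P ∈ polyFun m) {f : L2 S} (hf : f =ᵐ[volume.restrict S] P) : f ∈ polyL2 S m := by
  obtain ⟨g, hg, hg'⟩ := exists_mem_polyL2 hS hP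
  rwa [Lp.ext (hf.trans hg'.symm)]

theorem exists_polyFun_of_mem_polyL2v {S : Set E2} {m : ℤ} {f : L2v S} (hf : f ∈ polyL2v S m) :
    ∃ P : Fin 2 → E2 → ℝ, (∀ l, P l ∈ polyFun m) ∧
      f =ᵐ[volume.restrict S] fun x => !₂[P 0 x, P 1 x] := by
  induction hf using Submodule.span_induction with
  | mem f h =>
    obtain ⟨l, i, j, h, h'⟩ := h
    refine ⟨fun l' => if l' = l then fun x => x 0 ^ i * x 1 ^ j else 0, fun l' => ?_, ?_⟩
    · dsimp only
      split_ifs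
      exacts [monomial_mem_polyFun h, Submodule.zero_mem _]
    · refine h'.trans (Filter.Eventually.of_forall fun x => ?_)
      fin_cases l <;> apply E2.ext <;> simp
  | zero =>
    refine ⟨0, fun l => Submodule.zero_mem _, (Lp.coeFn_zero _ _ _).trans
      (Filter.Eventually.of_forall fun x => ?_)⟩
    apply E2.ext <;> simp
  | add f g _ _ h1 h2 =>
    obtain ⟨P, hP, hP'⟩ := h1
    obtain ⟨Q, hQ, hQ'⟩ := h2
    refine ⟨P + Q, fun l => Submodule.add_mem _ (hP l) (hQ l), (Lp.coeFn_add f g).trans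
      ((hP'.add hQ').trans (Filter.Eventually.of_forall fun x => ?_))⟩
    apply E2.ext <;> simp
  | smul a f _ h =>
    obtain ⟨P, hP, hP'⟩ := h
    refine ⟨a • P, fun l => Submodule.smul_mem _ a (hP l), (Lp.coeFn_smul a f).trans
      ((hP'.const_smul a).trans (Filter.Eventually.of_forall fun x => ?_))⟩
    apply E2.ext <;> simp

theorem exists_mem_polyGraph {S : Set E2} (hS : Bornology.IsBounded S) {m : ℤ} {P : E2 → ℝ}
    (hP : P ∈ polyFun m) : ∃ f ∈ polyGraph S m, f.1 =ᵐ[volume.restrict S] P ∧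
      f.2 =ᵐ[volume.restrict S] gradient P := by
  refine polyFun_induction (p := fun P => ∃ f ∈ polyGraph S m, f.1 =ᵐ[volume.restrict S] P ∧
      f.2 =ᵐ[volume.restrict S] gradient P)
    (fun i j h => ?_) ⟨0, Submodule.zero_mem _, Lp.coeFn_zero _ _ _, ?_⟩ (fun P hP Q hQ h1 h2 => ?_)
    (fun a P hP h => ?_) hP
  · have hm := memLp_of_continuous hS (f := fun x : E2 => x 0 ^ i * x 1 ^ j) (by fun_prop) 2
    have hm2 := memLp_of_continuous hS (continuous_gradient
      (f := fun x : E2 => x 0 ^ i * x 1 ^ j) (by fun_prop)) 2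
    exact ⟨(hm.toLp _, hm2.toLp _), Submodule.subset_span ⟨i, j, h, hm.coeFn_toLp, hm2.coeFn_toLp⟩,
      hm.coeFn_toLp, hm2.coeFn_toLp⟩
  · refine (Lp.coeFn_zero _ _ _).trans (Filter.Eventually.of_forall fun x => ?_)
    simp [gradient]
  · obtain ⟨f, hf, hf1, hf2⟩ := h1
    obtain ⟨g, hg, hg1, hg2⟩ := h2
    refine ⟨f + g, Submodule.add_mem _ hf hg, (Lp.coeFn_add f.1 g.1).trans (hf1.add hg1),
      (Lp.coeFn_add f.2 g.2).trans ((hf2.add hg2).trans (Filter.Eventually.of_forall fun x => ?_))⟩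
    exact (gradient_add_apply (differentiable_of_mem_polyFun hP) (differentiable_of_mem_polyFun hQ)
      x).symm
  · obtain ⟨f, hf, hf1, hf2⟩ := h
    refine ⟨a • f, Submodule.smul_mem _ a hf, (Lp.coeFn_smul a f.1).trans (hf1.const_smul a),
      (Lp.coeFn_smul a f.2).trans ((hf2.const_smul a).trans
        (Filter.Eventually.of_forall fun x => ?_))⟩
    exact (gradient_const_mul (differentiable_of_mem_polyFun hP) a x).symm

theorem exists_polyFun_of_mem_polyGraph {S : Set E2} {m : ℤ} {f : L2 S × L2v S}
    (hf : f ∈ polyGraph S m) : ∃ P ∈ polyFun m, f.1 =ᵐ[volume.restrict S] P ∧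
      f.2 =ᵐ[volume.restrict S] gradient P := by
  induction hf using Submodule.span_induction with
  | mem f h => obtain ⟨i, j, h, h'⟩ := h; exact ⟨_, monomial_mem_polyFun h, h'⟩
  | zero =>
    refine ⟨0, Submodule.zero_mem _, Lp.coeFn_zero _ _ _, (Lp.coeFn_zero _ _ _).trans
      (Filter.Eventually.of_forall fun x => ?_)⟩
    simp [gradient]
  | add f g _ _ h1 h2 =>
    obtain ⟨P, hP, hf1, hf2⟩ := h1
    obtain ⟨Q, hQ, hg1, hg2⟩ := h2
    refine ⟨fun x => P x + Q x, Submodule.add_mem _ hP hQ, (Lp.coeFn_add f.1 g.1).trans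
      (hf1.add hg1), (Lp.coeFn_add f.2 g.2).trans ((hf2.add hg2).trans
      (Filter.Eventually.of_forall fun x => ?_))⟩
    exact (gradient_add_apply (differentiable_of_mem_polyFun hP) (differentiable_of_mem_polyFun hQ)
      x).symm
  | smul a f _ h =>
    obtain ⟨P, hP, hf1, hf2⟩ := h
    refine ⟨fun x => a * P x, Submodule.smul_mem _ a hP, (Lp.coeFn_smul a f.1).trans
      (hf1.const_smul a), (Lp.coeFn_smul a f.2).trans ((hf2.const_smul a).trans
        (Filter.Eventually.of_forall fun x => ?_))⟩
    exact (gradient_const_mul (differentiable_of_mem_polyFun hP) a x).symm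

end MiscibleVEM

end


noncomputable section

namespace MiscibleVEM

/-! ### Functions as elements of `L²` -/

open Classical in
/-- The class of a square-integrable function in `L²(S)`. -/
def toL2 {F : Type} [NormedAddCommGroup F] (S : Set E2) (f : E2 → F) : Lp F 2 (volume.restrict S) :=
  if h : MemLp f 2 (volume.restrict S) then h.toLp f else 0

theorem coeFn_toL2 {F : Type} [NormedAddCommGroup F] {S : Set E2} {f : E2 → F}
    (hf : MemLp f 2 (volume.restrict S)) : toL2 S f =ᵐ[volume.restrict S] f := by
  rw [toL2, dif_pos hf]; exact hf.coeFn_toLp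

theorem integral_inner_eq {F : Type} [NormedAddCommGroup F] [InnerProductSpace ℝ F] {S : Set E2}
    (u : Lp F 2 (volume.restrict S)) {f : E2 → F} (hf : MemLp f 2 (volume.restrict S)) :
    ∫ x in S, (inner ℝ (u x) (f x) : ℝ) = inner ℝ u (toL2 S f) := by
  rw [L2.inner_def]
  refine integral_congr_ae ?_
  filter_upwards [coeFn_toL2 hf] with x hx
  rw [hx]

theorem integral_mul_eq {S : Set E2} (u : L2 S) {f : E2 → ℝ} (hf : MemLp f 2 (volume.restrict S)) :
    ∫ x in S, u x * f x = inner ℝ u (toL2 S f) := by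
  rw [← integral_inner_eq u hf]
  simp only [RCLike.inner_apply, conj_trivial, mul_comm]

theorem IsTest.memLp {U S : Set E2} (hS : Bornology.IsBounded S) {f : E2 → ℝ} (hf : IsTest U f) :
    MemLp f 2 (volume.restrict S) := memLp_of_continuous hS hf.1.continuous 2

theorem IsTest.memLp_gradient {U S : Set E2} (hS : Bornology.IsBounded S) {f : E2 → ℝ}
    (hf : IsTest U f) : MemLp (gradient f) 2 (volume.restrict S) :=
  memLp_of_continuous hS (continuous_gradient hf.contDiff_one) 2

theorem IsTest.memLp_gradient_apply {U S : Set E2} (hS : Bornology.IsBounded S) {f : E2 → ℝ}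
    (hf : IsTest U f) (j : Fin 2) : MemLp (fun x => gradient f x j) 2 (volume.restrict S) :=
  memLp_of_continuous hS (by have := continuous_gradient hf.contDiff_one; fun_prop) 2

theorem IsTest.memLp_single {U S : Set E2} (hS : Bornology.IsBounded S) {f : E2 → ℝ}
    (hf : IsTest U f) (j : Fin 2) :
    MemLp (fun x => f x • (EuclideanSpace.single j 1 : E2)) 2 (volume.restrict S) :=
  memLp_of_continuous hS (by have := hf.1.continuous; fun_prop) 2

theorem IsTest.memLp_curl {U S : Set E2} (hS : Bornology.IsBounded S) {f : E2 → ℝ}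
    (hf : IsTest U f) : MemLp (curl f) 2 (volume.restrict S) :=
  memLp_of_continuous hS (continuous_curl hf.contDiff_one) 2

theorem IsTest.mono {U V : Set E2} {f : E2 → ℝ} (hf : IsTest U f) (h : U ⊆ V) : IsTest V f :=
  ⟨hf.1, hf.2.1, hf.2.2.trans h⟩

/-- There is a test function which is one on a given bounded set. -/
theorem exists_isTest_eq_one {S : Set E2} (hS : Bornology.IsBounded S) :
    ∃ f : E2 → ℝ, IsTest univ f ∧ ∀ x ∈ S, f x = 1 ∧ gradient f x = 0 := by
  obtain ⟨R, hR⟩ := hS.subset_ball (0 : E2)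
  have hR1 : 0 < |R| + 1 := by positivity
  set φ : ContDiffBump (0 : E2) := ⟨|R| + 1, |R| + 2, hR1, by linarith⟩ with hφ
  refine ⟨φ, ⟨φ.contDiff, φ.hasCompactSupport, subset_univ _⟩, fun x hx => ?_⟩
  have hx' : x ∈ Metric.ball (0 : E2) (|R| + 1) :=
    Metric.ball_subset_ball (by linarith [le_abs_self R]) (hR hx)
  refine ⟨φ.one_of_mem_closedBall (Metric.ball_subset_closedBall hx'), ?_⟩
  have h1 : (φ : E2 → ℝ) =ᶠ[nhds x] fun _ => 1 := by
    filter_upwards [Metric.isOpen_ball.mem_nhds hx'] with y hy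
    exact φ.one_of_mem_closedBall (Metric.ball_subset_closedBall hy)
  rw [gradient, h1.fderiv_eq]
  simp

theorem integral_inner_add_eq {S : Set E2} (hb : Bornology.IsBounded S) (v : L2v S × L2 S)
    {f : E2 → ℝ} (hf : IsTest univ f) :
    ∫ x in S, ((inner ℝ (v.1 x) (gradient f x) : ℝ) + v.2 x * f x) =
      inner ℝ v.1 (toL2 S (gradient f)) + inner ℝ v.2 (toL2 S f) := by
  rw [← integral_mul_eq _ (hf.memLp hb), ← integral_inner_eq _ (hf.memLp_gradient hb),
    ← integral_add (integrable_inner_of_memLp (Lp.memLp _) (hf.memLp_gradient hb))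
      (integrable_mul_of_memLp (Lp.memLp _) (hf.memLp hb))]

namespace Polygon

variable (K : Polygon)

theorem integral_add_mul_eq (z : L2 K.carrier × L2v K.carrier) {f : E2 → ℝ} (hf : IsTest univ f)
    (j : Fin 2) : (∫ x in K.carrier, (z.1 x • gradient f x + f x • z.2 x)) j =
      inner ℝ z.1 (toL2 K.carrier fun x => gradient f x j) +
        inner ℝ z.2 (toL2 K.carrier fun x => f x • (EuclideanSpace.single j 1 : E2)) := by
  have hb := K.isBounded_carrier
  rw [← integral_mul_eq _ (hf.memLp_gradient_apply hb j), ← integral_inner_eq _ (hf.memLp_single hb j),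
    ← integral_add (integrable_mul_of_memLp (Lp.memLp _) (hf.memLp_gradient_apply hb j))
      (integrable_inner_of_memLp (Lp.memLp _) (hf.memLp_single hb j)), E2.integral_apply]
  · refine integral_congr_ae (Filter.Eventually.of_forall fun x => ?_)
    simp only [PiLp.add_apply, PiLp.smul_apply, smul_eq_mul, inner_smul_right,
      EuclideanSpace.inner_single_right, one_mul]
    simp
  · exact (integrable_smul_of_memLp (Lp.memLp _) (hf.memLp_gradient hb)).add
      (integrable_smul_of_memLp (hf.memLp hb) (Lp.memLp _))

theorem integral_inner_add_eq (v : L2v K.carrier × L2 K.carrier) {f : E2 → ℝ} (hf : IsTest univ f) :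
    ∫ x in K.carrier, ((inner ℝ (v.1 x) (gradient f x) : ℝ) + v.2 x * f x) =
      inner ℝ v.1 (toL2 K.carrier (gradient f)) + inner ℝ v.2 (toL2 K.carrier f) :=
  MiscibleVEM.integral_inner_add_eq K.isBounded_carrier v hf

theorem intervalIntegrable_edge (i : Fin (K.m + 3)) {t : ℝ → ℝ}
    (ht : MemLp t 2 (volume.restrict (Icc (0 : ℝ) 1))) {f : E2 → ℝ} (hf : Continuous f) :
    IntervalIntegrable (fun s => t s * f (K.edgePoint i s)) volume 0 1 := by
  rw [intervalIntegrable_iff_integrableOn_Icc_of_le zero_le_one]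
  have hc : ContinuousOn (fun s => f (K.edgePoint i s)) (Icc 0 1) :=
    (hf.comp (K.continuous_edgePoint i)).continuousOn
  exact IntegrableOn.mul_continuousOn (ht.integrable (by norm_num)) hc isCompact_Icc

theorem edgeIntegral_add (i : Fin (K.m + 3)) {t u : ℝ → ℝ}
    (ht : MemLp t 2 (volume.restrict (Icc (0 : ℝ) 1)))
    (hu : MemLp u 2 (volume.restrict (Icc (0 : ℝ) 1))) {f : E2 → ℝ} (hf : Continuous f) :
    K.edgeIntegral i (fun s => t s + u s) f = K.edgeIntegral i t f + K.edgeIntegral i u f := by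
  simp only [edgeIntegral, add_mul]
  rw [intervalIntegral.integral_add (K.intervalIntegrable_edge i ht hf)
    (K.intervalIntegrable_edge i hu hf), mul_add]

theorem edgeIntegral_smul (i : Fin (K.m + 3)) (a : ℝ) (t : ℝ → ℝ) (f : E2 → ℝ) :
    K.edgeIntegral i (fun s => a * t s) f = a * K.edgeIntegral i t f := by
  simp only [edgeIntegral, mul_assoc, intervalIntegral.integral_const_mul]
  ring

theorem memLp_edge {g : ℝ → ℝ} (hg : Continuous g) : MemLp g 2 (volume.restrict (Icc (0 : ℝ) 1)) := by
  obtain ⟨C, hC⟩ := isCompact_Icc.exists_bound_of_continuousOn (s := Icc (0 : ℝ) 1) hg.continuousOn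
  exact MemLp.of_bound hg.aestronglyMeasurable C
    ((ae_restrict_iff' measurableSet_Icc).2 (Filter.Eventually.of_forall hC))

theorem integral_gradient_mul {P f : E2 → ℝ} (hP : ContDiff ℝ 1 P) (hf : ContDiff ℝ 1 f)
    (j : Fin 2) :
    ∫ x in K.carrier, (P x * gradient f x j + f x * gradient P x j) =
      ∑ i, K.edgeIntegral i (fun s => P (K.edgePoint i s) * K.normal i j) f := by
  have h := K.integral_fderiv (hP.mul hf) (EuclideanSpace.single j 1)
  have e : ∀ x, P x * gradient f x j + f x * gradient P x j =
      fderiv ℝ (fun x => P x * f x) x (EuclideanSpace.single j 1) := fun x => by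
    rw [← gradient_apply, gradient_mul (hP.differentiable one_ne_zero) (hf.differentiable one_ne_zero)]
    simp
  simp only [e]
  refine h.trans (Finset.sum_congr rfl fun i _ => ?_)
  simp only [edgeIntegral, EuclideanSpace.inner_single_left, map_one, one_mul]
  congr 1
  refine intervalIntegral.integral_congr fun s _ => ?_
  ring

end Polygon

/-! ### Traces -/

theorem hasTrace_iff {K : Polygon} {z : L2 K.carrier × L2v K.carrier} {t : Fin (K.m + 3) → ℝ → ℝ} :
    HasTrace K z t ↔ (∀ i, MemLp (t i) 2 (volume.restrict (Icc (0 : ℝ) 1))) ∧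
      ∀ f, IsTest univ f → ∀ j, inner ℝ z.1 (toL2 K.carrier fun x => gradient f x j) +
        inner ℝ z.2 (toL2 K.carrier fun x => f x • (EuclideanSpace.single j 1 : E2)) =
          ∑ i, K.edgeIntegral i (t i) f * K.normal i j := by
  refine and_congr_right fun _ => forall_congr' fun f => forall_congr' fun hf => ?_
  have hs : ∀ j, (∑ i, K.edgeIntegral i (t i) f • K.normal i) j =
      ∑ i, K.edgeIntegral i (t i) f * K.normal i j := fun j => by
    rw [WithLp.ofLp_sum, Finset.sum_apply]
    simp
  constructor
  · intro h j
    rw [← K.integral_add_mul_eq z hf j, h, hs]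
  · intro h
    have : ∀ j, (∫ x in K.carrier, (z.1 x • gradient f x + f x • z.2 x)) j =
        (∑ i, K.edgeIntegral i (t i) f • K.normal i) j := fun j => by
      rw [K.integral_add_mul_eq z hf j, h j, hs]
    exact E2.ext (this 0) (this 1)

theorem HasTrace.add {K : Polygon} {z w : L2 K.carrier × L2v K.carrier}
    {t u : Fin (K.m + 3) → ℝ → ℝ} (hz : HasTrace K z t) (hw : HasTrace K w u) :
    HasTrace K (z + w) fun i s => t i s + u i s := by
  rw [hasTrace_iff] at *
  refine ⟨fun i => (hz.1 i).add (hw.1 i), fun f hf j => ?_⟩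
  simp only [Prod.fst_add, Prod.snd_add, inner_add_left,
    K.edgeIntegral_add _ (hz.1 _) (hw.1 _) hf.1.continuous, add_mul, Finset.sum_add_distrib]
  rw [← hz.2 f hf j, ← hw.2 f hf j]
  ring

theorem HasTrace.smul {K : Polygon} {z : L2 K.carrier × L2v K.carrier}
    {t : Fin (K.m + 3) → ℝ → ℝ} (hz : HasTrace K z t) (a : ℝ) :
    HasTrace K (a • z) fun i s => a * t i s := by
  rw [hasTrace_iff] at *
  refine ⟨fun i => (hz.1 i).const_mul a, fun f hf j => ?_⟩
  simp only [Prod.smul_fst, Prod.smul_snd, inner_smul_left, K.edgeIntegral_smul, mul_assoc,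
    ← Finset.mul_sum]
  rw [← hz.2 f hf j]
  simp
  ring

theorem hasTrace_of_ae_eq {K : Polygon} {z : L2 K.carrier × L2v K.carrier} {P : E2 → ℝ}
    (hP : ContDiff ℝ 1 P) (h1 : z.1 =ᵐ[volume.restrict K.carrier] P)
    (h2 : z.2 =ᵐ[volume.restrict K.carrier] gradient P) :
    HasTrace K z fun i s => P (K.edgePoint i s) := by
  rw [hasTrace_iff]
  refine ⟨fun i => Polygon.memLp_edge (hP.continuous.comp (K.continuous_edgePoint i)), fun f hf j => ?_⟩
  rw [← K.integral_add_mul_eq z hf j, E2.integral_apply]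
  · have e : ∀ i, K.edgeIntegral i (fun s => P (K.edgePoint i s)) f * K.normal i j =
        K.edgeIntegral i (fun s => P (K.edgePoint i s) * K.normal i j) f := fun i => by
      rw [mul_comm, ← K.edgeIntegral_smul]
      simp only [mul_comm]
    simp only [e]
    rw [← K.integral_gradient_mul hP hf.contDiff_one j]
    refine integral_congr_ae ?_
    filter_upwards [h1, h2] with x hx1 hx2
    simp [hx1, hx2]
  · exact (integrable_smul_of_memLp (Lp.memLp _) (hf.memLp_gradient K.isBounded_carrier)).add
      (integrable_smul_of_memLp (hf.memLp K.isBounded_carrier) (Lp.memLp _))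

namespace Polygon

variable (K : Polygon)

theorem normal_ne_zero (i : Fin (K.m + 3)) : K.normal i ≠ 0 := by
  refine smul_ne_zero (inv_ne_zero (K.edgeLength_pos i).ne') fun h => K.edgeVec_ne_zero i ?_
  have h0 := congrFun (congrArg WithLp.ofLp h) 0
  have h1 := congrFun (congrArg WithLp.ofLp h) 1
  simp at h0 h1
  apply E2.ext <;> simp [edgeVec] <;> linarith

/-- Smooth functions of the parameter of an edge extend to test functions that vanish on all other
edges. -/
theorem exists_isTest_edge (i : Fin (K.m + 3)) {g : ℝ → ℝ} (hg : ContDiff ℝ ∞ g)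
    (hgc : HasCompactSupport g) (hgs : tsupport g ⊆ Ioo 0 1) :
    ∃ f : E2 → ℝ, IsTest univ f ∧ (∀ s, f (K.edgePoint i s) = g s) ∧
      ∀ j ≠ i, ∀ s ∈ Icc (0 : ℝ) 1, f (K.edgePoint j s) = 0 := by
  set C : Set E2 := K.edgePoint i '' tsupport g with hC
  have hCc : IsCompact C := hgc.isCompact.image (K.continuous_edgePoint i)
  obtain ⟨R, hR⟩ := hCc.isBounded.subset_ball (0 : E2)
  set D : Set E2 := (⋃ j ∈ {j | j ≠ i}, K.edgePoint j '' Icc 0 1) ∪ (Metric.ball 0 R)ᶜ with hD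
  have hDc : IsClosed D := by
    refine IsClosed.union ?_ Metric.isOpen_ball.isClosed_compl
    exact (Set.toFinite _).isClosed_biUnion fun j _ =>
      (isCompact_Icc.image (K.continuous_edgePoint j)).isClosed
  have hdisj : Disjoint D C := by
    rw [Set.disjoint_right]
    rintro _ ⟨s, hs, rfl⟩ (h | h)
    · obtain ⟨j, hj, t, ht, hjt⟩ := mem_iUnion₂.1 h
      exact hj (K.edgePoint_eq_imp (hgs hs) ht hjt.symm).symm
    · exact h (hR ⟨s, hs, rfl⟩)
  obtain ⟨χ, hχ0, hχ1, -⟩ := exists_contMDiffMap_zero_one_of_isClosed (n := ⊤)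
    (modelWithCornersSelf ℝ E2) hDc hCc.isClosed hdisj
  have hχc : ContDiff ℝ ∞ χ := χ.contMDiff.contDiff
  set l : E2 → ℝ := fun x => (‖K.edgeVec i‖ ^ 2)⁻¹ * inner ℝ (x - K.vertex i) (K.edgeVec i) with hl
  have hlc : ContDiff ℝ ∞ l :=
    contDiff_const.mul ((contDiff_id.sub contDiff_const).inner ℝ contDiff_const)
  have hne : ‖K.edgeVec i‖ ^ 2 ≠ 0 := pow_ne_zero 2 (norm_ne_zero_iff.2 (K.edgeVec_ne_zero i))
  have hls : ∀ s, l (K.edgePoint i s) = s := fun s => by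
    simp only [hl, edgePoint, add_sub_cancel_left]
    rw [show K.vertex (i + 1) - K.vertex i = K.edgeVec i from rfl, inner_smul_left,
      real_inner_self_eq_norm_sq]
    rw [conj_trivial, mul_comm s, inv_mul_cancel_left₀ hne]
  refine ⟨fun x => g (l x) * χ x, ⟨(hg.comp hlc).mul hχc, ?_, subset_univ _⟩, fun s => ?_,
    fun j hj s hs => ?_⟩
  · refine HasCompactSupport.of_support_subset_isCompact (isCompact_closedBall (0 : E2) R) ?_
    intro x hx
    by_contra h
    have : χ x = 0 := hχ0 (Or.inr fun h' => h (Metric.ball_subset_closedBall h'))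
    exact hx (by simp [this])
  · simp only [hls]
    by_cases hs : s ∈ tsupport g
    · have : χ (K.edgePoint i s) = 1 := hχ1 ⟨s, hs, rfl⟩
      rw [this, mul_one]
    · rw [image_eq_zero_of_notMem_tsupport hs, zero_mul]
  · have : χ (K.edgePoint j s) = 0 :=
      hχ0 (Or.inl (mem_iUnion₂.2 ⟨j, hj, s, hs, rfl⟩))
    simp only [this, mul_zero]

end Polygon

theorem HasTrace.ae_eq_zero {K : Polygon} {t : Fin (K.m + 3) → ℝ → ℝ} (h : HasTrace K 0 t)
    (i : Fin (K.m + 3)) : ∀ᵐ s, s ∈ Ioo (0 : ℝ) 1 → t i s = 0 := by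
  rw [hasTrace_iff] at h
  refine isOpen_Ioo.ae_eq_zero_of_integral_contDiff_smul_eq_zero ?_ fun g hg hgc hgs => ?_
  · refine (IntegrableOn.mono_set ?_ Ioo_subset_Icc_self).locallyIntegrableOn
    exact (h.1 i).integrable (by norm_num)
  obtain ⟨f, hf, hfi, hfj⟩ := K.exists_isTest_edge i hg hgc hgs
  have h2 : ∀ j, K.edgeIntegral i (t i) f * K.normal i j = 0 := fun j => by
    have := h.2 f hf j
    rw [Finset.sum_eq_single i] at this
    · simpa using this.symm
    · intro l _ hl
      have : K.edgeIntegral l (t l) f = 0 := by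
        rw [Polygon.edgeIntegral, intervalIntegral.integral_congr (g := fun _ => 0)]
        · simp
        · intro s hs
          rw [uIcc_of_le zero_le_one] at hs
          simp [hfj l hl s hs]
      rw [this, zero_mul]
    · simp
  have h3 : K.edgeIntegral i (t i) f = 0 := by
    by_contra hne
    exact K.normal_ne_zero i (E2.ext ((mul_eq_zero.1 (h2 0)).resolve_left hne)
      ((mul_eq_zero.1 (h2 1)).resolve_left hne))
  have h4 := (mul_eq_zero.1 h3).resolve_left (K.edgeLength_pos i).ne'
  simp only [hfi] at h4
  have hsub : Function.support (fun s => g s • t i s) ⊆ Ioc 0 1 := fun s hs =>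
    Ioo_subset_Ioc_self (hgs (subset_tsupport g fun h0 => hs (by simp [h0])))
  rw [← intervalIntegral.integral_eq_integral_of_support_subset hsub]
  simpa only [smul_eq_mul, mul_comm] using h4

theorem boundaryIntegral_eq {K : Polygon} {z : L2 K.carrier × L2v K.carrier}
    {t : Fin (K.m + 3) → ℝ → ℝ} (h : HasTrace K z t) :
    boundaryIntegral K z = ∑ i, K.edgeIntegral i (t i) fun _ => 1 := by
  have hex : ∃ t, HasTrace K z t := ⟨t, h⟩
  rw [boundaryIntegral, dif_pos hex]
  have h0 := hex.choose_spec.add (h.smul (-1))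
  rw [neg_one_smul, add_neg_cancel] at h0
  refine Finset.sum_congr rfl fun i _ => ?_
  simp only [Polygon.edgeIntegral]
  congr 1
  refine intervalIntegral.integral_congr_ae ?_
  have h1 : ∀ᵐ s : ℝ, s ≠ 1 := by simp [ae_iff]
  filter_upwards [h0.ae_eq_zero i, h1] with s hs hs1 hs2
  rw [uIoc_of_le zero_le_one] at hs2
  have := hs ⟨hs2.1, lt_of_le_of_ne hs2.2 hs1⟩
  rw [show hex.choose i s = t i s by linarith]

theorem boundaryIntegral_add {K : Polygon} {z w : L2 K.carrier × L2v K.carrier}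
    (hz : ∃ t, HasTrace K z t) (hw : ∃ t, HasTrace K w t) :
    boundaryIntegral K (z + w) = boundaryIntegral K z + boundaryIntegral K w := by
  obtain ⟨t, ht⟩ := hz
  obtain ⟨u, hu⟩ := hw
  rw [boundaryIntegral_eq ht, boundaryIntegral_eq hu, boundaryIntegral_eq (ht.add hu),
    ← Finset.sum_add_distrib]
  exact Finset.sum_congr rfl fun i _ => K.edgeIntegral_add i (ht.1 i) (hu.1 i) continuous_const

theorem boundaryIntegral_smul {K : Polygon} {z : L2 K.carrier × L2v K.carrier}
    (hz : ∃ t, HasTrace K z t) (a : ℝ) :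
    boundaryIntegral K (a • z) = a * boundaryIntegral K z := by
  obtain ⟨t, ht⟩ := hz
  rw [boundaryIntegral_eq ht, boundaryIntegral_eq (ht.smul a), Finset.mul_sum]
  exact Finset.sum_congr rfl fun i _ => K.edgeIntegral_smul i a _ _

end MiscibleVEM

end


noncomputable section

namespace MiscibleVEM

/-! ### The projector `Π^∇` -/

instance finiteDimensional_polyGraph (S : Set E2) (m : ℤ) : FiniteDimensional ℝ (polyGraph S m) := by
  refine FiniteDimensional.span_of_finite ℝ ?_
  refine Set.Finite.subset ((finite_index m).biUnion (t := fun p =>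
    {f : L2 S × L2v S | (f.1 =ᵐ[volume.restrict S] fun x => x 0 ^ p.1 * x 1 ^ p.2) ∧
      f.2 =ᵐ[volume.restrict S] gradient fun x : E2 => x 0 ^ p.1 * x 1 ^ p.2}) fun p _ => ?_) ?_
  · refine Set.Subsingleton.finite fun f hf g hg => ?_
    rw [Set.mem_ofPred_eq] at hf hg
    exact Prod.ext (Lp.ext (hf.1.trans hg.1.symm)) (Lp.ext (hf.2.trans hg.2.symm))
  · rintro f ⟨i, j, h, hf⟩
    exact Set.mem_biUnion (x := (i, j)) h hf

theorem exists_hasTrace_of_mem_polyGraph {K : Polygon} {m : ℤ} {p : L2 K.carrier × L2v K.carrier}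
    (hp : p ∈ polyGraph K.carrier m) : ∃ t, HasTrace K p t := by
  obtain ⟨P, hP, h1, h2⟩ := exists_polyFun_of_mem_polyGraph hp
  exact ⟨_, hasTrace_of_ae_eq ((contDiff_of_mem_polyFun hP).of_le (by simp)) h1 h2⟩

theorem Polygon.edgePoint_mem_closure (K : Polygon) (i : Fin (K.m + 3)) {s : ℝ}
    (hs : s ∈ Icc (0 : ℝ) 1) : K.edgePoint i s ∈ closure K.carrier :=
  frontier_subset_closure (K.edgePoint_mem_frontier i hs)

/-- The perimeter of a polygon. -/
def Polygon.perimeter (K : Polygon) : ℝ := ∑ i, K.edgeLength i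

theorem Polygon.perimeter_pos (K : Polygon) : 0 < K.perimeter :=
  Finset.sum_pos (fun i _ => K.edgeLength_pos i) ⟨0, Finset.mem_univ _⟩

theorem boundaryIntegral_of_ae_eq {K : Polygon} {z : L2 K.carrier × L2v K.carrier} {P : E2 → ℝ}
    (hP : ContDiff ℝ 1 P) (h1 : z.1 =ᵐ[volume.restrict K.carrier] P)
    (h2 : z.2 =ᵐ[volume.restrict K.carrier] gradient P) {a : ℝ}
    (ha : ∀ x ∈ closure K.carrier, P x = a) : boundaryIntegral K z = K.perimeter * a := by
  rw [boundaryIntegral_eq (hasTrace_of_ae_eq hP h1 h2), Polygon.perimeter, Finset.sum_mul]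
  refine Finset.sum_congr rfl fun i _ => ?_
  rw [Polygon.edgeIntegral, intervalIntegral.integral_congr (g := fun _ => a)]
  · simp
  · intro s hs
    rw [uIcc_of_le zero_le_one] at hs
    simp [ha _ (K.edgePoint_mem_closure i hs)]

theorem eq_zero_of_mem_polyGraph {K : Polygon} {m : ℤ} {p : L2 K.carrier × L2v K.carrier}
    (hp : p ∈ polyGraph K.carrier m) (h2 : p.2 = 0) (hb : boundaryIntegral K p = 0) : p = 0 := by
  obtain ⟨P, hP, hP1, hP2⟩ := exists_polyFun_of_mem_polyGraph hp
  have hPc : ContDiff ℝ 1 P := (contDiff_of_mem_polyFun hP).of_le (by simp)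
  have hg : EqOn (gradient P) 0 K.carrier := by
    refine Measure.eqOn_open_of_ae_eq (μ := volume) ?_ K.isOpen_carrier
      (continuous_gradient hPc).continuousOn continuousOn_const
    refine hP2.symm.trans ?_
    rw [h2]
    exact Lp.coeFn_zero _ _ _
  have hconst : ∀ x ∈ K.carrier, P x = P K.center := fun x hx =>
    K.isOpen_carrier.is_const_of_fderiv_eq_zero (𝕜 := ℝ) K.isConnected_carrier.isPreconnected
      (hPc.differentiable one_ne_zero).differentiableOn (fun y hy => by
        ext v
        rw [← inner_gradient_left, hg hy]
        simp) hx K.center_mem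
  have hconst' : ∀ x ∈ closure K.carrier, P x = P K.center :=
    fun x hx => (show EqOn P (fun _ => P K.center) K.carrier from hconst).closure hPc.continuous
      continuous_const hx
  rw [boundaryIntegral_of_ae_eq hPc hP1 hP2 hconst'] at hb
  have h0 := (mul_eq_zero.1 hb).resolve_left K.perimeter_pos.ne'
  refine Prod.ext (Lp.ext ?_) h2
  refine (hP1.trans ?_).trans (Lp.coeFn_zero _ _ _).symm
  filter_upwards [ae_restrict_mem K.isOpen_carrier.measurableSet] with x hx
  rw [hconst x hx, h0]
  rfl

/-- The defining properties of the projection `Π^∇ z`. -/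
def IsGradProj (K : Polygon) (m : ℤ) (z p : L2 K.carrier × L2v K.carrier) : Prop :=
  p ∈ polyGraph K.carrier m ∧
    (∀ q ∈ polyGraph K.carrier m, (inner ℝ p.2 q.2 : ℝ) = inner ℝ z.2 q.2) ∧
    boundaryIntegral K p = boundaryIntegral K z

theorem IsGradProj.unique {K : Polygon} {m : ℤ} {z p q : L2 K.carrier × L2v K.carrier}
    (hp : IsGradProj K m z p) (hq : IsGradProj K m z q) : p = q := by
  have hsub := Submodule.sub_mem _ hp.1 hq.1
  rw [← sub_eq_zero]
  refine eq_zero_of_mem_polyGraph hsub ?_ ?_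
  · have : (inner ℝ (p - q).2 (p - q).2 : ℝ) = 0 := by
      rw [Prod.snd_sub, inner_sub_left, ← Prod.snd_sub, hp.2.1 _ hsub, hq.2.1 _ hsub, sub_self]
    exact inner_self_eq_zero.1 this
  · have := boundaryIntegral_add (exists_hasTrace_of_mem_polyGraph hp.1)
      (exists_hasTrace_of_mem_polyGraph (Submodule.smul_mem _ (-1 : ℝ) hq.1))
    rw [boundaryIntegral_smul (exists_hasTrace_of_mem_polyGraph hq.1), neg_one_smul,
      ← sub_eq_add_neg] at this
    rw [this, hp.2.2, hq.2.2]
    ring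

theorem exists_isGradProj {K : Polygon} {m : ℤ} (hm : 0 ≤ m) (z : L2 K.carrier × L2v K.carrier) :
    ∃ p, IsGradProj K m z p := by
  set W : Submodule ℝ (L2v K.carrier) :=
    (polyGraph K.carrier m).map (LinearMap.snd ℝ (L2 K.carrier) (L2v K.carrier)) with hW
  obtain ⟨p, hp, hpz⟩ := Submodule.mem_map.1 (W.starProjection_apply_mem z.2)
  obtain ⟨e, he, he1, he2⟩ := exists_mem_polyGraph K.isBounded_carrier (const_mem_polyFun hm 1)
  have he20 : e.2 = 0 := by
    refine Lp.ext (he2.trans ?_)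
    filter_upwards [Lp.coeFn_zero E2 2 (volume.restrict K.carrier)] with x hx
    rw [hx]
    simp [gradient]
  have heb : boundaryIntegral K e = K.perimeter :=
    (boundaryIntegral_of_ae_eq contDiff_const he1 he2 (fun _ _ => rfl)).trans (mul_one _)
  set a := (boundaryIntegral K z - boundaryIntegral K p) / K.perimeter with ha
  refine ⟨p + a • e, Submodule.add_mem _ hp (Submodule.smul_mem _ a he), fun q hq => ?_, ?_⟩
  · have hq2 : q.2 ∈ W := Submodule.mem_map.2 ⟨q, hq, rfl⟩
    have h := W.starProjection_inner_eq_zero z.2 q.2 hq2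
    rw [inner_sub_left, sub_eq_zero] at h
    rw [Prod.snd_add, Prod.smul_snd, he20, smul_zero, add_zero, h, ← hpz]
    rfl
  · rw [boundaryIntegral_add (exists_hasTrace_of_mem_polyGraph hp)
      (exists_hasTrace_of_mem_polyGraph (Submodule.smul_mem _ a he)),
      boundaryIntegral_smul (exists_hasTrace_of_mem_polyGraph he), heb, ha,
      div_mul_cancel₀ _ K.perimeter_pos.ne']
    ring

theorem isGradProj_projGrad (K : Polygon) {m : ℤ} (hm : 0 ≤ m) (z : L2 K.carrier × L2v K.carrier) :
    IsGradProj K m z (projGrad K m z) :=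
  Classical.epsilon_spec (exists_isGradProj hm z)

theorem IsGradProj.projGrad_eq {K : Polygon} {m : ℤ} (hm : 0 ≤ m)
    {z p : L2 K.carrier × L2v K.carrier} (h : IsGradProj K m z p) : projGrad K m z = p :=
  (isGradProj_projGrad K hm z).unique h

theorem projGrad_add {K : Polygon} {m : ℤ} (hm : 0 ≤ m) {z w : L2 K.carrier × L2v K.carrier}
    (hz : ∃ t, HasTrace K z t) (hw : ∃ t, HasTrace K w t) :
    projGrad K m (z + w) = projGrad K m z + projGrad K m w := by
  have h1 := isGradProj_projGrad K hm z
  have h2 := isGradProj_projGrad K hm w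
  refine IsGradProj.projGrad_eq hm ⟨Submodule.add_mem _ h1.1 h2.1, fun q hq => ?_, ?_⟩
  · rw [Prod.snd_add, Prod.snd_add, inner_add_left, inner_add_left, h1.2.1 q hq, h2.2.1 q hq]
  · rw [boundaryIntegral_add hz hw, boundaryIntegral_add (exists_hasTrace_of_mem_polyGraph h1.1)
      (exists_hasTrace_of_mem_polyGraph h2.1), h1.2.2, h2.2.2]

theorem projGrad_smul {K : Polygon} {m : ℤ} (hm : 0 ≤ m) {z : L2 K.carrier × L2v K.carrier}
    (hz : ∃ t, HasTrace K z t) (a : ℝ) : projGrad K m (a • z) = a • projGrad K m z := by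
  have h1 := isGradProj_projGrad K hm z
  refine IsGradProj.projGrad_eq hm ⟨Submodule.smul_mem _ a h1.1, fun q hq => ?_, ?_⟩
  · rw [Prod.smul_snd, Prod.smul_snd, inner_smul_left, inner_smul_left, h1.2.1 q hq]
  · rw [boundaryIntegral_smul hz, boundaryIntegral_smul (exists_hasTrace_of_mem_polyGraph h1.1),
      h1.2.2]

theorem projGrad_of_mem {K : Polygon} {m : ℤ} (hm : 0 ≤ m) {p : L2 K.carrier × L2v K.carrier}
    (hp : p ∈ polyGraph K.carrier m) : projGrad K m p = p :=
  IsGradProj.projGrad_eq hm ⟨hp, fun _ _ => rfl, rfl⟩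

/-! ### The local spaces are finite-dimensional vector spaces -/

theorem ZhLoc.exists_hasTrace {k : ℕ} {K : Polygon} {z : L2 K.carrier × L2v K.carrier}
    (hz : z ∈ ZhLoc k K) : ∃ t, HasTrace K z t := by
  obtain ⟨⟨g, -, -, h⟩, -⟩ := hz
  exact ⟨_, h⟩

/-- The condition `Δz = d`, tested with smooth functions, in terms of `L²` inner products. -/
theorem laplace_iff {K : Polygon} (z : L2v K.carrier) (d : L2 K.carrier) :
    (∀ f, IsTest K.carrier f →
      ∫ x in K.carrier, (inner ℝ (z x) (gradient f x) : ℝ) = -∫ x in K.carrier, d x * f x) ↔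
    ∀ f, IsTest K.carrier f → (inner ℝ z (toL2 K.carrier (gradient f)) : ℝ) =
      -inner ℝ d (toL2 K.carrier f) := by
  refine forall_congr' fun f => forall_congr' fun hf => ?_
  rw [integral_inner_eq _ (hf.memLp_gradient K.isBounded_carrier),
    integral_mul_eq _ (hf.memLp K.isBounded_carrier)]

/-- The condition `rot v = r`, tested with smooth functions, in terms of `L²` inner products. -/
theorem rot_iff {K : Polygon} (v : L2v K.carrier) (r : L2 K.carrier) :
    (∀ f, IsTest K.carrier f →
      ∫ x in K.carrier, (inner ℝ (v x) (curl f x) : ℝ) = ∫ x in K.carrier, r x * f x) ↔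
    ∀ f, IsTest K.carrier f → (inner ℝ v (toL2 K.carrier (curl f)) : ℝ) =
      inner ℝ r (toL2 K.carrier f) := by
  refine forall_congr' fun f => forall_congr' fun hf => ?_
  rw [integral_inner_eq _ (hf.memLp_curl K.isBounded_carrier),
    integral_mul_eq _ (hf.memLp K.isBounded_carrier)]

/-- The condition `v · n = g`, tested with smooth functions, in terms of `L²` inner products. -/
theorem flux_iff {K : Polygon} (v : L2v K.carrier × L2 K.carrier) (g : Fin (K.m + 3) → ℝ → ℝ) :
    (∀ f, IsTest univ f →
      ∫ x in K.carrier, ((inner ℝ (v.1 x) (gradient f x) : ℝ) + v.2 x * f x) =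
        ∑ i, K.edgeIntegral i (g i) f) ↔
    ∀ f, IsTest univ f → (inner ℝ v.1 (toL2 K.carrier (gradient f)) : ℝ) +
      inner ℝ v.2 (toL2 K.carrier f) = ∑ i, K.edgeIntegral i (g i) f := by
  refine forall_congr' fun f => forall_congr' fun hf => ?_
  rw [K.integral_inner_add_eq v hf]

/-- `Z_h(K)` as a vector space. -/
def zhLoc (k : ℕ) (K : Polygon) : Submodule ℝ (L2 K.carrier × L2v K.carrier) where
  carrier := ZhLoc k K
  zero_mem' := by
    have h0 : HasTrace K (0 : L2 K.carrier × L2v K.carrier)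
        fun i s => ((0 : Fin (K.m + 3) → Polynomial ℝ) i).eval s := by
      rw [hasTrace_iff]
      exact ⟨fun i => by simp, fun f _ j => by simp [Polygon.edgeIntegral]⟩
    refine ⟨⟨0, by simp, by simp, h0⟩, ⟨0, Submodule.zero_mem _, (laplace_iff _ _).2 (by simp)⟩, ?_⟩
    intro p _ _
    rw [projGrad_of_mem (by positivity) (Submodule.zero_mem _)]
  add_mem' := by
    intro z w hz hw
    have ez := ZhLoc.exists_hasTrace hz
    have ew := ZhLoc.exists_hasTrace hw
    obtain ⟨⟨g, hg, hgc, hgt⟩, ⟨d, hd, hdz⟩, hpz⟩ := hz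
    obtain ⟨⟨g', hg', hgc', hgt'⟩, ⟨d', hd', hdw⟩, hpw⟩ := hw
    rw [laplace_iff] at hdz hdw
    refine ⟨⟨g + g', fun i => Polynomial.natDegree_add_le_of_degree_le (hg i) (hg' i),
      fun i => by simp [hgc, hgc'], by simpa using hgt.add hgt'⟩,
      ⟨d + d', Submodule.add_mem _ hd hd', (laplace_iff _ _).2 fun f hf => ?_⟩, fun p hp hq => ?_⟩
    · rw [Prod.snd_add, inner_add_left, inner_add_left, hdz f hf, hdw f hf]; ring
    · rw [projGrad_add (by positivity) ez ew, Prod.fst_add, Prod.fst_add, inner_add_left,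
        inner_add_left, hpz p hp hq, hpw p hp hq]
  smul_mem' := by
    intro a z hz
    have ez := ZhLoc.exists_hasTrace hz
    obtain ⟨⟨g, hg, hgc, hgt⟩, ⟨d, hd, hdz⟩, hpz⟩ := hz
    rw [laplace_iff] at hdz
    refine ⟨⟨a • g, fun i => (Polynomial.natDegree_smul_le _ _).trans (hg i),
      fun i => by simp [hgc], by simpa using hgt.smul a⟩,
      ⟨a • d, Submodule.smul_mem _ a hd, (laplace_iff _ _).2 fun f hf => ?_⟩, fun p hp hq => ?_⟩
    · rw [Prod.smul_snd, inner_smul_left, inner_smul_left, hdz f hf]; simp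
    · rw [projGrad_smul (by positivity) ez, Prod.smul_fst, Prod.smul_fst, inner_smul_left,
        inner_smul_left, hpz p hp hq]

theorem inner_div_toL2 {K : Polygon} {v : L2v K.carrier × L2 K.carrier} {P : Fin 2 → E2 → ℝ}
    (hP : ∀ l, ContDiff ℝ 1 (P l))
    (h1 : v.1 =ᵐ[volume.restrict K.carrier] fun x => !₂[P 0 x, P 1 x])
    (h2 : v.2 =ᵐ[volume.restrict K.carrier] fun x => gradient (P 0) x 0 + gradient (P 1) x 1)
    {f : E2 → ℝ} (hf : IsTest univ f) :
    (inner ℝ v.1 (toL2 K.carrier (gradient f)) : ℝ) + inner ℝ v.2 (toL2 K.carrier f) =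
      ∑ i, K.edgeIntegral i
        (fun s => ∑ l, P l (K.edgePoint i s) * K.normal i l) f := by
  have hint : ∀ l, IntegrableOn
      (fun x => P l x * gradient f x l + f x * gradient (P l) x l) K.carrier := fun l => by
    have h1 := (hP l).continuous
    have h2 := continuous_gradient (hP l)
    have h3 := continuous_gradient hf.contDiff_one
    have h4 := hf.1.continuous
    exact K.integrableOn_of_continuous (by fun_prop)
  rw [← K.integral_inner_add_eq v hf]
  have e : ∫ x in K.carrier, ((inner ℝ (v.1 x) (gradient f x) : ℝ) + v.2 x * f x) =
      ∫ x in K.carrier, ((P 0 x * gradient f x 0 + f x * gradient (P 0) x 0) +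
        (P 1 x * gradient f x 1 + f x * gradient (P 1) x 1)) := by
    refine integral_congr_ae ?_
    filter_upwards [h1, h2] with x hx1 hx2
    rw [hx1, hx2, E2.inner_eq]
    simp
    ring
  rw [e, integral_add (hint 0) (hint 1), K.integral_gradient_mul (hP 0) hf.contDiff_one,
    K.integral_gradient_mul (hP 1) hf.contDiff_one, ← Finset.sum_add_distrib]
  refine Finset.sum_congr rfl fun i _ => ?_
  have hc := K.continuous_edgePoint i
  have h1 := (hP 0).continuous
  have h2 := (hP 1).continuous
  rw [← K.edgeIntegral_add i (Polygon.memLp_edge (by fun_prop)) (Polygon.memLp_edge (by fun_prop))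
    hf.1.continuous]
  simp [Fin.sum_univ_two]

theorem IsTest.edge_eq_zero {K : Polygon} {f : E2 → ℝ} (hf : IsTest K.carrier f)
    (i : Fin (K.m + 3)) {s : ℝ} (hs : s ∈ Icc (0 : ℝ) 1) : f (K.edgePoint i s) = 0 :=
  image_eq_zero_of_notMem_tsupport fun h =>
    K.not_mem_of_frontier (K.edgePoint_mem_frontier i hs) (hf.2.2 h)

theorem IsTest.edgeIntegral_eq_zero {K : Polygon} {f : E2 → ℝ} (hf : IsTest K.carrier f)
    (i : Fin (K.m + 3)) (g : ℝ → ℝ) : K.edgeIntegral i g f = 0 := by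
  rw [Polygon.edgeIntegral, intervalIntegral.integral_congr (g := fun _ => 0)]
  · simp
  · intro s hs
    rw [uIcc_of_le zero_le_one] at hs
    simp [hf.edge_eq_zero i hs]

theorem polyGraph_le_zhLoc (k : ℕ) (K : Polygon) :
    polyGraph K.carrier ((k : ℤ) + 1) ≤ zhLoc k K := by
  intro p hp
  obtain ⟨P, hP, h1, h2⟩ := exists_polyFun_of_mem_polyGraph hp
  have hPc : ContDiff ℝ ∞ P := contDiff_of_mem_polyFun hP
  have hPc1 : ContDiff ℝ 1 P := hPc.of_le (by simp)
  refine ⟨?_, ?_, fun q _ _ => by rw [projGrad_of_mem (by positivity) hp]⟩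
  · have := fun i => exists_polynomial_edge K i (n := k + 1) (by exact_mod_cast hP)
    choose g hg hgP using this
    refine ⟨g, hg, fun i => ?_, ?_⟩
    · rw [← hgP, ← hgP, K.edgePoint_one, K.edgePoint_zero]
    · have := hasTrace_of_ae_eq hPc1 h1 h2
      simpa only [hgP] using this
  · have hQ : ∀ l, (fun x => gradient P x l) ∈ polyFun ((k : ℤ) + 1 - 1) :=
      gradient_mem_polyFun hP
    have hL : (fun x => gradient (fun x => gradient P x 0) x 0 +
        gradient (fun x => gradient P x 1) x 1) ∈ polyFun ((k : ℤ) + 1) :=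
      polyFun_mono (by omega) (Submodule.add_mem _ (gradient_mem_polyFun (hQ 0) 0)
        (gradient_mem_polyFun (hQ 1) 1))
    obtain ⟨d, hd, hd'⟩ := exists_mem_polyL2 K.isBounded_carrier hL
    refine ⟨d, hd, (laplace_iff _ _).2 fun f hf => ?_⟩
    have h := inner_div_toL2 (K := K) (v := (p.2, d)) (P := fun l x => gradient P x l)
      (fun l => (contDiff_of_mem_polyFun (hQ l)).of_le (by simp)) (h2.trans
        (Filter.Eventually.of_forall fun x => by apply E2.ext <;> simp)) hd'
      (hf.mono (subset_univ _))
    simp only [hf.edgeIntegral_eq_zero, Finset.sum_const_zero] at h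
    exact eq_neg_of_add_eq_zero_left h

/-- `V_h(K)` as a vector space. -/
def vhLoc (k : ℕ) (K : Polygon) : Submodule ℝ (L2v K.carrier × L2 K.carrier) where
  carrier := VhLoc k K
  zero_mem' := by
    refine ⟨Submodule.zero_mem _, ⟨0, by simp, (flux_iff _ _).2 ?_⟩, 0, Submodule.zero_mem _,
      (rot_iff _ _).2 (by simp)⟩
    simp [Polygon.edgeIntegral]
  add_mem' := by
    intro v w hv hw
    obtain ⟨hv2, ⟨g, hg, hgv⟩, r, hr, hrv⟩ := hv
    obtain ⟨hw2, ⟨g', hg', hgw⟩, r', hr', hrw⟩ := hw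
    have hgv' := (flux_iff v fun i s => (g i).eval s).1 hgv
    have hgw' := (flux_iff w fun i s => (g' i).eval s).1 hgw
    rw [rot_iff] at hrv hrw
    refine ⟨Submodule.add_mem _ hv2 hw2, ⟨g + g', fun i =>
      Polynomial.natDegree_add_le_of_degree_le (hg i) (hg' i),
      (flux_iff _ (fun i s => ((g + g') i).eval s)).2 fun f hf => ?_⟩,
      r + r', Submodule.add_mem _ hr hr', (rot_iff _ _).2 fun f hf => ?_⟩
    · simp only [Pi.add_apply, Polynomial.eval_add]
      simp only [K.edgeIntegral_add _ (Polygon.memLp_edge (Polynomial.continuous _))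
        (Polygon.memLp_edge (Polynomial.continuous _)) hf.1.continuous, Finset.sum_add_distrib]
      rw [← hgv' f hf, ← hgw' f hf, Prod.fst_add, Prod.snd_add, inner_add_left, inner_add_left]
      ring
    · rw [Prod.fst_add, inner_add_left, inner_add_left, hrv f hf, hrw f hf]
  smul_mem' := by
    intro a v hv
    obtain ⟨hv2, ⟨g, hg, hgv⟩, r, hr, hrv⟩ := hv
    have hgv' := (flux_iff v fun i s => (g i).eval s).1 hgv
    rw [rot_iff] at hrv
    refine ⟨Submodule.smul_mem _ a hv2, ⟨a • g, fun i =>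
      (Polynomial.natDegree_smul_le _ _).trans (hg i),
      (flux_iff _ (fun i s => ((a • g) i).eval s)).2 fun f hf => ?_⟩,
      a • r, Submodule.smul_mem _ a hr, (rot_iff _ _).2 fun f hf => ?_⟩
    · simp only [Pi.smul_apply, Polynomial.eval_smul, smul_eq_mul]
      simp only [K.edgeIntegral_smul, ← Finset.mul_sum]
      rw [← hgv' f hf, Prod.smul_fst, Prod.smul_snd, inner_smul_left, inner_smul_left]
      simp only [conj_trivial]
      ring
    · rw [Prod.smul_fst, inner_smul_left, inner_smul_left, hrv f hf]

theorem exists_mem_vhLoc {k : ℕ} {K : Polygon} {p : L2v K.carrier} (hp : p ∈ polyL2v K.carrier k) :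
    ∃ d, (p, d) ∈ vhLoc k K := by
  obtain ⟨P, hP, hpP⟩ := exists_polyFun_of_mem_polyL2v hp
  have hPc : ∀ l, ContDiff ℝ 1 (P l) := fun l => (contDiff_of_mem_polyFun (hP l)).of_le (by simp)
  have hdiv : (fun x => gradient (P 0) x 0 + gradient (P 1) x 1) ∈ polyFun ((k : ℤ) - 1) :=
    Submodule.add_mem _ (gradient_mem_polyFun (hP 0) 0) (gradient_mem_polyFun (hP 1) 1)
  obtain ⟨d, hd, hd'⟩ := exists_mem_polyL2 K.isBounded_carrier (polyFun_mono (n := (k : ℤ)) (by omega) hdiv)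
  have hrot : (fun x => gradient (P 1) x 0 - gradient (P 0) x 1) ∈ polyFun ((k : ℤ) - 1) :=
    Submodule.sub_mem _ (gradient_mem_polyFun (hP 1) 0) (gradient_mem_polyFun (hP 0) 1)
  obtain ⟨r, hr, hr'⟩ := exists_mem_polyL2 K.isBounded_carrier hrot
  have := fun l i => exists_polynomial_edge K i (n := k) (hP l)
  choose g hg hgP using this
  refine ⟨d, hd, ⟨fun i => ∑ l, g l i * Polynomial.C (K.normal i l), fun i => ?_,
    (flux_iff (p, d) (fun i s => (∑ l, g l i * Polynomial.C (K.normal i l)).eval s)).2 fun f hf => ?_⟩,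
    r, hr, (rot_iff p r).2 fun f hf => ?_⟩
  · refine Polynomial.natDegree_sum_le_of_forall_le _ _ fun l _ => ?_
    exact (Polynomial.natDegree_mul_C_le _ _).trans (hg l i)
  · rw [inner_div_toL2 hPc hpP hd' hf]
    simp [hgP]
  · have hf' : IsTest univ f := hf.mono (subset_univ _)
    have hb := K.isBounded_carrier
    -- rotate the field
    have hq : MemLp (fun x => (!₂[-P 1 x, P 0 x] : E2)) 2 (volume.restrict K.carrier) := by
      refine memLp_of_continuous hb ((PiLp.continuous_toLp 2 _).comp (continuous_pi fun i => ?_)) 2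
      have h0 := (hPc 0).continuous
      have h1 := (hPc 1).continuous
      fin_cases i <;> simp <;> fun_prop
    have h := inner_div_toL2 (K := K) (v := (toL2 K.carrier fun x => (!₂[-P 1 x, P 0 x] : E2), -r))
      (P := ![fun x => (-1) * P 1 x, P 0]) (fun l => by
        fin_cases l
        · exact contDiff_const.mul (hPc 1)
        · exact hPc 0) ((coeFn_toL2 hq).trans (Filter.Eventually.of_forall fun x => by simp)) (by
        filter_upwards [hr', Lp.coeFn_neg r] with x hx hx'
        simp only [Matrix.cons_val_zero, Matrix.cons_val_one]
        rw [hx', Pi.neg_apply, hx, gradient_const_mul ((hPc 1).differentiable one_ne_zero)]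
        simp
        ring) hf'
    simp only [hf.edgeIntegral_eq_zero, Finset.sum_const_zero, inner_neg_left] at h
    rw [← sub_eq_add_neg, sub_eq_zero] at h
    rw [← h, ← integral_inner_eq _ (hf.memLp_curl hb), ← integral_inner_eq _ (hf.memLp_gradient hb)]
    refine integral_congr_ae ?_
    filter_upwards [hpP, coeFn_toL2 hq] with x hx1 hx2
    rw [hx1, hx2, E2.inner_eq, E2.inner_eq]
    simp [curl]
    ring

/-- A space on which a linear relation to a finite-dimensional space is defined and injective is
finite-dimensional. -/
theorem finiteDimensional_of_relation {E F : Type*} [AddCommGroup E] [Module ℝ E] [AddCommGroup F]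
    [Module ℝ F] [FiniteDimensional ℝ F] (Z : Submodule ℝ E) (R : Submodule ℝ (E × F))
    (hex : ∀ z ∈ Z, ∃ y, (z, y) ∈ R) (hinj : ∀ z, (z, 0) ∈ R → z = 0) :
    FiniteDimensional ℝ Z := by
  have h1 : Function.Injective ((LinearMap.snd ℝ E F).comp R.subtype) := by
    rw [← LinearMap.ker_eq_bot, LinearMap.ker_eq_bot']
    rintro ⟨⟨z, y⟩, h⟩ hy
    simp only [LinearMap.comp_apply, Submodule.subtype_apply, LinearMap.snd_apply] at hy
    subst hy
    simp [hinj z h]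
  have h2 : FiniteDimensional ℝ R := FiniteDimensional.of_injective _ h1
  have h3 : Z ≤ R.map (LinearMap.fst ℝ E F) := fun z hz => by
    obtain ⟨y, hy⟩ := hex z hz
    exact ⟨(z, y), hy, rfl⟩
  exact Submodule.finiteDimensional_of_le h3

theorem IsTest.gradient_apply {f : E2 → ℝ} (hf : IsTest univ f) (l : Fin 2) :
    IsTest univ fun x => gradient f x l := by
  have e : (fun x => gradient f x l) = fun x => fderiv ℝ f x (EuclideanSpace.single l 1) :=
    funext fun x => MiscibleVEM.gradient_apply f x l
  rw [e]
  refine ⟨?_, hf.2.1.fderiv_apply ℝ _, subset_univ _⟩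
  exact ((contDiff_infty_iff_fderiv.1 hf.1).2).clm_apply contDiff_const

theorem gradient_gradient_comm {f : E2 → ℝ} (hf : ContDiff ℝ ∞ f) (x : E2) (i j : Fin 2) :
    gradient (fun x => gradient f x i) x j = gradient (fun x => gradient f x j) x i := by
  have hd : Differentiable ℝ (fderiv ℝ f) := ((contDiff_infty_iff_fderiv.1 hf).2).differentiable (by simp)
  have h : ∀ i j, gradient (fun x => gradient f x i) x j =
      fderiv ℝ (fderiv ℝ f) x (EuclideanSpace.single j 1) (EuclideanSpace.single i 1) := fun i j => by
    simp only [gradient_apply]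
    rw [fderiv_clm_apply (hd x) (differentiableAt_const _)]
    simp
  rw [h, h]
  have hs : IsSymmSndFDerivAt ℝ f x :=
    ContDiffAt.isSymmSndFDerivAt hf.contDiffAt (by
      rw [minSmoothness_of_isRCLikeNormedField]; exact WithTop.coe_le_coe.2 le_top)
  exact hs _ _

/-- The Dirichlet problem in a star-shaped polygon has at most one solution. -/
theorem eq_zero_of_laplace_of_trace {K : Polygon} {z : L2 K.carrier × L2v K.carrier}
    (ht : HasTrace K z fun _ _ => 0)
    (hd : ∀ f, IsTest K.carrier f → (inner ℝ z.2 (toL2 K.carrier (gradient f)) : ℝ) = 0) : z = 0 := by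
  have hb := K.isBounded_carrier
  have ht' : ∀ f, IsTest univ f → ∀ j,
      ∫ x in K.carrier, (z.1 x * gradient f x j + f x * z.2 x j) = 0 := fun f hf j => by
    have h := ht.2 f hf
    have h2 : ∑ i, K.edgeIntegral i (fun _ => (0 : ℝ)) f • K.normal i = 0 := by
      simp [Polygon.edgeIntegral]
    rw [h2] at h
    have h3 := congrFun (congrArg WithLp.ofLp h) j
    rw [E2.integral_apply] at h3
    · simpa using h3
    · exact (integrable_smul_of_memLp (Lp.memLp _) (hf.memLp_gradient hb)).add
        (integrable_smul_of_memLp (hf.memLp hb) (Lp.memLp _))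
  have hint : ∀ f, IsTest univ f → ∀ j,
      IntegrableOn (fun x => z.1 x * gradient f x j + f x * z.2 x j) K.carrier := fun f hf j => by
    refine Integrable.add (integrable_mul_of_memLp (Lp.memLp _) (hf.memLp_gradient_apply hb j)) ?_
    have := integrable_inner_of_memLp (Lp.memLp z.2) (hf.memLp_single hb j)
    refine this.congr (Filter.Eventually.of_forall fun x => ?_)
    simp [inner_smul_right, EuclideanSpace.inner_single_right]
  set Rot : E2 →L[ℝ] E2 :=
    (EuclideanSpace.proj 1 : E2 →L[ℝ] ℝ).smulRight (EuclideanSpace.single 0 1) -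
      (EuclideanSpace.proj 0 : E2 →L[ℝ] ℝ).smulRight (EuclideanSpace.single 1 1) with hRot
  have hR0 : ∀ x, Rot x 0 = x 1 := fun x => by simp [hRot]
  have hR1 : ∀ x, Rot x 1 = -x 0 := fun x => by simp [hRot]
  have hz2 : z.2 = 0 := by
    have h0 : Rot.compLp z.2 = 0 := by
      refine eq_zero_of_divFree_of_rotFree K _ (fun f hf => ?_) fun f hf => ?_
      · have h1 := ht' _ (hf.gradient_apply 0) 1
        have h2 := ht' _ (hf.gradient_apply 1) 0
        rw [← sub_zero (0 : ℝ)]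
        nth_rewrite 1 [← h1]
        rw [← h2, ← integral_sub (hint _ (hf.gradient_apply 0) 1) (hint _ (hf.gradient_apply 1) 0)]
        refine integral_congr_ae ?_
        filter_upwards [Rot.coeFn_compLp z.2] with x hx
        rw [hx, E2.inner_eq, hR0, hR1, gradient_gradient_comm hf.1 x 0 1]
        ring
      · rw [← hd f hf, ← integral_inner_eq _ (hf.memLp_gradient hb)]
        refine integral_congr_ae ?_
        filter_upwards [Rot.coeFn_compLp z.2] with x hx
        rw [hx, E2.inner_eq, E2.inner_eq, hR0, hR1]
        simp [curl]
        ring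
    refine Lp.ext ?_
    have h1 : Rot.compLp z.2 =ᵐ[volume.restrict K.carrier] 0 := by
      rw [h0]; exact Lp.coeFn_zero _ _ _
    filter_upwards [h1, Rot.coeFn_compLp z.2, Lp.coeFn_zero E2 2 (volume.restrict K.carrier)]
      with x hx1 hx2 hx3
    rw [hx3]
    rw [hx1] at hx2
    have e0 := hR0 (z.2 x)
    have e1 := hR1 (z.2 x)
    rw [← hx2] at e0 e1
    simp at e0 e1
    exact E2.ext (by simp [← e1]) (by simp [← e0])
  have hz2x : ∀ᵐ x ∂(volume.restrict K.carrier), z.2 x = 0 := by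
    rw [hz2]; exact Lp.coeFn_zero _ _ _
  set T : ℝ →L[ℝ] E2 := ContinuousLinearMap.toSpanSingleton ℝ (EuclideanSpace.single 0 1) with hT
  have hT0 : ∀ a, T a 0 = a := fun a => by simp [hT]
  have hT1 : ∀ a, T a 1 = 0 := fun a => by simp [hT]
  have hz1 : T.compLp z.1 = 0 := by
    refine eq_zero_of_divFree_of_rotFree K _ (fun f hf => ?_) fun f hf => ?_
    · rw [← ht' f hf 0]
      refine integral_congr_ae ?_
      filter_upwards [T.coeFn_compLp z.1, hz2x] with x hx hx2
      rw [hx, E2.inner_eq, hT0, hT1, hx2]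
      simp
    · rw [← ht' f (hf.mono (subset_univ _)) 1]
      refine integral_congr_ae ?_
      filter_upwards [T.coeFn_compLp z.1, hz2x] with x hx hx2
      rw [hx, E2.inner_eq, hT0, hT1, hx2]
      simp [curl]
  refine Prod.ext (Lp.ext ?_) hz2
  have h1 : T.compLp z.1 =ᵐ[volume.restrict K.carrier] 0 := by
    rw [hz1]; exact Lp.coeFn_zero _ _ _
  filter_upwards [h1, T.coeFn_compLp z.1, Lp.coeFn_zero ℝ 2 (volume.restrict K.carrier)]
    with x hx1 hx2 hx3
  rw [Prod.fst_zero, hx3]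
  have e0 := hT0 (z.1 x)
  rw [← hx2, hx1] at e0
  exact e0.symm

theorem mem_degreeLT_of_natDegree_le {p : Polynomial ℝ} {n : ℕ} (h : p.natDegree ≤ n) :
    p ∈ Polynomial.degreeLT ℝ (n + 1) := by
  rw [Polynomial.mem_degreeLT]
  exact lt_of_le_of_lt (Polynomial.degree_le_of_natDegree_le h) (by exact_mod_cast Nat.lt_succ_self n)

instance finiteDimensional_degreeLT (n : ℕ) : FiniteDimensional ℝ (Polynomial.degreeLT ℝ n) :=
  (Polynomial.degreeLTEquiv ℝ n).symm.finiteDimensional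

instance finiteDimensional_zhLoc (k : ℕ) (K : Polygon) : FiniteDimensional ℝ (zhLoc k K) := by
  set R : Submodule ℝ ((L2 K.carrier × L2v K.carrier) ×
      ((Fin (K.m + 3) → Polynomial.degreeLT ℝ (k + 2)) × polyL2 K.carrier ((k : ℤ) + 1))) :=
    { carrier := {q | HasTrace K q.1 (fun i s => (q.2.1 i).1.eval s) ∧
        ∀ f, IsTest K.carrier f → (inner ℝ q.1.2 (toL2 K.carrier (gradient f)) : ℝ) =
          -inner ℝ q.2.2.1 (toL2 K.carrier f)}
      zero_mem' := by
        have h0 : HasTrace K (0 : L2 K.carrier × L2v K.carrier) fun _ _ => 0 := by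
          rw [hasTrace_iff]
          exact ⟨fun i => by simp, fun f _ j => by simp [Polygon.edgeIntegral]⟩
        exact ⟨by simpa using h0, by simp⟩
      add_mem' := by
        rintro p q ⟨h1, h2⟩ ⟨h3, h4⟩
        refine ⟨by simpa using h1.add h3, fun f hf => ?_⟩
        simp only [Prod.fst_add, Prod.snd_add, Submodule.coe_add, inner_add_left, h2 f hf, h4 f hf]
        ring
      smul_mem' := by
        rintro a p ⟨h1, h2⟩
        refine ⟨by simpa using h1.smul a, fun f hf => ?_⟩
        simp only [Prod.smul_fst, Prod.smul_snd, Submodule.coe_smul, inner_smul_left, h2 f hf]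
        simp } with hR
  refine finiteDimensional_of_relation (zhLoc k K) R (fun z hz => ?_) fun z hz => ?_
  · obtain ⟨⟨g, hg, -, hgt⟩, ⟨d, hd, hdz⟩, -⟩ := hz
    exact ⟨(fun i => ⟨g i, mem_degreeLT_of_natDegree_le (hg i)⟩, ⟨d, hd⟩), hgt,
      (laplace_iff _ _).1 hdz⟩
  · obtain ⟨h1, h2⟩ := hz
    refine eq_zero_of_laplace_of_trace (by simpa using h1) fun f hf => ?_
    simpa using h2 f hf

instance finiteDimensional_vhLoc (k : ℕ) (K : Polygon) : FiniteDimensional ℝ (vhLoc k K) := by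
  set R : Submodule ℝ ((L2v K.carrier × L2 K.carrier) ×
      ((Fin (K.m + 3) → Polynomial.degreeLT ℝ (k + 1)) × polyL2 K.carrier ((k : ℤ) - 1) ×
        polyL2 K.carrier k)) :=
    { carrier := {q | (∀ f, IsTest univ f → (inner ℝ q.1.1 (toL2 K.carrier (gradient f)) : ℝ) +
          inner ℝ q.1.2 (toL2 K.carrier f) =
            ∑ i, K.edgeIntegral i (fun s => (q.2.1 i).1.eval s) f) ∧
        (∀ f, IsTest K.carrier f → (inner ℝ q.1.1 (toL2 K.carrier (curl f)) : ℝ) =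
          inner ℝ q.2.2.1.1 (toL2 K.carrier f)) ∧ q.1.2 = q.2.2.2.1}
      zero_mem' := by simp [Polygon.edgeIntegral]
      add_mem' := by
        rintro p q ⟨h1, h2, h3⟩ ⟨h4, h5, h6⟩
        refine ⟨fun f hf => ?_, fun f hf => ?_, by simp [h3, h6]⟩
        · simp only [Prod.fst_add, Prod.snd_add, Pi.add_apply, Submodule.coe_add,
            Polynomial.eval_add]
          simp only [K.edgeIntegral_add _ (Polygon.memLp_edge (Polynomial.continuous _))
            (Polygon.memLp_edge (Polynomial.continuous _)) hf.1.continuous, Finset.sum_add_distrib]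
          rw [← h1 f hf, ← h4 f hf, inner_add_left, inner_add_left]
          ring
        · simp only [Prod.fst_add, Prod.snd_add, Submodule.coe_add, inner_add_left, h2 f hf, h5 f hf]
      smul_mem' := by
        rintro a p ⟨h1, h2, h3⟩
        refine ⟨fun f hf => ?_, fun f hf => ?_, by simp [h3]⟩
        · simp only [Prod.smul_fst, Prod.smul_snd, Pi.smul_apply, Submodule.coe_smul,
            Polynomial.eval_smul, smul_eq_mul]
          simp only [K.edgeIntegral_smul, ← Finset.mul_sum]
          rw [← h1 f hf, inner_smul_left, inner_smul_left]
          simp only [conj_trivial]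
          ring
        · simp only [Prod.smul_fst, Prod.smul_snd, Submodule.coe_smul, inner_smul_left, h2 f hf] }
    with hR
  refine finiteDimensional_of_relation (vhLoc k K) R (fun v hv => ?_) fun v hv => ?_
  · obtain ⟨hv2, ⟨g, hg, hgv⟩, r, hr, hrv⟩ := hv
    exact ⟨(fun i => ⟨g i, mem_degreeLT_of_natDegree_le (hg i)⟩, ⟨r, hr⟩, ⟨v.2, hv2⟩),
      (flux_iff v fun i s => (g i).eval s).1 hgv, (rot_iff _ _).1 hrv, rfl⟩
  · obtain ⟨h1, h2, h3⟩ := hv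
    have hv2 : v.2 = 0 := by simpa using h3
    refine Prod.ext (eq_zero_of_divFree_of_rotFree K v.1 (fun f hf => ?_) fun f hf => ?_) hv2
    · rw [integral_inner_eq _ (hf.memLp_gradient K.isBounded_carrier)]
      simpa [hv2, Polygon.edgeIntegral] using h1 f hf
    · rw [integral_inner_eq _ (hf.memLp_curl K.isBounded_carrier)]
      simpa using h2 f hf

end MiscibleVEM

end


noncomputable section

namespace MiscibleVEM

/-! ### Local velocities with prescribed divergence and normal trace -/

theorem IsTest.gradient_edge_eq_zero {K : Polygon} {f : E2 → ℝ} (hf : IsTest K.carrier f)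
    (i : Fin (K.m + 3)) {s : ℝ} (hs : s ∈ Icc (0 : ℝ) 1) : gradient f (K.edgePoint i s) = 0 := by
  have h : fderiv ℝ f (K.edgePoint i s) = 0 := fderiv_of_notMem_tsupport ℝ fun h =>
    K.not_mem_of_frontier (K.edgePoint_mem_frontier i hs) (hf.2.2 h)
  rw [gradient, h, map_zero]

theorem inner_curl_gradient {K : Polygon} {f g : E2 → ℝ} (hf : IsTest K.carrier f)
    (hg : IsTest univ g) :
    (inner ℝ (toL2 K.carrier (gradient g)) (toL2 K.carrier (curl f)) : ℝ) = 0 := by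
  have hf' : IsTest univ f := hf.mono (subset_univ _)
  have h := inner_div_toL2 (K := K) (v := (toL2 K.carrier (curl f), 0))
    (P := ![fun x => gradient f x 1, fun x => (-1) * gradient f x 0]) (fun l => by
      fin_cases l
      · exact (hf'.gradient_apply 1).contDiff_one
      · exact contDiff_const.mul (hf'.gradient_apply 0).contDiff_one)
    ((coeFn_toL2 (hf.memLp_curl K.isBounded_carrier)).trans
      (Filter.Eventually.of_forall fun x => by simp [curl])) (by
      filter_upwards [Lp.coeFn_zero ℝ 2 (volume.restrict K.carrier)] with x hx
      simp only [Matrix.cons_val_zero, Matrix.cons_val_one]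
      rw [hx, gradient_const_mul ((hf'.gradient_apply 0).contDiff_one.differentiable one_ne_zero),
        PiLp.smul_apply, gradient_gradient_comm hf.1 x 0 1]
      simp) hg
  rw [inner_zero_left, add_zero] at h
  rw [real_inner_comm, h]
  refine Finset.sum_eq_zero fun i _ => ?_
  rw [Polygon.edgeIntegral, intervalIntegral.integral_congr (g := fun _ => 0)]
  · simp
  · intro s hs
    rw [uIcc_of_le zero_le_one] at hs
    simp [hf.gradient_edge_eq_zero i hs]

theorem edgeIntegral_congr {K : Polygon} (i : Fin (K.m + 3)) {g h : ℝ → ℝ} {f f' : E2 → ℝ}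
    (hgh : ∀ s ∈ Icc (0 : ℝ) 1, g s * f (K.edgePoint i s) = h s * f' (K.edgePoint i s)) :
    K.edgeIntegral i g f = K.edgeIntegral i h f' := by
  rw [Polygon.edgeIntegral, Polygon.edgeIntegral]
  congr 1
  refine intervalIntegral.integral_congr fun s hs => ?_
  rw [uIcc_of_le zero_le_one] at hs
  exact hgh s hs

/-- Two vectors with the same products with `s` can be chosen orthogonal to all that is orthogonal
to `s`. -/
theorem exists_inner_eq_of_inner_eq_zero {H : Type*} [NormedAddCommGroup H] [InnerProductSpace ℝ H]
    [CompleteSpace H] (s : Set H) (v₀ : H) : ∃ v : H,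
      (∀ w ∈ s, (inner ℝ v w : ℝ) = inner ℝ v₀ w) ∧
      ∀ y, (∀ w ∈ s, (inner ℝ w y : ℝ) = 0) → (inner ℝ v y : ℝ) = 0 := by
  set X : Submodule ℝ H := (Submodule.span ℝ s)ᗮ with hX
  refine ⟨v₀ - X.starProjection v₀, fun w hw => ?_, fun y hy => ?_⟩
  · have h := (Submodule.mem_orthogonal _ _).1 (X.starProjection_apply_mem v₀) w
      (Submodule.subset_span hw)
    rw [inner_sub_left, real_inner_comm w (X.starProjection v₀), h, sub_zero]
  · refine X.starProjection_inner_eq_zero v₀ y ?_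
    rw [hX, Submodule.mem_orthogonal]
    intro w hw
    induction hw using Submodule.span_induction with
    | mem w h => exact hy w h
    | zero => exact inner_zero_left _
    | add w w' _ _ h1 h2 => rw [inner_add_left, h1, h2, add_zero]
    | smul c w _ h => rw [inner_smul_left, h, mul_zero]

/-- A polynomial divergence and polynomial edge fluxes are attained by a square-integrable field as
soon as they are compatible. -/
theorem exists_flux_eq {k : ℕ} {K : Polygon} {d : L2 K.carrier} (hd : d ∈ polyL2 K.carrier k)
    (g : Fin (K.m + 3) → Polynomial ℝ)
    (hdg : ∫ x in K.carrier, d x = ∑ i, K.edgeIntegral i (fun s => (g i).eval s) fun _ => 1) :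
    ∃ v : L2v K.carrier, ∀ f, IsTest univ f →
      (inner ℝ v (toL2 K.carrier (gradient f)) : ℝ) + inner ℝ d (toL2 K.carrier f) =
        ∑ i, K.edgeIntegral i (fun s => (g i).eval s) f := by
  have hb := K.isBounded_carrier
  obtain ⟨D, hD, hdD⟩ := exists_polyFun_of_mem_polyL2 hd
  obtain ⟨F, hF, hFD⟩ := exists_antideriv_polyFun hD
  have hFc : ContDiff ℝ 1 F := (contDiff_of_mem_polyFun hF).of_le (by simp)
  have hFcc := hFc.continuous
  have hedge := K.continuous_edgePoint
  have hw : MemLp (fun x => (!₂[F x, 0] : E2)) 2 (volume.restrict K.carrier) := by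
    refine memLp_of_continuous hb ((PiLp.continuous_toLp 2 _).comp (continuous_pi fun i => ?_)) 2
    fin_cases i <;> simp <;> fun_prop
  have hwf : ∀ f, IsTest univ f →
      (inner ℝ (toL2 K.carrier fun x => (!₂[F x, 0] : E2)) (toL2 K.carrier (gradient f)) : ℝ) +
        inner ℝ d (toL2 K.carrier f) =
      ∑ i, K.edgeIntegral i (fun s => F (K.edgePoint i s) * K.normal i 0) f := fun f hf => by
    have := inner_div_toL2 (K := K) (v := (toL2 K.carrier fun x => (!₂[F x, 0] : E2), d))
      (P := ![F, fun _ => 0]) (fun l => by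
        fin_cases l
        exacts [hFc, contDiff_const]) ((coeFn_toL2 hw).trans
          (Filter.Eventually.of_forall fun x => by simp)) (by
          filter_upwards [hdD] with x hx
          simp only [Matrix.cons_val_zero, Matrix.cons_val_one]
          rw [hx, ← hFD]
          simp [gradient]) hf
    simpa using this
  set a : Fin (K.m + 3) → ℝ → ℝ := fun i s =>
    K.edgeLength i * ((g i).eval s + (-1) * (F (K.edgePoint i s) * K.normal i 0)) with ha
  have hgc : ∀ i, Continuous fun s => (g i).eval s := fun i => Polynomial.continuous _
  have hac : ∀ i, Continuous (a i) := fun i => by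
    have := hgc i; have := hedge i
    simp only [ha]; fun_prop
  have haf : ∀ i (f : E2 → ℝ), Continuous f → ∫ s in (0 : ℝ)..1, a i s * f (K.edgePoint i s) =
      K.edgeIntegral i (fun s => (g i).eval s) f -
        K.edgeIntegral i (fun s => F (K.edgePoint i s) * K.normal i 0) f := fun i f hf => by
    have e1 := K.edgeIntegral_add i (Polygon.memLp_edge (hgc i))
      (Polygon.memLp_edge (g := fun s => (-1) * (F (K.edgePoint i s) * K.normal i 0))
        (by have := hedge i; fun_prop)) hf
    rw [K.edgeIntegral_smul, Polygon.edgeIntegral, ← intervalIntegral.integral_const_mul] at e1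
    simp only [ha, mul_assoc]
    rw [e1]
    ring
  obtain ⟨χ, hχ, hχ1⟩ := exists_isTest_eq_one hb.closure
  have hsum : ∑ i, ∫ s in (0 : ℝ)..1, a i s = 0 := by
    have e0 : ∀ i, ∫ s in (0 : ℝ)..1, a i s = ∫ s in (0 : ℝ)..1, a i s * χ (K.edgePoint i s) :=
      fun i => intervalIntegral.integral_congr fun s hs => by
        rw [uIcc_of_le zero_le_one] at hs
        simp [(hχ1 _ (K.edgePoint_mem_closure i hs)).1]
    have e1 : ∀ i, K.edgeIntegral i (fun s => (g i).eval s) χ =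
        K.edgeIntegral i (fun s => (g i).eval s) fun _ => 1 := fun i =>
      edgeIntegral_congr i fun s hs => by rw [(hχ1 _ (K.edgePoint_mem_closure i hs)).1]
    simp only [e0, haf _ χ hχ.1.continuous, Finset.sum_sub_distrib, e1]
    rw [← hdg, ← hwf χ hχ, ← K.integral_inner_add_eq (_, d) hχ, sub_eq_zero]
    refine setIntegral_congr_fun K.isOpen_carrier.measurableSet fun x hx => ?_
    simp [hχ1 x (subset_closure hx)]
  obtain ⟨u, hu⟩ := K.exists_divFree_field hac hsum
  refine ⟨(toL2 K.carrier fun x => (!₂[F x, 0] : E2)) + u, fun f hf => ?_⟩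
  have h1 := hu f hf.contDiff_one
  simp only [haf _ f hf.1.continuous, Finset.sum_sub_distrib] at h1
  rw [← hwf f hf, integral_inner_eq _ (hf.memLp_gradient hb)] at h1
  rw [inner_add_left, h1]
  ring

/-- A polynomial divergence and polynomial edge fluxes are attained by an element of the local
velocity space as soon as they are compatible. -/
theorem exists_vhLoc {k : ℕ} {K : Polygon} {d : L2 K.carrier} (hd : d ∈ polyL2 K.carrier k)
    {g : Fin (K.m + 3) → Polynomial ℝ} (hg : ∀ i, (g i).natDegree ≤ k)
    (hdg : ∫ x in K.carrier, d x = ∑ i, K.edgeIntegral i (fun s => (g i).eval s) fun _ => 1) :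
    ∃ v, (v, d) ∈ VhLoc k K ∧ ∀ f, IsTest univ f →
      ∫ x in K.carrier, ((inner ℝ (v x) (gradient f x) : ℝ) + d x * f x) =
        ∑ i, K.edgeIntegral i (fun s => (g i).eval s) f := by
  obtain ⟨v₀, hv₀⟩ := exists_flux_eq hd g hdg
  obtain ⟨v, hv, hv'⟩ := exists_inner_eq_of_inner_eq_zero
    {w : L2v K.carrier | ∃ f, IsTest univ f ∧ w = toL2 K.carrier (gradient f)} v₀
  have hvf := (flux_iff (v, d) fun i s => (g i).eval s).2 fun f hf => by
    rw [← hv₀ f hf]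
    congr 1
    exact hv _ ⟨f, hf, rfl⟩
  refine ⟨v, ⟨hd, ⟨g, hg, hvf⟩, 0, Submodule.zero_mem _, (rot_iff _ _).2 fun f hf => ?_⟩, hvf⟩
  rw [inner_zero_left]
  refine hv' _ ?_
  rintro _ ⟨h, hh, rfl⟩
  exact inner_curl_gradient hf hh

/-! ### The mesh and the global spaces -/

theorem IsConvexPolygonalDomain.isOpen {Ω : Set E2} (h : IsConvexPolygonalDomain Ω) : IsOpen Ω := by
  obtain ⟨-, s, rfl⟩ := h; exact isOpen_interior

theorem IsConvexPolygonalDomain.convex {Ω : Set E2} (h : IsConvexPolygonalDomain Ω) :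
    Convex ℝ Ω := by
  obtain ⟨-, s, rfl⟩ := h; exact (convex_convexHull ℝ _).interior

theorem IsConvexPolygonalDomain.isBounded {Ω : Set E2} (h : IsConvexPolygonalDomain Ω) :
    Bornology.IsBounded Ω := by
  obtain ⟨-, s, rfl⟩ := h
  exact (isBounded_convexHull.2 s.finite_toSet.isBounded).subset interior_subset

theorem restrictL2_ae_eq {F : Type} [NormedAddCommGroup F] {S T : Set E2} (h : S ⊆ T)
    (f : Lp F 2 (volume.restrict T)) : restrictL2 h f =ᵐ[volume.restrict S] f :=
  MemLp.coeFn_toLp _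

theorem ae_restrict_of_ae_eq {F : Type} {S T : Set E2} (h : S ⊆ T) {f g : E2 → F}
    (hf : f =ᵐ[volume.restrict T] g) : f =ᵐ[volume.restrict S] g :=
  hf.filter_mono (ae_mono (Measure.restrict_mono_set _ h))

theorem restrictL2_add {F : Type} [NormedAddCommGroup F] {S T : Set E2} (h : S ⊆ T)
    (f g : Lp F 2 (volume.restrict T)) :
    restrictL2 h (f + g) = restrictL2 h f + restrictL2 h g := by
  refine Lp.ext ((restrictL2_ae_eq h _).trans ?_)
  filter_upwards [ae_restrict_of_ae_eq h (Lp.coeFn_add f g), Lp.coeFn_add (restrictL2 h f)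
    (restrictL2 h g), restrictL2_ae_eq h f, restrictL2_ae_eq h g] with x h1 h2 h3 h4
  rw [h1, h2, Pi.add_apply, Pi.add_apply, h3, h4]

theorem restrictL2_smul {F : Type} [NormedAddCommGroup F] [NormedSpace ℝ F] {S T : Set E2}
    (h : S ⊆ T) (a : ℝ) (f : Lp F 2 (volume.restrict T)) :
    restrictL2 h (a • f) = a • restrictL2 h f := by
  refine Lp.ext ((restrictL2_ae_eq h _).trans ?_)
  filter_upwards [ae_restrict_of_ae_eq h (Lp.coeFn_smul a f), Lp.coeFn_smul a (restrictL2 h f),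
    restrictL2_ae_eq h f] with x h1 h2 h3
  rw [h1, h2, Pi.smul_apply, Pi.smul_apply, h3]

variable {Ω : Set E2}

namespace Mesh

variable (M : Mesh Ω)

/-- Restriction to an element as a linear map. -/
def resL (K : Fin M.card) : L2 Ω →ₗ[ℝ] L2 (M.elem K).carrier where
  toFun := M.res K
  map_add' := restrictL2_add _
  map_smul' := restrictL2_smul _

/-- Restriction of vector fields to an element as a linear map. -/
def resvL (K : Fin M.card) : L2v Ω →ₗ[ℝ] L2v (M.elem K).carrier where
  toFun := M.resv K
  map_add' := restrictL2_add _
  map_smul' := restrictL2_smul _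

theorem ae_eq_iUnion : Ω =ᵐ[volume] ⋃ K, (M.elem K).carrier := by
  refine Filter.EventuallyLE.antisymm ?_ (LE.le.eventuallyLE (iUnion_subset M.subset))
  rw [ae_le_set]
  refine measure_mono_null (t := ⋃ K, frontier (M.elem K).carrier) ?_
    (measure_iUnion_null fun K => (M.elem K).volume_frontier)
  rintro x ⟨hx, hx'⟩
  obtain ⟨K, hK⟩ := mem_iUnion.1 (M.cover hx)
  refine mem_iUnion.2 ⟨K, ?_⟩
  rw [(M.elem K).isOpen_carrier.frontier_eq]
  exact ⟨hK, fun h => hx' (mem_iUnion.2 ⟨K, h⟩)⟩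

theorem ae_restrict_of_forall {p : E2 → Prop}
    (h : ∀ K, ∀ᵐ x ∂(volume.restrict (M.elem K).carrier), p x) : ∀ᵐ x ∂(volume.restrict Ω), p x := by
  rw [Measure.restrict_congr_set M.ae_eq_iUnion]
  exact (ae_restrict_iUnion_iff _ _).2 h

theorem setIntegral_eq_sum {F : Type*} [NormedAddCommGroup F] [NormedSpace ℝ F] {f : E2 → F}
    (hf : IntegrableOn f Ω) : ∫ x in Ω, f x = ∑ K, ∫ x in (M.elem K).carrier, f x := by
  rw [setIntegral_congr_set M.ae_eq_iUnion, integral_iUnion_fintype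
    (fun K => (M.elem K).isOpen_carrier.measurableSet) (fun K L h => M.disjoint K L h)
    fun K => hf.mono_set (M.subset K)]

theorem res_ae_eq (K : Fin M.card) (f : L2 Ω) :
    M.res K f =ᵐ[volume.restrict (M.elem K).carrier] f := restrictL2_ae_eq _ f

theorem resv_ae_eq (K : Fin M.card) (f : L2v Ω) :
    M.resv K f =ᵐ[volume.restrict (M.elem K).carrier] f := restrictL2_ae_eq _ f

theorem eq_zero_of_restrictL2 {F : Type} [NormedAddCommGroup F] {f : Lp F 2 (volume.restrict Ω)}
    (h : ∀ K, restrictL2 (M.subset K) f = 0) : f = 0 := by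
  refine Lp.ext (Filter.EventuallyEq.trans ?_ (Lp.coeFn_zero _ _ _).symm)
  refine M.ae_restrict_of_forall fun K => ?_
  have h1 := restrictL2_ae_eq (M.subset K) f
  rw [h K] at h1
  exact h1.symm.trans (Lp.coeFn_zero _ _ _)

/-- Functions on the elements are the restrictions of a function on the domain. -/
theorem exists_restrictL2_eq {F : Type} [NormedAddCommGroup F]
    (f : ∀ K, Lp F 2 (volume.restrict (M.elem K).carrier)) :
    ∃ g : Lp F 2 (volume.restrict Ω), ∀ K, restrictL2 (M.subset K) g = f K := by
  set G : E2 → F := fun x => ∑ K, (M.elem K).carrier.indicator (f K) x with hG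
  have hm : ∀ K, MeasurableSet (M.elem K).carrier := fun K => (M.elem K).isOpen_carrier.measurableSet
  have hmem : MemLp G 2 (volume.restrict Ω) := memLp_finsetSum _ fun K _ =>
    ((memLp_indicator_iff_restrict (hm K)).2 (Lp.memLp (f K))).restrict _
  refine ⟨hmem.toLp G, fun K => Lp.ext ((restrictL2_ae_eq _ _).trans
    ((ae_restrict_of_ae_eq (M.subset K) hmem.coeFn_toLp).trans ?_))⟩
  filter_upwards [ae_restrict_mem (hm K)] with x hx
  simp only [hG]
  rw [Finset.sum_eq_single K, indicator_of_mem hx]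
  · intro L _ hL
    exact indicator_of_notMem (Set.disjoint_right.1 (M.disjoint L K hL) hx) _
  · simp

end Mesh

/-- `V_h` as a vector space. -/
def vh (k : ℕ) (M : Mesh Ω) (hb : Bornology.IsBounded Ω) : Submodule ℝ (L2v Ω × L2 Ω) where
  carrier := Vh k M
  zero_mem' := by
    refine ⟨fun f hf => ?_, fun K => ?_⟩
    · rw [integral_inner_add_eq hb 0 hf]; simp
    · have : (M.resvL K 0, M.resL K 0) ∈ vhLoc k (M.elem K) := by
        rw [map_zero, map_zero]; exact Submodule.zero_mem _
      exact this
  add_mem' := by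
    intro v w hv hw
    refine ⟨fun f hf => ?_, fun K => ?_⟩
    · have h1 := hv.1 f hf
      have h2 := hw.1 f hf
      rw [integral_inner_add_eq hb _ hf] at h1 h2 ⊢
      rw [Prod.fst_add, Prod.snd_add, inner_add_left, inner_add_left]
      linarith
    · have : (M.resvL K (v + w).1, M.resL K (v + w).2) ∈ vhLoc k (M.elem K) := by
        rw [Prod.fst_add, Prod.snd_add, map_add, map_add]
        exact (vhLoc k (M.elem K)).add_mem (hv.2 K) (hw.2 K)
      exact this
  smul_mem' := by
    intro a v hv
    refine ⟨fun f hf => ?_, fun K => ?_⟩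
    · have h1 := hv.1 f hf
      rw [integral_inner_add_eq hb _ hf] at h1 ⊢
      rw [Prod.smul_fst, Prod.smul_snd, inner_smul_left, inner_smul_left, ← mul_add, h1, mul_zero]
    · have : (M.resvL K (a • v).1, M.resL K (a • v).2) ∈ vhLoc k (M.elem K) := by
        rw [Prod.smul_fst, Prod.smul_snd, map_smul, map_smul]
        exact (vhLoc k (M.elem K)).smul_mem a (hv.2 K)
      exact this

/-- `Q_h` as a vector space. -/
def qh (k : ℕ) (M : Mesh Ω) (hb : Bornology.IsBounded Ω) : Submodule ℝ (L2 Ω) where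
  carrier := Qh k M
  zero_mem' := by
    refine ⟨?_, fun K => ?_⟩
    · exact integral_eq_zero_of_ae (Lp.coeFn_zero _ _ _)
    · have : M.resL K 0 ∈ polyL2 (M.elem K).carrier k := by
        rw [map_zero]; exact Submodule.zero_mem _
      exact this
  add_mem' := by
    intro p q hp hq
    have hfin : IsFiniteMeasure (volume.restrict Ω) :=
      ⟨by rw [Measure.restrict_apply_univ]; exact hb.measure_lt_top⟩
    refine ⟨?_, fun K => ?_⟩
    · have hp1 : ∫ x in Ω, p x = 0 := hp.1
      have hq1 : ∫ x in Ω, q x = 0 := hq.1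
      change ∫ x in Ω, (p + q) x = 0
      rw [integral_congr_ae (Lp.coeFn_add p q), integral_add' ((Lp.memLp p).integrable (by norm_num))
        ((Lp.memLp q).integrable (by norm_num)), hp1, hq1, add_zero]
    · have : M.resL K (p + q) ∈ polyL2 (M.elem K).carrier k := by
        rw [map_add]; exact Submodule.add_mem _ (hp.2 K) (hq.2 K)
      exact this
  smul_mem' := by
    intro a p hp
    refine ⟨?_, fun K => ?_⟩
    · have hp1 : ∫ x in Ω, p x = 0 := hp.1
      change ∫ x in Ω, (a • p) x = 0
      rw [integral_congr_ae (Lp.coeFn_smul a p)]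
      simp only [Pi.smul_apply, integral_smul, hp1, smul_zero]
    · have : M.resL K (a • p) ∈ polyL2 (M.elem K).carrier k := by
        rw [map_smul]; exact Submodule.smul_mem _ a (hp.2 K)
      exact this

theorem integral_H1_apply (hb : Bornology.IsBounded Ω) (z : L2 Ω × L2v Ω) {f : E2 → ℝ}
    (hf : IsTest Ω f) :
    (∫ x in Ω, z.1 x • gradient f x = -∫ x in Ω, f x • z.2 x) ↔
      ∀ j, (inner ℝ z.1 (toL2 Ω fun x => gradient f x j) : ℝ) =
        -inner ℝ z.2 (toL2 Ω fun x => f x • (EuclideanSpace.single j 1 : E2)) := by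
  have h1 : ∀ j, (∫ x in Ω, z.1 x • gradient f x) j = inner ℝ z.1 (toL2 Ω fun x => gradient f x j) :=
    fun j => by
      rw [E2.integral_apply (integrable_smul_of_memLp (Lp.memLp _) (hf.memLp_gradient hb)),
        ← integral_mul_eq _ (hf.memLp_gradient_apply hb j)]
      rfl
  have h2 : ∀ j, (-∫ x in Ω, f x • z.2 x) j =
      -inner ℝ z.2 (toL2 Ω fun x => f x • (EuclideanSpace.single j 1 : E2)) := fun j => by
    rw [PiLp.neg_apply, E2.integral_apply (integrable_smul_of_memLp (hf.memLp hb) (Lp.memLp _)),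
      ← integral_inner_eq _ (hf.memLp_single hb j)]
    congr 1
    refine integral_congr_ae (Filter.Eventually.of_forall fun x => ?_)
    simp [inner_smul_right, EuclideanSpace.inner_single_right]
  constructor
  · intro h j
    rw [← h1, h, h2]
  · intro h
    refine E2.ext ?_ ?_ <;> rw [h1, h, h2]

theorem H1_add (hb : Bornology.IsBounded Ω) {v w : L2 Ω × L2v Ω} (hv : v ∈ H1 Ω) (hw : w ∈ H1 Ω) :
    v + w ∈ H1 Ω := fun f hf => by
  have h1 := (integral_H1_apply hb v hf).1 (hv f hf)
  have h2 := (integral_H1_apply hb w hf).1 (hw f hf)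
  refine (integral_H1_apply hb _ hf).2 fun j => ?_
  rw [Prod.fst_add, Prod.snd_add, inner_add_left, inner_add_left, h1 j, h2 j]
  ring

theorem H1_smul (hb : Bornology.IsBounded Ω) (a : ℝ) {v : L2 Ω × L2v Ω} (hv : v ∈ H1 Ω) :
    a • v ∈ H1 Ω := fun f hf => by
  have h1 := (integral_H1_apply hb v hf).1 (hv f hf)
  refine (integral_H1_apply hb _ hf).2 fun j => ?_
  rw [Prod.smul_fst, Prod.smul_snd, inner_smul_left, inner_smul_left, h1 j, mul_neg]

theorem H1_zero (hb : Bornology.IsBounded Ω) : (0 : L2 Ω × L2v Ω) ∈ H1 Ω := fun f hf => by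
  refine (integral_H1_apply hb _ hf).2 fun j => ?_
  rw [Prod.fst_zero, Prod.snd_zero, inner_zero_left, inner_zero_left, neg_zero]

/-- `Z_h` as a vector space. -/
def zh (k : ℕ) (M : Mesh Ω) (hb : Bornology.IsBounded Ω) : Submodule ℝ (L2 Ω × L2v Ω) where
  carrier := Zh k M
  zero_mem' := ⟨H1_zero hb, fun K => by
    have : (M.resL K 0, M.resvL K 0) ∈ zhLoc k (M.elem K) := by
      rw [map_zero, map_zero]; exact (zhLoc k (M.elem K)).zero_mem
    exact this⟩
  add_mem' := fun {v w} hv hw => ⟨H1_add hb hv.1 hw.1, fun K => by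
    have h := (zhLoc k (M.elem K)).add_mem (x := (M.resL K v.1, M.resvL K v.2))
      (y := (M.resL K w.1, M.resvL K w.2)) (hv.2 K) (hw.2 K)
    rw [Prod.mk_add_mk, ← map_add, ← map_add] at h
    exact h⟩
  smul_mem' := fun a v hv => ⟨H1_smul hb a hv.1, fun K => by
    have h := (zhLoc k (M.elem K)).smul_mem (x := (M.resL K v.1, M.resvL K v.2)) a (hv.2 K)
    rw [Prod.smul_mk, ← map_smul, ← map_smul] at h
    exact h⟩

instance finiteDimensional_vh (k : ℕ) (M : Mesh Ω) (hb : Bornology.IsBounded Ω) :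
    FiniteDimensional ℝ (vh k M hb) := by
  set T : vh k M hb →ₗ[ℝ] ∀ K, vhLoc k (M.elem K) := LinearMap.pi fun K =>
    (((M.resvL K).prodMap (M.resL K)).comp (vh k M hb).subtype).codRestrict (vhLoc k (M.elem K))
      fun v => v.2.2 K with hT
  refine FiniteDimensional.of_injective T ?_
  rw [← LinearMap.ker_eq_bot, LinearMap.ker_eq_bot']
  intro v hv
  have h : ∀ K, M.resv K v.1.1 = 0 ∧ M.res K v.1.2 = 0 := fun K =>
    Prod.ext_iff.1 (congrArg Subtype.val (congrFun hv K))
  exact Subtype.ext (Prod.ext (M.eq_zero_of_restrictL2 fun K => (h K).1)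
    (M.eq_zero_of_restrictL2 fun K => (h K).2))

instance finiteDimensional_zh (k : ℕ) (M : Mesh Ω) (hb : Bornology.IsBounded Ω) :
    FiniteDimensional ℝ (zh k M hb) := by
  set T : zh k M hb →ₗ[ℝ] ∀ K, zhLoc k (M.elem K) := LinearMap.pi fun K =>
    (((M.resL K).prodMap (M.resvL K)).comp (zh k M hb).subtype).codRestrict (zhLoc k (M.elem K))
      fun v => v.2.2 K with hT
  refine FiniteDimensional.of_injective T ?_
  rw [← LinearMap.ker_eq_bot, LinearMap.ker_eq_bot']
  intro v hv
  have h : ∀ K, M.res K v.1.1 = 0 ∧ M.resv K v.1.2 = 0 := fun K =>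
    Prod.ext_iff.1 (congrArg Subtype.val (congrFun hv K))
  exact Subtype.ext (Prod.ext (M.eq_zero_of_restrictL2 fun K => (h K).1)
    (M.eq_zero_of_restrictL2 fun K => (h K).2))

instance finiteDimensional_qh (k : ℕ) (M : Mesh Ω) (hb : Bornology.IsBounded Ω) :
    FiniteDimensional ℝ (qh k M hb) := by
  set T : qh k M hb →ₗ[ℝ] ∀ K, polyL2 (M.elem K).carrier k := LinearMap.pi fun K =>
    ((M.resL K).comp (qh k M hb).subtype).codRestrict (polyL2 (M.elem K).carrier k)
      fun v => v.2.2 K with hT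
  refine FiniteDimensional.of_injective T ?_
  rw [← LinearMap.ker_eq_bot, LinearMap.ker_eq_bot']
  intro v hv
  have h : ∀ K, M.res K v.1 = 0 := fun K => congrArg Subtype.val (congrFun hv K)
  exact Subtype.ext (M.eq_zero_of_restrictL2 h)

end MiscibleVEM

end


noncomputable section

namespace MiscibleVEM

/-! ### Adjacent elements -/

/-- Two polygons that run through the same edge in the same direction overlap. -/
theorem Polygon.not_disjoint_of_edge_eq {K L : Polygon} {i : Fin (K.m + 3)} {j : Fin (L.m + 3)}
    (h0 : K.vertex i = L.vertex j) (h1 : K.vertex (i + 1) = L.vertex (j + 1)) :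
    ¬Disjoint K.carrier L.carrier := by
  have J1 := K.coneArea_pos i
  have J2 := L.coneArea_pos j
  rw [Polygon.coneArea] at J1 J2
  rw [← h0, ← h1] at J2
  set a := K.vertex i with ha
  set b := K.vertex (i + 1) with hb
  set c := K.center with hc
  set d := L.center with hd
  set p : E2 := (1 / 2 : ℝ) • (a + b) with hp
  set J := cross (a - c) (b - c) with hJ
  set μ := cross (a - d) (b - d) / J with hμ
  set l := cross (d - p) (c - p) / J with hl
  have hμ0 : 0 < μ := div_pos J2 J1
  have hdp : d - p = l • (b - a) + μ • (c - p) := by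
    refine E2.ext ?_ ?_ <;>
    · simp only [PiLp.sub_apply, PiLp.add_apply, PiLp.smul_apply, smul_eq_mul, hl, hμ]
      rw [div_mul_eq_mul_div, div_mul_eq_mul_div, ← add_div, eq_div_iff J1.ne', hJ]
      simp only [cross, hp, PiLp.sub_apply, PiLp.add_apply, PiLp.smul_apply, smul_eq_mul]
      ring
  set e := (2 * (μ + |l|) + 2)⁻¹ with he
  have hden : 0 < 2 * (μ + |l|) + 2 := by positivity
  have he0 : 0 < e := inv_pos.2 hden
  have he1 : e * (2 * (μ + |l|) + 2) = 1 := inv_mul_cancel₀ hden.ne'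
  have heμ : 0 < e * μ := mul_pos he0 hμ0
  have hel : 0 ≤ e * |l| := by positivity
  have hr : 0 < 1 - e * μ := by nlinarith
  have hs : 1 / 2 + e * l / (1 - e * μ) ∈ Icc (0 : ℝ) 1 := by
    have h3 : |e * l / (1 - e * μ)| ≤ 1 / 2 := by
      rw [abs_div, abs_mul, abs_of_pos he0, abs_of_pos hr, div_le_iff₀ hr]
      nlinarith
    rw [abs_le] at h3
    constructor <;> linarith
  refine Set.not_disjoint_iff.2 ⟨p + e • (d - p), ?_, ?_⟩
  · have h := K.ray_mem (frontier_subset_closure (K.edgePoint_mem_frontier i hs)) hr.le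
      (by linarith)
    convert h using 1
    rw [hdp, Polygon.edgePoint, ← ha, ← hb, ← hc]
    refine E2.ext ?_ ?_ <;>
    · simp only [PiLp.sub_apply, PiLp.add_apply, PiLp.smul_apply, smul_eq_mul, hp]
      field_simp
      ring
  · have h := L.ray_mem (r := 1 - e) (frontier_subset_closure (L.edgePoint_mem_frontier j
      (s := 1 / 2) (by norm_num))) (by nlinarith) (by linarith)
    convert h using 1
    rw [Polygon.edgePoint, ← h0, ← h1, ← hd]
    refine E2.ext ?_ ?_ <;>
    · simp only [PiLp.sub_apply, PiLp.add_apply, PiLp.smul_apply, smul_eq_mul, hp]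
      ring

variable {Ω : Set E2}

/-- The edges `(K, i)` and `(L, j)` of different elements coincide. -/
def Mesh.Matches (M : Mesh Ω) (e f : Σ K, Fin ((M.elem K).m + 3)) : Prop :=
  f.1 ≠ e.1 ∧ (M.elem f.1).vertex f.2 = (M.elem e.1).vertex (e.2 + 1) ∧
    (M.elem f.1).vertex (f.2 + 1) = (M.elem e.1).vertex e.2

namespace Mesh.Matches

variable {M : Mesh Ω} {e f g : Σ K, Fin ((M.elem K).m + 3)}

theorem symm (h : M.Matches e f) : M.Matches f e := ⟨h.1.symm, h.2.2.symm, h.2.1.symm⟩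

theorem unique (hf : M.Matches e f) (hg : M.Matches e g) : f = g := by
  obtain ⟨K, i⟩ := f
  obtain ⟨L, j⟩ := g
  have h0 := hf.2.1.trans hg.2.1.symm
  have h1 := hf.2.2.trans hg.2.2.symm
  by_cases h : K = L
  · subst h
    exact congrArg _ ((M.elem K).vertex_injective h0)
  · exact absurd (M.disjoint K L h) (Polygon.not_disjoint_of_edge_eq h0 h1)

theorem edgeLength_eq (h : M.Matches e f) :
    (M.elem f.1).edgeLength f.2 = (M.elem e.1).edgeLength e.2 := by
  rw [Polygon.edgeLength, Polygon.edgeLength, h.2.1, h.2.2, dist_comm]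

theorem edgeIntegral_eq (h : M.Matches e f) (φ : E2 → ℝ) :
    (M.elem f.1).edgeIntegral f.2 (fun _ => 1) φ = (M.elem e.1).edgeIntegral e.2 (fun _ => 1) φ := by
  rw [Polygon.edgeIntegral, Polygon.edgeIntegral, h.edgeLength_eq]
  congr 1
  simp only [one_mul]
  have := intervalIntegral.integral_comp_sub_left (a := 0) (b := 1)
    (fun s => φ ((M.elem e.1).edgePoint e.2 s)) 1
  rw [sub_zero, sub_self] at this
  rw [← this]
  refine intervalIntegral.integral_congr fun s _ => ?_
  simp only [Polygon.edgePoint, h.2.1, h.2.2]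
  congr 1
  module

theorem normal_eq (h : M.Matches e f) :
    (M.elem f.1).normal f.2 = -(M.elem e.1).normal e.2 := by
  rw [Polygon.normal, Polygon.normal, h.edgeLength_eq, h.2.1, h.2.2, ← smul_neg]
  congr 1
  refine E2.ext ?_ ?_ <;> simp

end Mesh.Matches

theorem Mesh.exists_matches (M : Mesh Ω) (e : Σ K, Fin ((M.elem K).m + 3)) :
    segment ℝ ((M.elem e.1).vertex e.2) ((M.elem e.1).vertex (e.2 + 1)) ⊆ frontier Ω ∨
      ∃ f, M.Matches e f := by
  rcases M.conforming e.1 e.2 with h | ⟨L, hL, j, h⟩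
  · exact Or.inl h
  · exact Or.inr ⟨⟨L, j⟩, hL, h⟩

/-! ### Discrete velocities with constant edge fluxes -/

/-- The restriction of the integral of a product to the elements. -/
theorem Mesh.integral_mul_eq_sum (M : Mesh Ω) (p q : L2 Ω) :
    ∫ x in Ω, p x * q x = ∑ K, (inner ℝ (M.res K p) (M.res K q) : ℝ) := by
  rw [M.setIntegral_eq_sum (integrable_mul_of_memLp (Lp.memLp p) (Lp.memLp q))]
  refine Finset.sum_congr rfl fun K _ => ?_
  rw [L2.inner_def]
  refine integral_congr_ae ?_
  filter_upwards [M.res_ae_eq K p, M.res_ae_eq K q] with x h1 h2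
  rw [h1, h2]
  simp [mul_comm]

theorem exists_mem_Vh {k : ℕ} (M : Mesh Ω) (hb : Bornology.IsBounded Ω)
    {d : ∀ K, L2 (M.elem K).carrier} (hd : ∀ K, d K ∈ polyL2 (M.elem K).carrier k)
    {c : (Σ K, Fin ((M.elem K).m + 3)) → ℝ}
    (hdc : ∀ K, ∫ x in (M.elem K).carrier, d K x =
      ∑ i, c ⟨K, i⟩ * (M.elem K).edgeLength i)
    (hc : ∀ f, IsTest univ f →
      ∑ e : Σ K, Fin ((M.elem K).m + 3), c e * (M.elem e.1).edgeIntegral e.2 (fun _ => 1) f = 0) :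
    ∃ w ∈ Vh k M, ∀ q, B w q = -∑ K, (inner ℝ (d K) (M.res K q) : ℝ) := by
  have hconst : ∀ e : Σ K, Fin ((M.elem K).m + 3), ∀ f : E2 → ℝ,
      (M.elem e.1).edgeIntegral e.2 (fun s => (Polynomial.C (c e)).eval s) f =
        c e * (M.elem e.1).edgeIntegral e.2 (fun _ => 1) f := fun e f => by
    rw [← Polygon.edgeIntegral_smul]
    simp
  have h : ∀ K, ∃ v, (v, d K) ∈ VhLoc k (M.elem K) ∧ ∀ f, IsTest univ f →
      ∫ x in (M.elem K).carrier, ((inner ℝ (v x) (gradient f x) : ℝ) + d K x * f x) =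
        ∑ i, c ⟨K, i⟩ * (M.elem K).edgeIntegral i (fun _ => 1) f := fun K => by
    obtain ⟨v, hv, hv'⟩ := exists_vhLoc (hd K) (g := fun i => Polynomial.C (c ⟨K, i⟩))
      (fun i => by simp) (by
        rw [hdc K]
        refine Finset.sum_congr rfl fun i _ => ?_
        rw [hconst ⟨K, i⟩, Polygon.edgeIntegral]
        simp)
    refine ⟨v, hv, fun f hf => (hv' f hf).trans (Finset.sum_congr rfl fun i _ => ?_)⟩
    exact hconst ⟨K, i⟩ f
  choose v hv hv' using h
  obtain ⟨w1, hw1⟩ := M.exists_restrictL2_eq v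
  obtain ⟨w2, hw2⟩ := M.exists_restrictL2_eq d
  have h1 : ∀ K, M.resv K w1 = v K := hw1
  have h2 : ∀ K, M.res K w2 = d K := hw2
  refine ⟨(w1, w2), ⟨fun f hf => ?_, fun K => ?_⟩, fun q => ?_⟩
  · have hint : IntegrableOn (fun x => (inner ℝ (w1 x) (gradient f x) : ℝ) + w2 x * f x) Ω :=
      (integrable_inner_of_memLp (Lp.memLp w1) (hf.memLp_gradient hb)).add
        (integrable_mul_of_memLp (Lp.memLp w2) (hf.memLp hb))
    rw [M.setIntegral_eq_sum hint, ← hc f hf, Fintype.sum_sigma]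
    refine Finset.sum_congr rfl fun K _ => ?_
    rw [← hv' K f hf]
    refine integral_congr_ae ?_
    filter_upwards [M.resv_ae_eq K w1, M.res_ae_eq K w2] with x e1 e2
    rw [← e1, ← e2, h1, h2]
  · change (M.resv K w1, M.res K w2) ∈ _
    rw [h1, h2]
    exact hv K
  · rw [B, M.integral_mul_eq_sum]
    simp only [h2]

/-! ### Pressures orthogonal to all divergences -/

theorem toL2_const_mem_polyL2 {S : Set E2} (hS : Bornology.IsBounded S) {m : ℤ} (hm : 0 ≤ m)
    (a : ℝ) : toL2 S (fun _ => a) ∈ polyL2 S m :=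
  mem_polyL2_of_ae_eq hS (const_mem_polyFun hm a)
    (coeFn_toL2 (memLp_of_continuous hS continuous_const 2))

theorem Polygon.integral_toL2_const (K : Polygon) (a : ℝ) :
    ∫ x in K.carrier, toL2 K.carrier (fun _ => a) x = a * volume.real K.carrier := by
  rw [integral_congr_ae (coeFn_toL2 (memLp_of_continuous K.isBounded_carrier continuous_const 2))]
  simp [mul_comm]

theorem Polygon.inner_toL2_const (K : Polygon) (u : L2 K.carrier) (a : ℝ) :
    (inner ℝ u (toL2 K.carrier fun _ => a) : ℝ) = a * ∫ x in K.carrier, u x := by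
  rw [← integral_mul_eq u (memLp_of_continuous K.isBounded_carrier continuous_const 2),
    integral_mul_const, mul_comm]

theorem Polygon.volume_real_pos (K : Polygon) : 0 < volume.real K.carrier :=
  ENNReal.toReal_pos K.volume_carrier_pos.ne' K.volume_carrier_lt_top.ne

/-- A discrete pressure that is orthogonal to all divergences of discrete velocities is elementwise
constant. -/
theorem exists_const_of_B_eq_zero {k : ℕ} (M : Mesh Ω) (hb : Bornology.IsBounded Ω) {q : L2 Ω}
    (hq : ∀ K, M.res K q ∈ polyL2 (M.elem K).carrier k) (hB : ∀ v ∈ Vh k M, B v q = 0)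
    (K : Fin M.card) : ∃ a : ℝ, M.res K q = toL2 (M.elem K).carrier fun _ => a := by
  classical
  set S := (M.elem K).carrier with hS
  set a : ℝ := (volume.real S)⁻¹ * ∫ x in S, M.res K q x with ha
  have hV := (M.elem K).volume_real_pos
  refine ⟨a, ?_⟩
  set d₀ : L2 S := M.res K q - toL2 S fun _ => a with hd₀
  have hint : ∫ x in S, d₀ x = 0 := by
    rw [hd₀, integral_congr_ae (Lp.coeFn_sub _ _)]
    simp only [Pi.sub_apply]
    rw [integral_sub ((Lp.memLp _).integrable (by norm_num)) ((Lp.memLp _).integrable (by norm_num)),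
      Polygon.integral_toL2_const, ha, mul_right_comm, inv_mul_cancel₀ hV.ne', one_mul, sub_self]
  obtain ⟨w, hw, hwB⟩ := exists_mem_Vh (k := k) M hb
    (d := Function.update (fun L => (0 : L2 (M.elem L).carrier)) K d₀) (c := fun _ => 0)
    (fun L => by
      by_cases h : L = K
      · subst h
        rw [Function.update_self]
        exact Submodule.sub_mem _ (hq L)
          (toL2_const_mem_polyL2 (M.elem L).isBounded_carrier (by positivity) a)
      · rw [Function.update_of_ne h]
        exact Submodule.zero_mem _)
    (fun L => by
      by_cases h : L = K
      · subst h
        rw [Function.update_self, hint]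
        simp
      · rw [Function.update_of_ne h, integral_eq_zero_of_ae (Lp.coeFn_zero _ _ _)]
        simp) (fun f _ => by simp)
  have h := hwB q
  rw [hB w hw, Finset.sum_eq_single K (fun L _ hL => by
    rw [Function.update_of_ne hL, inner_zero_left]) (by simp), Function.update_self, eq_comm,
    neg_eq_zero] at h
  have h2 : (inner ℝ d₀ d₀ : ℝ) = 0 := by
    nth_rewrite 2 [hd₀]
    rw [inner_sub_right, h, Polygon.inner_toL2_const, hint]
    simp
  exact sub_eq_zero.1 (inner_self_eq_zero.1 h2)

/-- The constants on both sides of a common edge agree. -/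
theorem const_eq_of_matches {k : ℕ} {M : Mesh Ω} (hb : Bornology.IsBounded Ω) {q : L2 Ω}
    (hB : ∀ v ∈ Vh k M, B v q = 0) {a : Fin M.card → ℝ}
    (ha : ∀ K, M.res K q = toL2 (M.elem K).carrier fun _ => a K)
    {e f : Σ K, Fin ((M.elem K).m + 3)} (hef : M.Matches e f) : a e.1 = a f.1 := by
  classical
  set l := (M.elem e.1).edgeLength e.2 with hl
  have hl0 : 0 < l := (M.elem e.1).edgeLength_pos e.2
  have hV := fun K => (M.elem K).volume_real_pos
  set t : Fin M.card → ℝ := fun K => ((Pi.single e.1 l : Fin M.card → ℝ) K -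
    (Pi.single f.1 l : Fin M.card → ℝ) K) * (volume.real (M.elem K).carrier)⁻¹ with ht
  have htV : ∀ K, t K * volume.real (M.elem K).carrier = (Pi.single e.1 l : Fin M.card → ℝ) K -
    (Pi.single f.1 l : Fin M.card → ℝ) K := fun K => by
      rw [ht]; exact inv_mul_cancel_right₀ (hV K).ne' _
  have hsingle : ∀ (g : Σ K, Fin ((M.elem K).m + 3)) (K : Fin M.card),
      ∑ i, (Pi.single g 1 : (Σ K, Fin ((M.elem K).m + 3)) → ℝ) ⟨K, i⟩ * (M.elem K).edgeLength i =
        (Pi.single g.1 ((M.elem g.1).edgeLength g.2) : Fin M.card → ℝ) K := by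
    rintro ⟨L, j⟩ K
    by_cases h : K = L
    · subst h
      rw [Finset.sum_eq_single j]
      · simp
      · intro i _ hi
        rw [Pi.single_eq_of_ne (fun h => hi (by simpa using h)), zero_mul]
      · simp
    · rw [Pi.single_eq_of_ne h]
      refine Finset.sum_eq_zero fun i _ => ?_
      rw [Pi.single_eq_of_ne (fun h' => h (congrArg Sigma.fst h')), zero_mul]
  obtain ⟨w, hw, hwB⟩ := exists_mem_Vh (k := k) M hb
    (d := fun K => toL2 (M.elem K).carrier fun _ => t K)
    (c := fun g => (Pi.single e 1 : (Σ K, Fin ((M.elem K).m + 3)) → ℝ) g -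
      (Pi.single f 1 : (Σ K, Fin ((M.elem K).m + 3)) → ℝ) g)
    (fun K => toL2_const_mem_polyL2 (M.elem K).isBounded_carrier (by positivity) _)
    (fun K => by
      simp only [sub_mul, Finset.sum_sub_distrib, hsingle]
      rw [Polygon.integral_toL2_const, htV, hef.edgeLength_eq])
    (fun φ _ => by
      simp only [sub_mul, Finset.sum_sub_distrib, Pi.single_apply, ite_mul, one_mul, zero_mul,
        Finset.sum_ite_eq', Finset.mem_univ, if_true]
      rw [hef.edgeIntegral_eq, sub_self])
  have h := hwB q
  rw [hB w hw] at h
  have h2 : ∀ K, (inner ℝ (toL2 (M.elem K).carrier fun _ => t K) (M.res K q) : ℝ) =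
      ((Pi.single e.1 l : Fin M.card → ℝ) K - (Pi.single f.1 l : Fin M.card → ℝ) K) * a K :=
    fun K => by
      rw [ha K, Polygon.inner_toL2_const, Polygon.integral_toL2_const, htV, mul_comm]
  simp only [h2, sub_mul, Finset.sum_sub_distrib, Pi.single_apply, ite_mul, zero_mul,
        Finset.sum_ite_eq', Finset.mem_univ, if_true] at h
  have h3 : l * (a e.1 - a f.1) = 0 := by linarith
  exact sub_eq_zero.1 ((mul_eq_zero.1 h3).resolve_left hl0.ne')

end MiscibleVEM

end


noncomputable section

namespace MiscibleVEM

variable {Ω : Set E2}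

/-- An elementwise constant function without jumps across common edges has no weak derivative in
the interior of the domain. -/
theorem integral_mul_fderiv_eq_zero (hΩ : IsOpen Ω) (hb : Bornology.IsBounded Ω) {M : Mesh Ω}
    {q : L2 Ω} {a : Fin M.card → ℝ} (ha : ∀ K, M.res K q = toL2 (M.elem K).carrier fun _ => a K)
    (hjump : ∀ e f, M.Matches e f → a e.1 = a f.1) {f : E2 → ℝ} (hf : IsTest Ω f) (v : E2) :
    ∫ x in Ω, q x * fderiv ℝ f x v = 0 := by
  classical
  have hf1 := hf.contDiff_one
  have hc : Continuous fun x => fderiv ℝ f x v := (hf1.continuous_fderiv one_ne_zero).clm_apply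
    continuous_const
  have hloc : ∀ K, ∫ x in (M.elem K).carrier, q x * fderiv ℝ f x v =
      ∑ i, a K * ((inner ℝ v ((M.elem K).normal i) : ℝ) *
        (M.elem K).edgeIntegral i (fun _ => 1) f) := fun K => by
    have h1 : ∫ x in (M.elem K).carrier, q x * fderiv ℝ f x v =
        ∫ x in (M.elem K).carrier, a K * fderiv ℝ f x v := by
      refine integral_congr_ae ?_
      filter_upwards [M.res_ae_eq K q, coeFn_toL2 (memLp_of_continuous (M.elem K).isBounded_carrier
        (continuous_const (y := a K)) 2)] with x h1 h2
      rw [← h1, ha K, h2]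
    rw [h1, integral_const_mul, Polygon.integral_fderiv _ hf1, Finset.mul_sum]
    refine Finset.sum_congr rfl fun i _ => ?_
    congr 1
    rw [← Polygon.edgeIntegral_smul]
    simp only [mul_one]
  rw [M.setIntegral_eq_sum (integrable_mul_of_memLp (Lp.memLp q) (memLp_of_continuous hb hc 2))]
  simp only [hloc]
  rw [← Fintype.sum_sigma (fun e : Σ K, Fin ((M.elem K).m + 3) =>
    a e.1 * ((inner ℝ v ((M.elem e.1).normal e.2) : ℝ) *
      (M.elem e.1).edgeIntegral e.2 (fun _ => 1) f))]
  set σ : (Σ K, Fin ((M.elem K).m + 3)) → Σ K, Fin ((M.elem K).m + 3) :=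
    fun e => if h : ∃ f, M.Matches e f then h.choose else e with hσ
  have hσ1 : ∀ e, (∃ f, M.Matches e f) → M.Matches e (σ e) := fun e h => by
    simp only [hσ, dif_pos h]; exact h.choose_spec
  have hbd : ∀ e : Σ K, Fin ((M.elem K).m + 3), (¬∃ f, M.Matches e f) →
      (M.elem e.1).edgeIntegral e.2 (fun _ => 1) f = 0 := fun e h => by
    have hs := (M.exists_matches e).resolve_right h
    rw [Polygon.edgeIntegral, intervalIntegral.integral_congr (g := fun _ => 0)]
    · simp
    · intro s hs'
      rw [uIcc_of_le zero_le_one] at hs'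
      have hx := hs ((M.elem e.1).edgePoint_mem_segment e.2 hs')
      have : f ((M.elem e.1).edgePoint e.2 s) = 0 := image_eq_zero_of_notMem_tsupport fun h' => by
        rw [hΩ.frontier_eq] at hx
        exact hx.2 (hf.2.2 h')
      simp [this]
  refine Finset.sum_involution (fun e _ => σ e) ?_ ?_ (fun _ _ => Finset.mem_univ _) ?_
  · intro e _
    by_cases h : ∃ f, M.Matches e f
    · have hm := hσ1 e h
      rw [hm.normal_eq, hm.edgeIntegral_eq, hjump _ _ hm, inner_neg_right]
      ring
    · have : σ e = e := by simp only [hσ, dif_neg h]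
      rw [this, hbd e h, mul_zero, mul_zero, add_zero]
  · intro e _ hne heq
    by_cases h : ∃ f, M.Matches e f
    · exact (hσ1 e h).1 (congrArg Sigma.fst heq)
    · exact hne (by rw [hbd e h, mul_zero, mul_zero])
  · intro e _
    by_cases h : ∃ f, M.Matches e f
    · have hm := hσ1 e h
      exact (hσ1 (σ e) ⟨e, hm.symm⟩).unique hm.symm
    · have : σ e = e := by simp only [hσ, dif_neg h]
      simp only [this]

theorem IsTest.comp_sub {φ : E2 → ℝ} {r : ℝ} (hφ : IsTest (Metric.ball 0 r) φ) {x : E2}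
    {U : Set E2} (hx : Metric.ball x r ⊆ U) : IsTest U fun z => φ (z - x) := by
  refine ⟨hφ.1.comp (contDiff_id.sub contDiff_const), hφ.2.1.comp_homeomorph (Homeomorph.subRight x),
    fun z hz => hx ?_⟩
  have h1 : z - x ∈ tsupport φ := tsupport_comp_subset_preimage φ
    (f := fun z => z - x) (by fun_prop) hz
  have := hφ.2.2 h1
  rwa [mem_ball_zero_iff, ← dist_eq_norm] at this

/-- Mollifications of a function without weak derivatives are constant on convex domains. -/
theorem integral_mul_comp_sub_eq (hconv : Convex ℝ Ω) (hb : Bornology.IsBounded Ω) {q : L2 Ω}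
    (hq : ∀ f, IsTest Ω f → ∀ v, ∫ x in Ω, q x * fderiv ℝ f x v = 0) {φ : E2 → ℝ} {r : ℝ}
    (hφ : IsTest (Metric.ball 0 r) φ) {x y : E2} (hx : Metric.ball x r ⊆ Ω)
    (hy : Metric.ball y r ⊆ Ω) :
    ∫ z in Ω, q z * φ (z - x) = ∫ z in Ω, q z * φ (z - y) := by
  have hfin : IsFiniteMeasure (volume.restrict Ω) :=
    ⟨by rw [Measure.restrict_apply_univ]; exact hb.measure_lt_top⟩
  have hqi : Integrable q (volume.restrict Ω) := (Lp.memLp q).integrable (by norm_num)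
  set γ : ℝ → E2 := fun t => x + t • (y - x) with hγ
  have hball : ∀ t ∈ Icc (0 : ℝ) 1, Metric.ball (γ t) r ⊆ Ω := fun t ht z hz => by
    have h1 : x + (z - γ t) ∈ Ω := hx (by simpa [dist_eq_norm] using hz)
    have h2 : y + (z - γ t) ∈ Ω := hy (by simpa [dist_eq_norm] using hz)
    have h3 := hconv h1 h2 (sub_nonneg.2 ht.2) ht.1 (sub_add_cancel 1 t)
    convert h3 using 1
    simp only [hγ]
    module
  have hφ1 := hφ.contDiff_one
  obtain ⟨C, hC⟩ := (hφ1.continuous_fderiv one_ne_zero).bounded_above_of_compact_support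
    (hφ.2.1.fderiv ℝ)
  have hcφ := hφ.1.continuous
  have hder : ∀ t, HasDerivAt (fun t => ∫ z in Ω, q z * φ (z - γ t))
      (∫ z in Ω, q z * -fderiv ℝ φ (z - γ t) (y - x)) t := fun t => by
    refine (hasDerivAt_integral_of_dominated_loc_of_deriv_le (μ := volume.restrict Ω)
      (F := fun t z => q z * φ (z - γ t)) (F' := fun t z => q z * -fderiv ℝ φ (z - γ t) (y - x))
      (bound := fun z => ‖q z‖ * (C * ‖y - x‖)) Filter.univ_mem ?_ ?_ ?_ ?_ ?_ ?_).2
    · exact Filter.Eventually.of_forall fun s => (Lp.aestronglyMeasurable q).mul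
        (by fun_prop : Continuous fun z => φ (z - γ s)).aestronglyMeasurable
    · exact integrable_mul_of_memLp (Lp.memLp q) (memLp_of_continuous hb (by fun_prop) 2)
    · refine (Lp.aestronglyMeasurable q).mul (Continuous.aestronglyMeasurable ?_)
      exact (((hφ1.continuous_fderiv one_ne_zero).comp (by fun_prop)).clm_apply
        continuous_const).neg
    · refine Filter.Eventually.of_forall fun z s _ => ?_
      rw [norm_mul, norm_neg]
      gcongr
      exact (ContinuousLinearMap.le_opNorm _ _).trans (by gcongr; exact hC _)
    · exact hqi.norm.mul_const _
    · refine Filter.Eventually.of_forall fun z s _ => HasDerivAt.const_mul _ ?_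
      have h1 : HasDerivAt (fun s => z - γ s) (-(y - x)) s := by
        have := (((hasDerivAt_id s).smul_const (y - x)).const_add x).const_sub z
        simpa using this
      have h2 := ((hφ1.differentiable one_ne_zero) (z - γ s)).hasFDerivAt.comp_hasDerivAt s h1
      rw [map_neg] at h2
      exact h2
  have hzero : ∀ t ∈ Icc (0 : ℝ) 1, ∫ z in Ω, q z * -fderiv ℝ φ (z - γ t) (y - x) = 0 :=
    fun t ht => by
      have h := hq _ (hφ.comp_sub (hball t ht)) (x - y)
      rw [← h]
      refine integral_congr_ae (Filter.Eventually.of_forall fun z => ?_)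
      simp only
      rw [fderiv_comp_sub, ← map_neg, neg_sub]
  have h := constant_of_has_deriv_right_zero (f := fun t => ∫ z in Ω, q z * φ (z - γ t))
    (a := 0) (b := 1) (fun t _ => (hder t).continuousAt.continuousWithinAt)
    (fun t ht => by
      have := (hder t).hasDerivWithinAt (s := Ici t)
      rwa [hzero t (Ico_subset_Icc_self ht)] at this) 1 (by simp)
  simp only [hγ] at h
  simpa using h.symm

theorem integral_mul_comp_sub_center {M : Mesh Ω} {q : L2 Ω} {a : ℝ} {K : Fin M.card}
    (hΩ : MeasurableSet Ω) (ha : M.res K q = toL2 (M.elem K).carrier fun _ => a) {φ : E2 → ℝ} {r : ℝ}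
    (hφ : IsTest (Metric.ball 0 r) φ) (hr : r ≤ (M.elem K).radius) :
    ∫ z in Ω, q z * φ (z - (M.elem K).center) = a * ∫ z, φ z := by
  have hball : Metric.ball (M.elem K).center r ⊆ (M.elem K).carrier :=
    (Metric.ball_subset_ball hr).trans (M.elem K).ball_subset
  have hzero : ∀ z ∉ (M.elem K).carrier, φ (z - (M.elem K).center) = 0 := fun z hz =>
    image_eq_zero_of_notMem_tsupport (f := fun z => φ (z - (M.elem K).center))
      fun h => hz ((hφ.comp_sub hball).2.2 h)
  rw [setIntegral_eq_of_subset_of_forall_sdiff_eq_zero hΩ (M.subset K)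
    (fun z hz => by rw [hzero z hz.2, mul_zero]),
    ← integral_sub_right_eq_self φ (M.elem K).center, ← integral_const_mul,
    ← setIntegral_eq_integral_of_forall_compl_eq_zero (s := (M.elem K).carrier)
      (f := fun z => a * φ (z - (M.elem K).center)) (fun z hz => by rw [hzero z hz, mul_zero])]
  refine integral_congr_ae ?_
  filter_upwards [M.res_ae_eq K q, coeFn_toL2 (memLp_of_continuous (M.elem K).isBounded_carrier
    (continuous_const (y := a)) 2)] with x h1 h2
  rw [← h1, ha, h2]

/-- The divergence is injective on discrete pressures: the algebraic inf-sup condition. -/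
theorem eq_zero_of_B_eq_zero (hΩ : IsConvexPolygonalDomain Ω) {k : ℕ} {M : Mesh Ω} {q : L2 Ω}
    (hq : q ∈ Qh k M) (hB : ∀ v ∈ Vh k M, B v q = 0) : q = 0 := by
  have hb := hΩ.isBounded
  have hfin : IsFiniteMeasure (volume.restrict Ω) :=
    ⟨by rw [Measure.restrict_apply_univ]; exact hb.measure_lt_top⟩
  choose a ha using exists_const_of_B_eq_zero M hb hq.2 hB
  have hd : ∀ f, IsTest Ω f → ∀ v, ∫ x in Ω, q x * fderiv ℝ f x v = 0 := fun f hf v =>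
    integral_mul_fderiv_eq_zero hΩ.isOpen hb ha (fun e f h => const_eq_of_matches hb hB ha h) hf v
  have hconst : ∀ K L, a K = a L := fun K L => by
    set r := min (M.elem K).radius (M.elem L).radius with hr
    have hr0 : 0 < r := lt_min (M.elem K).radius_pos (M.elem L).radius_pos
    set φ : ContDiffBump (0 : E2) := ⟨r / 4, r / 2, by positivity, by linarith⟩ with hφ
    have ht : IsTest (Metric.ball 0 r) φ := ⟨φ.contDiff, φ.hasCompactSupport, by
      rw [φ.tsupport_eq]
      exact Metric.closedBall_subset_ball (by simp only [hφ]; linarith)⟩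
    have h := integral_mul_comp_sub_eq hΩ.convex hb hd ht (x := (M.elem K).center)
      (y := (M.elem L).center)
      ((Metric.ball_subset_ball (min_le_left _ _)).trans ((M.elem K).ball_subset.trans (M.subset K)))
      ((Metric.ball_subset_ball (min_le_right _ _)).trans ((M.elem L).ball_subset.trans (M.subset L)))
    have hm := hΩ.isOpen.measurableSet
    rw [integral_mul_comp_sub_center hm (ha K) ht (min_le_left _ _),
      integral_mul_comp_sub_center hm (ha L) ht (min_le_right _ _)] at h
    exact mul_right_cancel₀ φ.integral_pos.ne' h
  refine M.eq_zero_of_restrictL2 fun K => ?_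
  have hint : ∑ L, a L * volume.real (M.elem L).carrier = 0 := by
    have h0 : ∫ x in Ω, q x = 0 := hq.1
    rw [M.setIntegral_eq_sum ((Lp.memLp q).integrable (by norm_num))] at h0
    rw [← h0]
    refine Finset.sum_congr rfl fun L _ => ?_
    rw [← Polygon.integral_toL2_const, ← ha L]
    exact integral_congr_ae (M.res_ae_eq L q)
  simp only [fun L => hconst L K] at hint
  rw [← Finset.mul_sum] at hint
  have hpos : 0 < ∑ L, volume.real (M.elem L).carrier :=
    Finset.sum_pos (fun L _ => (M.elem L).volume_real_pos) ⟨K, Finset.mem_univ K⟩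
  have hK : a K = 0 := (mul_eq_zero.1 hint).resolve_right hpos.ne'
  change M.res K q = 0
  rw [ha K, hK]
  refine Lp.ext ((coeFn_toL2 (memLp_of_continuous (M.elem K).isBounded_carrier
    continuous_const 2)).trans (Lp.coeFn_zero _ _ _).symm)

end MiscibleVEM

end


noncomputable section

namespace MiscibleVEM

/-! ### Linear systems in finite dimension -/

/-- In finite dimension, a nondegenerate linear variational problem has exactly one solution. -/
theorem existsUnique_of_nondegenerate {V : Type*} [AddCommGroup V] [Module ℝ V]
    [FiniteDimensional ℝ V] (b : V →ₗ[ℝ] V →ₗ[ℝ] ℝ) (hb : ∀ x, (∀ y, b x y = 0) → x = 0)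
    (l : V →ₗ[ℝ] ℝ) : ∃! x, ∀ y, b x y = l y := by
  have hinj : Function.Injective b := by
    rw [← LinearMap.ker_eq_bot, LinearMap.ker_eq_bot']
    exact fun x hx => hb x fun y => by rw [hx]; rfl
  have hsurj : Function.Surjective b :=
    (LinearMap.injective_iff_surjective_of_finrank_eq_finrank
      (Subspace.dual_finrank_eq (K := ℝ) (V := V)).symm).1 hinj
  obtain ⟨x, hx⟩ := hsurj l
  refine ⟨x, fun y => by simp only [hx], fun x' hx' => hinj ?_⟩
  rw [hx]
  exact LinearMap.ext hx'

/-- A finite-dimensional saddle point problem with a definite form and an injective constraint has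
exactly one solution. -/
theorem existsUnique_saddle {V W : Type*} [AddCommGroup V] [Module ℝ V] [FiniteDimensional ℝ V]
    [AddCommGroup W] [Module ℝ W] [FiniteDimensional ℝ W] (a : V →ₗ[ℝ] V →ₗ[ℝ] ℝ)
    (ha : ∀ x, a x x = 0 → x = 0) (b : V →ₗ[ℝ] W →ₗ[ℝ] ℝ) (hb : ∀ y, (∀ x, b x y = 0) → y = 0)
    (l : V →ₗ[ℝ] ℝ) (m : W →ₗ[ℝ] ℝ) :
    ∃! z : V × W, (∀ x, a z.1 x + b x z.2 = l x) ∧ ∀ y, b z.1 y = m y := by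
  set s : (V × W) →ₗ[ℝ] (V × W) →ₗ[ℝ] ℝ :=
    a.compl₁₂ (LinearMap.fst ℝ V W) (LinearMap.fst ℝ V W) +
      b.flip.compl₁₂ (LinearMap.snd ℝ V W) (LinearMap.fst ℝ V W) +
      b.compl₁₂ (LinearMap.fst ℝ V W) (LinearMap.snd ℝ V W) with hs
  have hsv : ∀ z w, s z w = a z.1 w.1 + b w.1 z.2 + b z.1 w.2 := fun z w => rfl
  have hiff : ∀ z : V × W, (∀ w, s z w = (l.coprod m) w) ↔
      (∀ x, a z.1 x + b x z.2 = l x) ∧ ∀ y, b z.1 y = m y := fun z => by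
    constructor
    · refine fun h => ⟨fun x => ?_, fun y => ?_⟩
      · simpa [hsv] using h (x, 0)
      · simpa [hsv] using h (0, y)
    · rintro ⟨h1, h2⟩ w
      rw [hsv, h1, h2, LinearMap.coprod_apply]
  have h := existsUnique_of_nondegenerate s (fun z hz => by
    have h1 : z.1 = 0 := ha _ (by simpa [hsv] using hz (z.1, -z.2))
    have h2 : z.2 = 0 := hb _ fun x => by simpa [hsv, h1] using hz (x, 0)
    exact Prod.ext h1 h2) (l.coprod m)
  simpa only [hiff] using h

/-! ### Weighted integrals -/

/-- The integral of a pointwise bilinear expression is bilinear. -/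
theorem exists_bilin_integral {F G : Type} [NormedAddCommGroup F] [NormedSpace ℝ F]
    [NormedAddCommGroup G] [NormedSpace ℝ G] {S : Set E2} (t : E2 → F → G → ℝ)
    (add_left : ∀ x u v w, t x (u + v) w = t x u w + t x v w)
    (smul_left : ∀ x (c : ℝ) u w, t x (c • u) w = c * t x u w)
    (add_right : ∀ x u v w, t x u (v + w) = t x u v + t x u w)
    (smul_right : ∀ x (c : ℝ) u w, t x u (c • w) = c * t x u w)
    (hint : ∀ (f : Lp F 2 (volume.restrict S)) (g : Lp G 2 (volume.restrict S)),
      IntegrableOn (fun x => t x (f x) (g x)) S) :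
    ∃ b : Lp F 2 (volume.restrict S) →ₗ[ℝ] Lp G 2 (volume.restrict S) →ₗ[ℝ] ℝ,
      ∀ f g, b f g = ∫ x in S, t x (f x) (g x) := by
  refine ⟨LinearMap.mk₂ ℝ (fun f g => ∫ x in S, t x (f x) (g x)) ?_ ?_ ?_ ?_, fun f g => rfl⟩
  · intro f f' g
    rw [← integral_add (hint f g) (hint f' g)]
    refine integral_congr_ae ?_
    filter_upwards [Lp.coeFn_add f f'] with x hx
    rw [hx, Pi.add_apply, add_left]
  · intro c f g
    rw [smul_eq_mul, ← integral_const_mul]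
    refine integral_congr_ae ?_
    filter_upwards [Lp.coeFn_smul c f] with x hx
    rw [hx, Pi.smul_apply, smul_left]
  · intro f g g'
    rw [← integral_add (hint f g) (hint f g')]
    refine integral_congr_ae ?_
    filter_upwards [Lp.coeFn_add g g'] with x hx
    rw [hx, Pi.add_apply, add_right]
  · intro c f g
    rw [smul_eq_mul, ← integral_const_mul]
    refine integral_congr_ae ?_
    filter_upwards [Lp.coeFn_smul c g] with x hx
    rw [hx, Pi.smul_apply, smul_right]

theorem integrable_mul_mul_of_memLp {μ : Measure E2} {w f g : E2 → ℝ} (hw : MemLp w ⊤ μ)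
    (hf : MemLp f 2 μ) (hg : MemLp g 2 μ) : Integrable (fun x => w x * f x * g x) μ :=
  integrable_mul_of_memLp (hf.mul hw) hg

theorem memLp_apply {μ : Measure E2} {p : ENNReal} {f : E2 → E2} (hf : MemLp f p μ) (i : Fin 2) :
    MemLp (fun x => f x i) p μ :=
  hf.continuousLinearMap_comp (EuclideanSpace.proj i : E2 →L[ℝ] ℝ)

theorem memLp_top_of_mem_polyL2v {S : Set E2} (hS : Bornology.IsBounded S) {m : ℤ} {f : L2v S}
    (hf : f ∈ polyL2v S m) : MemLp f ⊤ (volume.restrict S) := by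
  obtain ⟨P, hP, h⟩ := exists_polyFun_of_mem_polyL2v hf
  refine (memLp_congr_ae h).2 (memLp_of_continuous hS
    ((PiLp.continuous_toLp 2 _).comp (continuous_pi fun i => ?_)) ⊤)
  have h0 := continuous_of_mem_polyFun (hP 0)
  have h1 := continuous_of_mem_polyFun (hP 1)
  fin_cases i <;> simpa

/-- A weight with values in a compact interval is bounded. -/
theorem memLp_top_of_bounds {S : Set E2} (hS : MeasurableSet S) {w : E2 → ℝ}
    (hw : AEMeasurable w (volume.restrict S)) {lo hi : ℝ} (h : ∀ x ∈ S, lo ≤ w x ∧ w x ≤ hi) :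
    MemLp w ⊤ (volume.restrict S) := by
  refine memLp_top_of_bound hw.aestronglyMeasurable (max |lo| |hi|) ?_
  filter_upwards [ae_restrict_mem hS] with x hx
  exact abs_le_max_abs_abs (h x hx).1 (h x hx).2

theorem mul_norm_sq_le_integral {F : Type} [NormedAddCommGroup F] [InnerProductSpace ℝ F]
    {S : Set E2} (hS : MeasurableSet S) {w : E2 → ℝ} {lo : ℝ} (h : ∀ x ∈ S, lo ≤ w x)
    (f : Lp F 2 (volume.restrict S)) (hint : IntegrableOn (fun x => w x * inner ℝ (f x) (f x)) S) :
    lo * ‖f‖ ^ 2 ≤ ∫ x in S, w x * inner ℝ (f x) (f x) := by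
  rw [← real_inner_self_eq_norm_sq, L2.inner_def, ← integral_const_mul]
  refine integral_mono_ae ((L2.integrable_inner f f).const_mul lo) hint ?_
  filter_upwards [ae_restrict_mem hS] with x hx
  exact mul_le_mul_of_nonneg_right (h x hx) real_inner_self_nonneg

theorem Polygon.abs_average_pos (K : Polygon) {w : E2 → ℝ}
    (hw : AEMeasurable w (volume.restrict K.carrier)) {lo hi : ℝ} (hlo : 0 < lo)
    (h : ∀ x ∈ K.carrier, lo ≤ w x ∧ w x ≤ hi) : 0 < |⨍ x in K.carrier, w x| := by
  have hm := K.isOpen_carrier.measurableSet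
  have hint : IntegrableOn w K.carrier := (memLp_top_of_bounds hm hw h).integrable le_top
  have h1 : lo * volume.real K.carrier ≤ ∫ x in K.carrier, w x := by
    have := setIntegral_mono_on (integrable_const lo) hint hm fun x hx => (h x hx).1
    rwa [setIntegral_const, smul_eq_mul, mul_comm] at this
  have hV := K.volume_real_pos
  refine abs_pos.2 (ne_of_gt ?_)
  rw [setAverage_eq, smul_eq_mul]
  exact mul_pos (inv_pos.2 hV) (lt_of_lt_of_le (mul_pos hlo hV) h1)

/-! ### The coefficients -/

variable {Ω : Set E2}

theorem Medium.exists_bounds_inv_a (med : Medium Ω) (hne : Ω.Nonempty) : ∃ lo hi : ℝ, 0 < lo ∧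
    ∀ c, ∀ x ∈ Ω, lo ≤ (med.a c x)⁻¹ ∧ (med.a c x)⁻¹ ≤ hi := by
  obtain ⟨lo, hi, hlo, h⟩ := med.bounds_a
  obtain ⟨y, hy⟩ := hne
  have hhi : 0 < hi := hlo.trans_le ((h 0 y hy).1.trans (h 0 y hy).2)
  refine ⟨hi⁻¹, lo⁻¹, inv_pos.2 hhi, fun c x hx => ?_⟩
  have h1 := h c x hx
  exact ⟨inv_anti₀ (hlo.trans_le h1.1) h1.2, inv_anti₀ hlo h1.1⟩

theorem Medium.aemeasurable_inv_a (med : Medium Ω) {S : Set E2} {c : E2 → ℝ}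
    (hc : AEMeasurable c (volume.restrict S)) :
    AEMeasurable (fun x => (med.a (c x) x)⁻¹) (volume.restrict S) :=
  (med.measurable_a.comp_aemeasurable (hc.prodMk aemeasurable_id)).inv

theorem Medium.memLp_top_diffusion (med : Medium Ω) {S : Set E2} (hS : MeasurableSet S)
    (hSΩ : S ⊆ Ω) {u : E2 → E2} (hu : MemLp u ⊤ (volume.restrict S)) (i j : Fin 2) :
    MemLp (fun x => med.diffusion x (u x) i j) ⊤ (volume.restrict S) := by
  obtain ⟨lo, hi, -, hφ⟩ := med.bounds_φ
  have hφ' : MemLp med.φ ⊤ (volume.restrict S) := memLp_top_of_bounds hS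
    (med.measurable_φ.mono_measure (Measure.restrict_mono_set _ hSΩ)) fun x hx => hφ x (hSΩ hx)
  have hum : AEMeasurable u (volume.restrict S) := hu.1.aemeasurable
  have hc : ∀ i, AEMeasurable (fun x => u x i) (volume.restrict S) :=
    fun i => (memLp_apply hu i).1.aemeasurable
  have hE : MemLp (fun x => u x i * u x j / ‖u x‖ ^ 2) ⊤ (volume.restrict S) := by
    refine memLp_top_of_bound (((hc i).mul (hc j)).div (hum.norm.pow_const 2)).aestronglyMeasurable
      1 (Filter.Eventually.of_forall fun x => ?_)
    rw [norm_div, norm_mul, norm_pow, norm_norm]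
    refine div_le_one_of_le₀ ?_ (by positivity)
    rw [pow_two]
    exact mul_le_mul (PiLp.norm_apply_le _ _) (PiLp.norm_apply_le _ _) (norm_nonneg _)
      (norm_nonneg _)
  have h1 : MemLp (fun _ : E2 => (1 : Matrix (Fin 2) (Fin 2) ℝ) i j) ⊤ (volume.restrict S) :=
    memLp_top_const _
  have h2 := MemLp.mul (p := ⊤) (q := ⊤) (r := ⊤)
    ((h1.const_mul med.dm).add (MemLp.mul (p := ⊤) (q := ⊤) (r := ⊤)
    ((hE.const_mul med.dl).add ((h1.sub hE).const_mul med.dt)) hu.norm)) hφ'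
  refine (memLp_congr_ae (Filter.Eventually.of_forall fun x => ?_)).1 h2
  simp [Medium.diffusion]
  ring

theorem Medium.diffusion_mulVec_nonneg (med : Medium Ω) {x : E2} (hx : 0 ≤ med.φ x) (u f : E2) :
    0 ≤ (med.diffusion x u).mulVec f ⬝ᵥ f := by
  have hdm := med.dm_pos
  have hdt := hdm.trans_le med.dm_le_dt
  have hdl := hdt.trans_le med.dt_le_dl
  set E := (inner ℝ u f : ℝ) ^ 2 / ‖u‖ ^ 2 with hE
  have hE0 : 0 ≤ E := by positivity
  have hE1 : E ≤ ‖f‖ ^ 2 := by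
    refine div_le_of_le_mul₀ (by positivity) (by positivity) ?_
    rw [← mul_pow, mul_comm ‖f‖, ← sq_abs]
    exact pow_le_pow_left₀ (abs_nonneg _) (abs_real_inner_le_norm u f) 2
  have h : (med.diffusion x u).mulVec f ⬝ᵥ f =
      med.φ x * (med.dm * ‖f‖ ^ 2 + ‖u‖ * (med.dl * E + med.dt * (‖f‖ ^ 2 - E))) := by
    rw [hE, ← real_inner_self_eq_norm_sq f, E2.inner_eq, E2.inner_eq]
    simp [Medium.diffusion, Matrix.mulVec, dotProduct, Fin.sum_univ_two, Matrix.one_apply]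
    ring
  rw [h]
  have := sub_nonneg.2 hE1
  positivity

end MiscibleVEM

end


noncomputable section

namespace MiscibleVEM

variable {Ω : Set E2}

/-! ### Local projections and local spaces -/

theorem proj_sub_proj (S : Set E2) (m : ℤ) (f : L2 S) : proj S m (f - proj S m f) = 0 := by
  rw [proj, map_sub, sub_eq_zero]
  exact (Submodule.starProjection_eq_self_iff.2 (Submodule.starProjection_apply_mem _ _)).symm

theorem projv_sub_projv (S : Set E2) (m : ℤ) (f : L2v S) : projv S m (f - projv S m f) = 0 := by
  rw [projv, map_sub, sub_eq_zero]
  exact (Submodule.starProjection_eq_self_iff.2 (Submodule.starProjection_apply_mem _ _)).symm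

theorem exists_sub_proj_mem_ZhLoc {k : ℕ} {K : Polygon} {z : L2 K.carrier × L2v K.carrier}
    (hz : z ∈ ZhLoc k K) : ∃ g, (z.1 - proj K.carrier ((k : ℤ) + 1) z.1, g) ∈ ZhLoc k K := by
  obtain ⟨P, hP, h⟩ := exists_polyFun_of_mem_polyL2
    ((polyL2 K.carrier ((k : ℤ) + 1)).starProjection_apply_mem z.1)
  obtain ⟨p, hp, hp1, -⟩ := exists_mem_polyGraph K.isBounded_carrier hP
  have h1 : p.1 = proj K.carrier ((k : ℤ) + 1) z.1 := Lp.ext (hp1.trans h.symm)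
  refine ⟨z.2 - p.2, ?_⟩
  rw [← h1]
  exact (zhLoc k K).sub_mem hz (polyGraph_le_zhLoc k K hp)

theorem exists_sub_projv_mem_VhLoc {k : ℕ} {K : Polygon} {v : L2v K.carrier × L2 K.carrier}
    (hv : v ∈ VhLoc k K) : ∃ d, (v.1 - projv K.carrier k v.1, d) ∈ VhLoc k K := by
  obtain ⟨d, hd⟩ := exists_mem_vhLoc ((polyL2v K.carrier k).starProjection_apply_mem v.1)
  exact ⟨v.2 - d, (vhLoc k K).sub_mem hv hd⟩

theorem sub_projGrad_mem_ZhLoc {k : ℕ} {K : Polygon} {z : L2 K.carrier × L2v K.carrier}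
    (hz : z ∈ ZhLoc k K) : z - projGrad K ((k : ℤ) + 1) z ∈ ZhLoc k K ∧
      projGrad K ((k : ℤ) + 1) (z - projGrad K ((k : ℤ) + 1) z) = 0 := by
  have hk : (0 : ℤ) ≤ (k : ℤ) + 1 := by positivity
  have hp := (isGradProj_projGrad K hk z).1
  have hmem : z - projGrad K ((k : ℤ) + 1) z ∈ ZhLoc k K :=
    (zhLoc k K).sub_mem hz (polyGraph_le_zhLoc k K hp)
  refine ⟨hmem, ?_⟩
  have h := projGrad_add hk (ZhLoc.exists_hasTrace hmem)
    (ZhLoc.exists_hasTrace (polyGraph_le_zhLoc k K hp))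
  rw [sub_add_cancel, projGrad_of_mem hk hp] at h
  exact left_eq_add.1 (by rw [add_comm]; exact h)

/-! ### The discrete forms are bilinear -/

section Forms

variable (k : ℕ) (M : Mesh Ω) (med : Medium Ω) (S : Stabilization k M)

/-- The elementwise projection as a linear map. -/
def Mesh.prL (K : Fin M.card) : L2 Ω →ₗ[ℝ] L2 (M.elem K).carrier :=
  (polyL2 (M.elem K).carrier ((k : ℤ) + 1)).starProjection.toLinearMap ∘ₗ M.resL K

/-- The elementwise projection of vector fields as a linear map. -/
def Mesh.prvL (K : Fin M.card) : L2v Ω →ₗ[ℝ] L2v (M.elem K).carrier :=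
  (polyL2v (M.elem K).carrier k).starProjection.toLinearMap ∘ₗ M.resvL K

theorem Mesh.prL_apply (K : Fin M.card) (c : L2 Ω) : M.prL k K c = M.pr k K c := rfl

theorem Mesh.prvL_apply (K : Fin M.card) (v : L2v Ω) : M.prvL k K v = M.prv k K v := rfl

theorem Mesh.resL_apply (K : Fin M.card) (c : L2 Ω) : M.resL K c = M.res K c := rfl

theorem Mesh.resvL_apply (K : Fin M.card) (v : L2v Ω) : M.resvL K v = M.resv K v := rfl

theorem Mesh.measurableSet_elem (K : Fin M.card) : MeasurableSet (M.elem K).carrier :=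
  (M.elem K).isOpen_carrier.measurableSet

theorem Medium.memLp_top_phi (K : Fin M.card) :
    MemLp med.φ ⊤ (volume.restrict (M.elem K).carrier) := by
  obtain ⟨lo, hi, -, hφ⟩ := med.bounds_φ
  exact memLp_top_of_bounds (M.measurableSet_elem K)
    (med.measurable_φ.mono_measure (Measure.restrict_mono_set _ (M.subset K)))
    fun x hx => hφ x (M.subset K hx)

theorem Mesh.memLp_top_prv (K : Fin M.card) (u : L2v Ω) :
    MemLp (M.prv k K u) ⊤ (volume.restrict (M.elem K).carrier) :=
  memLp_top_of_mem_polyL2v (M.elem K).isBounded_carrier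
    (Submodule.starProjection_apply_mem _ _)

theorem exists_bilin_Mh : ∃ b : L2 Ω →ₗ[ℝ] L2 Ω →ₗ[ℝ] ℝ,
    ∀ c z : L2 Ω × L2v Ω, b c.1 z.1 = Mh k M med S c z := by
  have h : ∀ K, ∃ b : L2 (M.elem K).carrier →ₗ[ℝ] L2 (M.elem K).carrier →ₗ[ℝ] ℝ,
      ∀ f g, b f g = ∫ x in (M.elem K).carrier, med.φ x * f x * g x := fun K =>
    exists_bilin_integral (fun x u v => med.φ x * u * v) (by intros; ring)
      (by intros; simp only [smul_eq_mul]; ring) (by intros; ring)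
      (by intros; simp only [smul_eq_mul]; ring)
      fun f g => integrable_mul_mul_of_memLp (med.memLp_top_phi M K) (Lp.memLp f) (Lp.memLp g)
  choose b hb using h
  refine ⟨∑ K, ((b K).compl₁₂ (M.prL k K) (M.prL k K) +
    nuM M med K • (S.SM K).compl₁₂ (M.resL K - M.prL k K) (M.resL K - M.prL k K)), fun c z => ?_⟩
  simp only [LinearMap.sum_apply, LinearMap.add_apply, LinearMap.smul_apply,
    LinearMap.compl₁₂_apply, LinearMap.sub_apply, hb, smul_eq_mul, M.prL_apply, M.resL_apply, Mh]

theorem integrableOn_inv_a_inner (c : L2 Ω) (K : Fin M.card) (f g : L2v (M.elem K).carrier) :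
    IntegrableOn (fun x => (med.a (M.pr k K c x) x)⁻¹ * (inner ℝ (f x) (g x) : ℝ))
      (M.elem K).carrier := by
  obtain ⟨lo, hi, -, ha⟩ := med.exists_bounds_inv_a ⟨_, M.subset K (M.elem K).center_mem⟩
  refine Integrable.bdd_mul (L2.integrable_inner f g)
    (med.aemeasurable_inv_a (Lp.aestronglyMeasurable _).aemeasurable).aestronglyMeasurable
    (c := max |lo| |hi|) ?_
  filter_upwards [ae_restrict_mem (M.measurableSet_elem K)] with x hx
  exact abs_le_max_abs_abs (ha _ x (M.subset K hx)).1 (ha _ x (M.subset K hx)).2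

theorem exists_bilin_Ah (c : L2 Ω) : ∃ b : L2v Ω →ₗ[ℝ] L2v Ω →ₗ[ℝ] ℝ,
    ∀ u v : L2v Ω × L2 Ω, b u.1 v.1 = Ah k M med S c u v := by
  have h : ∀ K, ∃ b : L2v (M.elem K).carrier →ₗ[ℝ] L2v (M.elem K).carrier →ₗ[ℝ] ℝ,
      ∀ f g, b f g = ∫ x in (M.elem K).carrier,
        (med.a (M.pr k K c x) x)⁻¹ * (inner ℝ (f x) (g x) : ℝ) := fun K =>
    exists_bilin_integral (fun x u v => (med.a (M.pr k K c x) x)⁻¹ * (inner ℝ u v : ℝ))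
      (by intros; rw [inner_add_left]; ring) (by intros; rw [real_inner_smul_left]; ring)
      (by intros; rw [inner_add_right]; ring) (by intros; rw [real_inner_smul_right]; ring)
      (integrableOn_inv_a_inner k M med c K)
  choose b hb using h
  refine ⟨∑ K, ((b K).compl₁₂ (M.prvL k K) (M.prvL k K) +
    nuA M med K c • (S.SA K).compl₁₂ (M.resvL K - M.prvL k K) (M.resvL K - M.prvL k K)),
    fun u v => ?_⟩
  simp only [LinearMap.sum_apply, LinearMap.add_apply, LinearMap.smul_apply,
    LinearMap.compl₁₂_apply, LinearMap.sub_apply, hb, smul_eq_mul, M.prvL_apply, M.resvL_apply, Ah]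

theorem exists_bilin_Thetah {qp qm : E2 → ℝ} (hq : MemLp (fun x => qp x + qm x) ⊤ (volume.restrict Ω))
    (u : L2v Ω) : ∃ b : (L2 Ω × L2v Ω) →ₗ[ℝ] (L2 Ω × L2v Ω) →ₗ[ℝ] ℝ,
    ∀ c z, b c z = Thetah k M qp qm u c z := by
  have h1 : ∀ K, ∃ b : L2v (M.elem K).carrier →ₗ[ℝ] L2 (M.elem K).carrier →ₗ[ℝ] ℝ,
      ∀ f g, b f g = ∫ x in (M.elem K).carrier, (inner ℝ (M.prv k K u x) (f x) : ℝ) * g x :=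
    fun K => exists_bilin_integral (fun x v s => (inner ℝ (M.prv k K u x) v : ℝ) * s)
      (by intros; rw [inner_add_right]; ring) (by intros; rw [real_inner_smul_right]; ring)
      (by intros; ring) (by intros; simp only [smul_eq_mul]; ring) fun f g => by
        have hU := M.memLp_top_prv k K u
        simp only [E2.inner_eq, add_mul]
        exact (integrable_mul_mul_of_memLp (memLp_apply hU 0) (memLp_apply (Lp.memLp f) 0)
          (Lp.memLp g)).add (integrable_mul_mul_of_memLp (memLp_apply hU 1)
          (memLp_apply (Lp.memLp f) 1) (Lp.memLp g))
  have h2 : ∀ K, ∃ b : L2 (M.elem K).carrier →ₗ[ℝ] L2 (M.elem K).carrier →ₗ[ℝ] ℝ,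
      ∀ f g, b f g = ∫ x in (M.elem K).carrier, (qp x + qm x) * f x * g x := fun K =>
    exists_bilin_integral (fun x u v => (qp x + qm x) * u * v) (by intros; ring)
      (by intros; simp only [smul_eq_mul]; ring) (by intros; ring)
      (by intros; simp only [smul_eq_mul]; ring)
      fun f g => integrable_mul_mul_of_memLp
        (hq.mono_measure (Measure.restrict_mono_set _ (M.subset K))) (Lp.memLp f) (Lp.memLp g)
  choose b1 hb1 using h1
  choose b2 hb2 using h2
  refine ⟨(1 / 2 : ℝ) • ((∑ K, (b1 K).compl₁₂ (M.prvL k K ∘ₗ LinearMap.snd ℝ _ _)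
      (M.prL k K ∘ₗ LinearMap.fst ℝ _ _)) +
    (∑ K, (b2 K).compl₁₂ (M.prL k K ∘ₗ LinearMap.fst ℝ _ _) (M.prL k K ∘ₗ LinearMap.fst ℝ _ _)) -
    ∑ K, (b1 K).flip.compl₁₂ (M.prL k K ∘ₗ LinearMap.fst ℝ _ _)
      (M.prvL k K ∘ₗ LinearMap.snd ℝ _ _)), fun c z => ?_⟩
  simp only [LinearMap.sum_apply, LinearMap.add_apply, LinearMap.smul_apply,
    LinearMap.compl₁₂_apply, LinearMap.sub_apply, hb1, hb2, smul_eq_mul, M.prL_apply, M.prvL_apply,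
    LinearMap.flip_apply, LinearMap.comp_apply, LinearMap.fst_apply, LinearMap.snd_apply, Thetah]
  simp only [mul_comm]

/-- The difference of a discrete function and its gradient projection, as a linear map. -/
def zhSubProjGrad (hb : Bornology.IsBounded Ω) (K : Fin M.card) :
    zh k M hb →ₗ[ℝ] L2 (M.elem K).carrier where
  toFun z := M.res K z.1.1 - (projGrad (M.elem K) ((k : ℤ) + 1) (M.res K z.1.1, M.resv K z.1.2)).1
  map_add' z w := by
    have h := congrArg Prod.fst (projGrad_add (m := (k : ℤ) + 1) (by positivity)
      (ZhLoc.exists_hasTrace (z.2.2 K)) (ZhLoc.exists_hasTrace (w.2.2 K)))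
    rw [Prod.mk_add_mk, Prod.fst_add] at h
    have e1 : M.res K (z + w).1.1 = M.res K z.1.1 + M.res K w.1.1 := (M.resL K).map_add _ _
    have e2 : M.resv K (z + w).1.2 = M.resv K z.1.2 + M.resv K w.1.2 := (M.resvL K).map_add _ _
    rw [e1, e2, h]
    abel
  map_smul' a z := by
    have h := congrArg Prod.fst (projGrad_smul (m := (k : ℤ) + 1) (by positivity)
      (ZhLoc.exists_hasTrace (z.2.2 K)) a)
    rw [Prod.smul_mk, Prod.smul_fst] at h
    have e1 : M.res K (a • z).1.1 = a • M.res K z.1.1 := (M.resL K).map_smul _ _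
    have e2 : M.resv K (a • z).1.2 = a • M.resv K z.1.2 := (M.resvL K).map_smul _ _
    rw [e1, e2, h, smul_sub, RingHom.id_apply]

theorem exists_bilin_Dh (hb : Bornology.IsBounded Ω) (u : L2v Ω) :
    ∃ b : zh k M hb →ₗ[ℝ] zh k M hb →ₗ[ℝ] ℝ, ∀ c z, b c z = Dh k M med S u c.1 z.1 := by
  have h : ∀ K, ∃ b : L2v (M.elem K).carrier →ₗ[ℝ] L2v (M.elem K).carrier →ₗ[ℝ] ℝ,
      ∀ f g, b f g = ∫ x in (M.elem K).carrier,
        (med.diffusion x (M.prv k K u x)).mulVec (f x) ⬝ᵥ (g x) := fun K =>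
    exists_bilin_integral (fun x (v w : E2) => (med.diffusion x (M.prv k K u x)).mulVec v ⬝ᵥ w)
      (by intros; rw [WithLp.ofLp_add, Matrix.mulVec_add, add_dotProduct])
      (by intros; rw [WithLp.ofLp_smul, Matrix.mulVec_smul, smul_dotProduct, smul_eq_mul])
      (by intros; rw [WithLp.ofLp_add, dotProduct_add])
      (by intros; rw [WithLp.ofLp_smul, dotProduct_smul, smul_eq_mul]) fun f g => by
        simp only [dotProduct, Matrix.mulVec, Fin.sum_univ_two, add_mul]
        have hD := med.memLp_top_diffusion (M.measurableSet_elem K) (M.subset K)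
          (M.memLp_top_prv k K u)
        have hI : ∀ i j, IntegrableOn (fun x => med.diffusion x (M.prv k K u x) i j * f x j * g x i)
            (M.elem K).carrier := fun i j =>
          integrable_mul_mul_of_memLp (hD i j) (memLp_apply (Lp.memLp f) j)
            (memLp_apply (Lp.memLp g) i)
        exact ((hI 0 0).add (hI 0 1)).add ((hI 1 0).add (hI 1 1))
  choose b hbK using h
  set p : zh k M hb →ₗ[ℝ] L2v Ω := LinearMap.snd ℝ _ _ ∘ₗ (zh k M hb).subtype
  refine ⟨∑ K, ((b K).compl₁₂ (M.prvL k K ∘ₗ p) (M.prvL k K ∘ₗ p) +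
    nuD M med K u • (S.SD K).compl₁₂ (zhSubProjGrad k M hb K) (zhSubProjGrad k M hb K)),
    fun c z => ?_⟩
  simp only [LinearMap.sum_apply, LinearMap.add_apply, LinearMap.smul_apply,
    LinearMap.compl₁₂_apply, hbK, smul_eq_mul, M.prvL_apply, LinearMap.comp_apply]
  rfl

theorem exists_linear_sourceh {qp chat : E2 → ℝ} (hqp : MemLp qp ⊤ (volume.restrict Ω))
    (hc : MemLp chat 2 (volume.restrict Ω)) : ∃ l : L2 Ω →ₗ[ℝ] ℝ,
    ∀ z : L2 Ω × L2v Ω, l z.1 = sourceh k M qp chat z := by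
  have h : MemLp (fun x => qp x * chat x) 2 (volume.restrict Ω) := hc.mul hqp
  refine ⟨∑ K, (innerₗ _ (toL2 (M.elem K).carrier fun x => qp x * chat x)) ∘ₗ M.prL k K,
    fun z => ?_⟩
  simp only [LinearMap.sum_apply, LinearMap.comp_apply, innerₗ_apply_apply, M.prL_apply, sourceh]
  refine Finset.sum_congr rfl fun K _ => ?_
  rw [real_inner_comm, ← integral_mul_eq _ (h.mono_measure
    (Measure.restrict_mono_set _ (M.subset K)))]
  simp only [mul_comm]

theorem exists_linear_gammah {c : L2 Ω} (hc : GravityL2 k M med c) : ∃ l : L2v Ω →ₗ[ℝ] ℝ,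
    ∀ v : L2v Ω × L2 Ω, l v.1 = gammah k M med c v := by
  refine ⟨∑ K, (innerₗ _ (toL2 (M.elem K).carrier fun x => med.γ (M.pr k K c x))) ∘ₗ M.prvL k K,
    fun v => ?_⟩
  simp only [LinearMap.sum_apply, LinearMap.comp_apply, innerₗ_apply_apply, M.prvL_apply, gammah]
  refine Finset.sum_congr rfl fun K _ => ?_
  rw [real_inner_comm, ← integral_inner_eq _ (hc K)]
  simp only [real_inner_comm]

theorem B_eq_inner (v : L2v Ω × L2 Ω) (q : L2 Ω) : B v q = -inner ℝ v.2 q := by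
  rw [B, L2.inner_def]
  simp [mul_comm]

end Forms

end MiscibleVEM

end


noncomputable section

namespace MiscibleVEM

variable {Ω : Set E2}

/-! ### Definiteness of the discrete forms -/

theorem ae_eq_zero_of_forall_isTest {F : Type*} [NormedAddCommGroup F] [NormedSpace ℝ F]
    [CompleteSpace F] (hΩ : IsOpen Ω) {g : E2 → F} (hg : IntegrableOn g Ω)
    (h : ∀ f, IsTest Ω f → ∫ x in Ω, f x • g x = 0) : g =ᵐ[volume.restrict Ω] 0 := by
  have h1 := hΩ.ae_eq_zero_of_integral_contDiff_smul_eq_zero (μ := volume)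
    hg.locallyIntegrableOn fun f hf hfc hfs => by
      rw [← h f ⟨hf, hfc, hfs⟩]
      refine (setIntegral_eq_integral_of_forall_compl_eq_zero fun x hx => ?_).symm
      rw [image_eq_zero_of_notMem_tsupport fun hx' => hx (hfs hx'), zero_smul]
  exact (ae_restrict_iff' hΩ.measurableSet).2 h1

theorem integrableOn_Lp {F : Type*} [NormedAddCommGroup F] (hb : Bornology.IsBounded Ω)
    (f : Lp F 2 (volume.restrict Ω)) : IntegrableOn f Ω := by
  have hfin : IsFiniteMeasure (volume.restrict Ω) :=
    ⟨by rw [Measure.restrict_apply_univ]; exact hb.measure_lt_top⟩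
  exact (Lp.memLp f).integrable (by norm_num)

/-- An `H¹` function is determined by its first component. -/
theorem H1.eq_zero (hΩ : IsOpen Ω) (hb : Bornology.IsBounded Ω) {z : L2 Ω × L2v Ω} (hz : z ∈ H1 Ω)
    (h : z.1 = 0) : z = 0 := by
  refine Prod.ext h (Lp.ext ((ae_eq_zero_of_forall_isTest hΩ (integrableOn_Lp hb _)
    fun f hf => ?_).trans (Lp.coeFn_zero _ _ _).symm))
  have h1 := hz f hf
  rw [h, integral_eq_zero_of_ae (by
    filter_upwards [Lp.coeFn_zero ℝ 2 (volume.restrict Ω)] with x hx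
    rw [hx, Pi.zero_apply, zero_smul, Pi.zero_apply]), eq_comm, neg_eq_zero] at h1
  exact h1

/-- An `H(div)` field is determined by its first component. -/
theorem V.eq_zero (hΩ : IsOpen Ω) (hb : Bornology.IsBounded Ω) {v : L2v Ω × L2 Ω} (hv : v ∈ V Ω)
    (h : v.1 = 0) : v = 0 := by
  refine Prod.ext h (Lp.ext ((ae_eq_zero_of_forall_isTest hΩ (integrableOn_Lp hb _)
    fun f hf => ?_).trans (Lp.coeFn_zero _ _ _).symm))
  have hf' := hf.mono (subset_univ _)
  have h1 := hv f hf'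
  rw [integral_inner_add_eq hb v hf', h, inner_zero_left, zero_add,
    ← integral_mul_eq _ (hf.memLp hb)] at h1
  rw [← h1]
  simp only [smul_eq_mul, mul_comm]

section Forms

variable {k : ℕ} {M : Mesh Ω} (med : Medium Ω) (S : Stabilization k M)

theorem nuM_pos (K : Fin M.card) : 0 < nuM M med K := by
  obtain ⟨lo, hi, hlo, hφ⟩ := med.bounds_φ
  exact (M.elem K).abs_average_pos
    (med.measurable_φ.mono_measure (Measure.restrict_mono_set _ (M.subset K))) hlo
    fun x hx => hφ x (M.subset K hx)

theorem nuD_nonneg (K : Fin M.card) (u : L2v Ω) : 0 ≤ nuD M med K u := by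
  have h1 := (nuM_pos med K).le
  have h2 := med.dm_pos
  have h3 := h2.trans_le med.dm_le_dt
  rw [nuD]
  positivity

theorem nuA_pos (K : Fin M.card) (c : L2 Ω) : 0 < nuA M med K c := by
  obtain ⟨lo, hi, hlo, ha⟩ := med.exists_bounds_inv_a
    ⟨_, M.subset K (M.elem K).center_mem⟩
  exact (M.elem K).abs_average_pos (med.aemeasurable_inv_a aemeasurable_const) hlo
    fun x hx => ha _ x (M.subset K hx)

theorem eq_zero_of_sum_nonpos {ι : Type*} [Fintype ι] {f : ι → ℝ} (h0 : ∀ i, 0 ≤ f i)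
    (h : ∑ i, f i ≤ 0) (i : ι) : f i = 0 :=
  (Finset.sum_eq_zero_iff_of_nonneg fun i _ => h0 i).1
    (le_antisymm h (Finset.sum_nonneg fun i _ => h0 i)) i (Finset.mem_univ i)

/-- A quantity bounded below by positive multiples of the squared norms of the two parts of a
splitting is nonnegative, and vanishes only if the sum of both parts does. -/
theorem nonneg_and_eq_zero_of_le {E : Type*} [NormedAddCommGroup E] {p z : E} {a b t : ℝ}
    (ha : 0 < a) (hb : 0 < b) (h : a * ‖p‖ ^ 2 + b * ‖z - p‖ ^ 2 ≤ t) :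
    0 ≤ t ∧ (t = 0 → z = 0) := by
  have h1 : 0 ≤ a * ‖p‖ ^ 2 := by positivity
  have h2 : 0 ≤ b * ‖z - p‖ ^ 2 := by positivity
  refine ⟨by linarith, fun ht => ?_⟩
  have h3 : a * ‖p‖ ^ 2 = 0 := by linarith
  have h4 : b * ‖z - p‖ ^ 2 = 0 := by linarith
  have h5 : p = 0 := by simpa [ha.ne'] using h3
  simpa [hb.ne', h5] using h4

theorem eq_zero_of_Mh_nonpos (hΩ : IsOpen Ω) (hb : Bornology.IsBounded Ω) {c : L2 Ω × L2v Ω}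
    (hc : c ∈ Zh k M) (h : Mh k M med S c c ≤ 0) : c = 0 := by
  obtain ⟨lo, hi, hlo, hφ⟩ := med.bounds_φ
  obtain ⟨M₀, _, hM₀, _, hS⟩ := S.bounds_SM
  have key : ∀ K, 0 ≤ ((∫ x in (M.elem K).carrier, med.φ x * M.pr k K c.1 x * M.pr k K c.1 x) +
      nuM M med K * S.SM K (M.res K c.1 - M.pr k K c.1) (M.res K c.1 - M.pr k K c.1)) ∧
      (((∫ x in (M.elem K).carrier, med.φ x * M.pr k K c.1 x * M.pr k K c.1 x) +
      nuM M med K * S.SM K (M.res K c.1 - M.pr k K c.1) (M.res K c.1 - M.pr k K c.1)) = 0 →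
        M.res K c.1 = 0) := fun K => by
    have hν := nuM_pos med K
    refine nonneg_and_eq_zero_of_le hlo (mul_pos hν hM₀) (p := M.pr k K c.1) (add_le_add ?_ ?_)
    · have e : ∀ x, med.φ x * M.pr k K c.1 x * M.pr k K c.1 x =
          med.φ x * inner ℝ (M.pr k K c.1 x) (M.pr k K c.1 x) := fun x => by
        simp only [RCLike.inner_apply, conj_trivial]
        ring
      have hint := integrable_mul_mul_of_memLp (med.memLp_top_phi M K)
        (Lp.memLp (M.pr k K c.1)) (Lp.memLp (M.pr k K c.1))
      simp only [e] at hint ⊢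
      exact mul_norm_sq_le_integral (M.measurableSet_elem K)
        (fun x hx => (hφ x (M.subset K hx)).1) _ hint
    · obtain ⟨g, hg⟩ := exists_sub_proj_mem_ZhLoc (hc.2 K)
      rw [mul_assoc]
      exact mul_le_mul_of_nonneg_left (hS K _ hg (proj_sub_proj _ _ _)).1 hν.le
  exact H1.eq_zero hΩ hb hc.1 (M.eq_zero_of_restrictL2 fun K =>
    (key K).2 (eq_zero_of_sum_nonpos (fun K => (key K).1) h K))

theorem eq_zero_of_Ah_nonpos (hΩ : IsOpen Ω) (hb : Bornology.IsBounded Ω) (c : L2 Ω)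
    {v : L2v Ω × L2 Ω} (hv : v ∈ Vh k M) (h : Ah k M med S c v v ≤ 0) : v = 0 := by
  obtain ⟨M₀, _, hM₀, _, hS⟩ := S.bounds_SA
  have key : ∀ K, 0 ≤ ((∫ x in (M.elem K).carrier, (med.a (M.pr k K c x) x)⁻¹ *
      (inner ℝ (M.prv k K v.1 x) (M.prv k K v.1 x) : ℝ)) +
      nuA M med K c * S.SA K (M.resv K v.1 - M.prv k K v.1) (M.resv K v.1 - M.prv k K v.1)) ∧
      (((∫ x in (M.elem K).carrier, (med.a (M.pr k K c x) x)⁻¹ *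
      (inner ℝ (M.prv k K v.1 x) (M.prv k K v.1 x) : ℝ)) +
      nuA M med K c * S.SA K (M.resv K v.1 - M.prv k K v.1) (M.resv K v.1 - M.prv k K v.1)) = 0 →
        M.resv K v.1 = 0) := fun K => by
    obtain ⟨lo, hi, hlo, ha⟩ := med.exists_bounds_inv_a
      ⟨_, M.subset K (M.elem K).center_mem⟩
    have hν := nuA_pos med K c
    refine nonneg_and_eq_zero_of_le hlo (mul_pos hν hM₀) (p := M.prv k K v.1) (add_le_add ?_ ?_)
    · exact mul_norm_sq_le_integral (M.measurableSet_elem K)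
        (fun x hx => (ha _ x (M.subset K hx)).1) _ (integrableOn_inv_a_inner k M med c K _ _)
    · obtain ⟨d, hd⟩ := exists_sub_projv_mem_VhLoc (hv.2 K)
      rw [mul_assoc]
      exact mul_le_mul_of_nonneg_left (hS K _ hd (projv_sub_projv _ _ _)).1 hν.le
  exact V.eq_zero hΩ hb hv.1 (M.eq_zero_of_restrictL2 fun K =>
    (key K).2 (eq_zero_of_sum_nonpos (fun K => (key K).1) h K))

theorem Dh_nonneg (u : L2v Ω) {c : L2 Ω × L2v Ω} (hc : c ∈ Zh k M) : 0 ≤ Dh k M med S u c c := by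
  obtain ⟨lo, hi, hlo, hφ⟩ := med.bounds_φ
  obtain ⟨M₀, _, hM₀, _, hS⟩ := S.bounds_SD
  refine Finset.sum_nonneg fun K _ => add_nonneg (setIntegral_nonneg (M.measurableSet_elem K)
    fun x hx => ?_) (mul_nonneg (nuD_nonneg med K u) ?_)
  · exact med.diffusion_mulVec_nonneg (hlo.le.trans (hφ x (M.subset K hx)).1) _ _
  · obtain ⟨h1, h2⟩ := sub_projGrad_mem_ZhLoc (hc.2 K)
    exact le_trans (by positivity) (hS K _ h1 h2).1

theorem Thetah_nonneg {qp qm : E2 → ℝ} (hqp : ∀ᵐ x ∂(volume.restrict Ω), 0 ≤ qp x)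
    (hqm : ∀ᵐ x ∂(volume.restrict Ω), 0 ≤ qm x) (u : L2v Ω) (c : L2 Ω × L2v Ω) :
    0 ≤ Thetah k M qp qm u c c := by
  have h : 0 ≤ ∑ K, ∫ x in (M.elem K).carrier,
      (qp x + qm x) * M.pr k K c.1 x * M.pr k K c.1 x := by
    refine Finset.sum_nonneg fun K _ => integral_nonneg_of_ae ?_
    have hle := ae_mono (Measure.restrict_mono_set volume (M.subset K))
    filter_upwards [hqp.filter_mono hle, hqm.filter_mono hle] with x h1 h2
    rw [mul_assoc]
    exact mul_nonneg (add_nonneg h1 h2) (mul_self_nonneg _)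
  rw [Thetah]
  simp only [mul_comm (M.pr k _ c.1 _) (inner ℝ _ _ : ℝ)]
  linarith

/-! ### Solvability of the two problems -/

theorem existsUnique_solvesMixed (hΩ : IsConvexPolygonalDomain Ω) {qp qm : E2 → ℝ}
    (hG : MemLp (fun x => qp x - qm x) ⊤ (volume.restrict Ω)) {c : Zh k M}
    (hc : GravityL2 k M med c.1.1) :
    ∃! up : Vh k M × Qh k M, SolvesMixed k M med S qp qm c up.1 up.2 := by
  have hb := hΩ.isBounded
  have hfin : IsFiniteMeasure (volume.restrict Ω) :=
    ⟨by rw [Measure.restrict_apply_univ]; exact hb.measure_lt_top⟩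
  obtain ⟨a, ha⟩ := exists_bilin_Ah k M med S c.1.1
  obtain ⟨l, hl⟩ := exists_linear_gammah k M med hc
  have hG2 : MemLp (fun x => qp x - qm x) 2 (volume.restrict Ω) := hG.mono_exponent le_top
  set p1 : vh k M hb →ₗ[ℝ] L2v Ω := LinearMap.fst ℝ _ _ ∘ₗ (vh k M hb).subtype
  set p2 : vh k M hb →ₗ[ℝ] L2 Ω := LinearMap.snd ℝ _ _ ∘ₗ (vh k M hb).subtype
  set b : vh k M hb →ₗ[ℝ] qh k M hb →ₗ[ℝ] ℝ := -(innerₗ (L2 Ω)).compl₁₂ p2 (qh k M hb).subtype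
  have hbB : ∀ v q, b v q = B v.1 q.1 := fun v q => (B_eq_inner v.1 q.1).symm
  set m : qh k M hb →ₗ[ℝ] ℝ :=
    -(innerₗ (L2 Ω) (toL2 Ω fun x => qp x - qm x)) ∘ₗ (qh k M hb).subtype
  have hm : ∀ q, m q = -∫ x in Ω, (qp x - qm x) * q.1 x := fun q => by
    change -(inner ℝ (toL2 Ω fun x => qp x - qm x) q.1 : ℝ) = _
    rw [real_inner_comm, ← integral_mul_eq _ hG2]
    simp only [mul_comm]
  have h := existsUnique_saddle (a.compl₁₂ p1 p1) (fun v hv => Subtype.ext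
      (eq_zero_of_Ah_nonpos med S hΩ.isOpen hb c.1.1 v.2 ((ha v.1 v.1).symm.trans hv).le)) b
    (fun q hq => Subtype.ext (eq_zero_of_B_eq_zero hΩ q.2 fun v hv =>
      (hbB ⟨v, hv⟩ q).symm.trans (hq ⟨v, hv⟩))) (l ∘ₗ p1) m
  have e : ∀ (u : vh k M hb) (p : qh k M hb), ((∀ v, a.compl₁₂ p1 p1 u v + b v p = (l ∘ₗ p1) v) ∧
      ∀ q, b u q = m q) ↔ SolvesMixed k M med S qp qm c u p := fun u p => by
    refine and_congr (forall_congr' fun v => ?_) (forall_congr' fun q => ?_)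
    · rw [hbB, ← ha u.1 v.1, ← hl v.1]
      rfl
    · rw [hbB, hm]
  obtain ⟨⟨u, p⟩, hup, huniq⟩ := h
  exact ⟨(u, p), (e u p).1 hup, fun up' h' => huniq up' ((e up'.1 up'.2).2 h')⟩

theorem existsUnique_solvesConcentration (hΩ : IsConvexPolygonalDomain Ω) {τ : ℝ} (hτ : 0 < τ)
    {qp qm chat : E2 → ℝ} (hqp0 : ∀ᵐ x ∂(volume.restrict Ω), 0 ≤ qp x)
    (hqm0 : ∀ᵐ x ∂(volume.restrict Ω), 0 ≤ qm x) (hqp : MemLp qp ⊤ (volume.restrict Ω))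
    (hG : MemLp (fun x => qp x - qm x) ⊤ (volume.restrict Ω))
    (hchat : MemLp chat 2 (volume.restrict Ω)) (c' : Zh k M) (u' : Vh k M) :
    ∃! c : Zh k M, SolvesConcentration k M med S τ qp qm chat c' u' c := by
  have hb := hΩ.isBounded
  have hsum : MemLp (fun x => qp x + qm x) ⊤ (volume.restrict Ω) := by
    refine (memLp_congr_ae (Filter.Eventually.of_forall fun x => ?_)).1 ((hqp.add hqp).sub hG)
    simp only [Pi.add_apply, Pi.sub_apply]
    ring
  obtain ⟨bM, hM⟩ := exists_bilin_Mh k M med S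
  obtain ⟨bT, hT⟩ := exists_bilin_Thetah k M hsum u'.1.1
  obtain ⟨bD, hD⟩ := exists_bilin_Dh k M med S hb u'.1.1
  obtain ⟨l, hl⟩ := exists_linear_sourceh k M hqp hchat
  set p1 : zh k M hb →ₗ[ℝ] L2 Ω := LinearMap.fst ℝ _ _ ∘ₗ (zh k M hb).subtype
  set b : zh k M hb →ₗ[ℝ] zh k M hb →ₗ[ℝ] ℝ := τ⁻¹ • bM.compl₁₂ p1 p1 +
    bT.compl₁₂ (zh k M hb).subtype (zh k M hb).subtype + bD
  have hbv : ∀ c z, b c z = τ⁻¹ * Mh k M med S c.1 z.1 + Thetah k M qp qm u'.1.1 c.1 z.1 +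
      Dh k M med S u'.1.1 c.1 z.1 := fun c z => by
    rw [← hM, ← hT, ← hD]
    rfl
  set r : zh k M hb →ₗ[ℝ] ℝ := (l + τ⁻¹ • bM c'.1.1) ∘ₗ p1
  have h := existsUnique_of_nondegenerate b (fun c hc => by
    have h1 := hc c
    rw [hbv] at h1
    have h2 := Thetah_nonneg (k := k) (M := M) hqp0 hqm0 u'.1.1 c.1
    have h3 := Dh_nonneg med S u'.1.1 c.2
    have h4 : τ⁻¹ * Mh k M med S c.1 c.1 ≤ 0 := by linarith
    exact Subtype.ext (eq_zero_of_Mh_nonpos med S hΩ.isOpen hb c.2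
      (nonpos_of_mul_nonpos_right h4 (inv_pos.2 hτ)))) r
  have e : ∀ c : zh k M hb, (∀ z, b c z = r z) ↔ SolvesConcentration k M med S τ qp qm chat c' u' c :=
    fun c => forall_congr' fun z => by
      have h1 : Mh k M med S (τ⁻¹ • (c.1 - c'.1)) z.1 =
          τ⁻¹ * Mh k M med S c.1 z.1 - τ⁻¹ * bM c'.1.1 z.1.1 := by
        rw [← hM, ← hM, Prod.smul_fst, Prod.fst_sub, map_smul, map_sub, LinearMap.smul_apply,
          LinearMap.sub_apply, smul_eq_mul, mul_sub]
      have h2 : r z = sourceh k M qp chat z.1 + τ⁻¹ * bM c'.1.1 z.1.1 := by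
        rw [← hl]
        rfl
      rw [hbv, h1, h2]
      constructor <;> intro h <;> linarith
  obtain ⟨c, hc, huniq⟩ := h
  exact ⟨c, (e c).1 hc, fun c₁ h₁ => huniq c₁ ((e c₁).2 h₁)⟩

end Forms

/-! ### The scheme -/

/-- A scheme whose steps are uniquely solvable along the iterates that it produces is uniquely
solvable. -/
theorem existsUnique_scheme {Z V Q : Type*} [Nonempty V] [Nonempty Q] (N : ℕ)
    (mixed : ℕ → Z → V → Q → Prop) (conc : ℕ → Z → V → Z → Prop) (G : Z → Prop) (c₀ : Z)
    (hmixed : ∀ n ≤ N, ∀ c, G c → ∃! up : V × Q, mixed n c up.1 up.2)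
    (hconc : ∀ n < N, ∀ c u, ∃! c', conc n c u c')
    (hG : ∀ m ≤ N, ∀ (C : ℕ → Z) (U : ℕ → V) (P : ℕ → Q), C 0 = c₀ →
      (∀ n < m, mixed n (C n) (U n) (P n) ∧ conc n (C n) (U n) (C (n + 1))) → G (C m)) :
    ∃! X : Fin (N + 1) → Z × V × Q, (X 0).1 = c₀ ∧
      (∀ n : Fin (N + 1), mixed n (X n).1 (X n).2.1 (X n).2.2) ∧
      ∀ n : Fin N, conc n (X n.castSucc).1 (X n.castSucc).2.1 (X n.succ).1 := by
  classical
  have hm : ∀ n c, ∃ up : V × Q, (∃ up : V × Q, mixed n c up.1 up.2) → mixed n c up.1 up.2 :=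
    fun n c => by
      by_cases h : ∃ up : V × Q, mixed n c up.1 up.2
      · exact ⟨h.choose, fun _ => h.choose_spec⟩
      · exact ⟨Classical.arbitrary _, fun h' => absurd h' h⟩
  have hc : ∀ n c u, ∃ c', (∃ c', conc n c u c') → conc n c u c' := fun n c u => by
    by_cases h : ∃ c', conc n c u c'
    · exact ⟨h.choose, fun _ => h.choose_spec⟩
    · exact ⟨c, fun h' => absurd h' h⟩
  choose m hm using hm
  choose s hs using hc
  set F : ℕ → Z × V × Q := fun n => Nat.rec (c₀, m 0 c₀)
    (fun n x => (s n x.1 x.2.1, m (n + 1) (s n x.1 x.2.1))) n with hF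
  have hF2 : ∀ n, (F n).2 = m n (F n).1 := fun n => by cases n <;> rfl
  have hFc : ∀ n < N, conc n (F n).1 (F n).2.1 (F (n + 1)).1 := fun n hn =>
    hs n _ _ (hconc n hn _ _).exists
  have hFG : ∀ n ≤ N, G (F n).1 := fun n => by
    induction n using Nat.strong_induction_on with
    | _ n ih =>
      intro hn
      refine hG n hn (fun i => (F i).1) (fun i => (F i).2.1) (fun i => (F i).2.2) rfl
        fun i hi => ⟨?_, hFc i (hi.trans_le hn)⟩
      have hi' := (hi.trans_le hn).le
      simp only [hF2]
      exact hm i _ (hmixed i hi' _ (ih i hi hi')).exists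
  have hFm : ∀ n ≤ N, mixed n (F n).1 (F n).2.1 (F n).2.2 := fun n hn => by
    simp only [hF2]
    exact hm n _ (hmixed n hn _ (hFG n hn)).exists
  refine ⟨fun n => F n, ⟨rfl, fun n => hFm n (Nat.lt_succ_iff.1 n.2), fun n => ?_⟩, ?_⟩
  · exact hFc n n.2
  · rintro X ⟨h0, hXm, hXc⟩
    have hX : ∀ n, ∀ h : n < N + 1, (X ⟨n, h⟩).1 = (F n).1 → X ⟨n, h⟩ = F n := fun n h he => by
      refine Prod.ext he ?_
      have h1 := hXm ⟨n, h⟩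
      rw [he] at h1
      have hn := Nat.lt_succ_iff.1 h
      exact (hmixed n hn _ (hFG n hn)).unique h1 (hFm n hn)
    have key : ∀ n, ∀ h : n < N + 1, X ⟨n, h⟩ = F n := fun n => by
      induction n with
      | zero => exact fun h => hX 0 h h0
      | succ n ih =>
        intro h
        have hn : n < N := Nat.lt_of_succ_lt_succ h
        refine hX _ h ((hconc n hn _ _).unique (hXc ⟨n, hn⟩) ?_)
        have e : X (Fin.castSucc ⟨n, hn⟩) = F n := ih (hn.trans (Nat.lt_succ_self N))
        rw [e]
        exact hFc n hn
    exact funext fun n => key n n.2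

end MiscibleVEM

end

theorem mainTheorem4 (Ω : Set MiscibleVEM.E2) (hΩ : MiscibleVEM.IsConvexPolygonalDomain Ω)
    (k : ℕ) (M : MiscibleVEM.Mesh Ω) (med : MiscibleVEM.Medium Ω)
    (S : MiscibleVEM.Stabilization k M)
    (τ : ℝ) (hτ : 0 < τ) (N : ℕ)
    -- the source terms and the injected concentration, as functions of time and space
    (qp qm chat : ℝ → MiscibleVEM.E2 → ℝ)
    (hqp_nonneg : ∀ n ≤ N, ∀ᵐ x ∂(MeasureTheory.volume.restrict Ω), 0 ≤ qp (n * τ) x)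
    (hqm_nonneg : ∀ n ≤ N, ∀ᵐ x ∂(MeasureTheory.volume.restrict Ω), 0 ≤ qm (n * τ) x)
    (hqp : ∀ n ≤ N, MeasureTheory.MemLp (qp (n * τ)) ⊤ (MeasureTheory.volume.restrict Ω))
    (hG : ∀ n ≤ N, MeasureTheory.MemLp (fun x => qp (n * τ) x - qm (n * τ) x) ⊤
      (MeasureTheory.volume.restrict Ω))
    (hchat : ∀ n ≤ N, MeasureTheory.MemLp (chat (n * τ)) 2 (MeasureTheory.volume.restrict Ω))
    (c₀ : MiscibleVEM.Zh k M) :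
    -- every mixed problem (initial one and later steps) is uniquely solvable
    (∀ n ≤ N, ∀ c : MiscibleVEM.Zh k M, MiscibleVEM.GravityL2 k M med c.1.1 →
      ∃! up : MiscibleVEM.Vh k M × MiscibleVEM.Qh k M,
        MiscibleVEM.SolvesMixed k M med S (qp (n * τ)) (qm (n * τ)) c up.1 up.2) ∧
    -- every concentration step is uniquely solvable
    (∀ n < N, ∀ (c' : MiscibleVEM.Zh k M) (u' : MiscibleVEM.Vh k M),
      ∃! c : MiscibleVEM.Zh k M, MiscibleVEM.SolvesConcentration k M med S τ
        (qp ((n + 1 : ℕ) * τ)) (qm ((n + 1 : ℕ) * τ)) (chat ((n + 1 : ℕ) * τ)) c' u' c) ∧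
    -- the whole scheme is uniquely solvable, if the gravity term of every iterate that the scheme
    -- produces is square-integrable
    ((∀ m ≤ N, ∀ (C : ℕ → MiscibleVEM.Zh k M) (U : ℕ → MiscibleVEM.Vh k M)
        (P : ℕ → MiscibleVEM.Qh k M), C 0 = c₀ →
        (∀ n < m,
          MiscibleVEM.SolvesMixed k M med S (qp (n * τ)) (qm (n * τ)) (C n) (U n) (P n) ∧
          MiscibleVEM.SolvesConcentration k M med S τ (qp ((n + 1 : ℕ) * τ))
            (qm ((n + 1 : ℕ) * τ)) (chat ((n + 1 : ℕ) * τ)) (C n) (U n) (C (n + 1))) →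
        MiscibleVEM.GravityL2 k M med (C m).1.1) →
      ∃! X : Fin (N + 1) → MiscibleVEM.Zh k M × MiscibleVEM.Vh k M × MiscibleVEM.Qh k M,
        (X 0).1 = c₀ ∧
        (∀ n : Fin (N + 1), MiscibleVEM.SolvesMixed k M med S (qp ((n : ℕ) * τ))
          (qm ((n : ℕ) * τ)) (X n).1 (X n).2.1 (X n).2.2) ∧
        ∀ n : Fin N, MiscibleVEM.SolvesConcentration k M med S τ (qp (((n : ℕ) + 1 : ℕ) * τ))
          (qm (((n : ℕ) + 1 : ℕ) * τ)) (chat (((n : ℕ) + 1 : ℕ) * τ))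
          (X n.castSucc).1 (X n.castSucc).2.1 (X n.succ).1) := by
  have hmixed : ∀ n ≤ N, ∀ c : MiscibleVEM.Zh k M, MiscibleVEM.GravityL2 k M med c.1.1 →
      ∃! up : MiscibleVEM.Vh k M × MiscibleVEM.Qh k M,
        MiscibleVEM.SolvesMixed k M med S (qp (n * τ)) (qm (n * τ)) c up.1 up.2 :=
    fun n hn c hc => MiscibleVEM.existsUnique_solvesMixed med S hΩ (hG n hn) hc
  have hconc : ∀ n < N, ∀ (c' : MiscibleVEM.Zh k M) (u' : MiscibleVEM.Vh k M),
      ∃! c : MiscibleVEM.Zh k M, MiscibleVEM.SolvesConcentration k M med S τ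
        (qp ((n + 1 : ℕ) * τ)) (qm ((n + 1 : ℕ) * τ)) (chat ((n + 1 : ℕ) * τ)) c' u' c :=
    fun n hn c' u' => MiscibleVEM.existsUnique_solvesConcentration med S hΩ hτ
      (hqp_nonneg _ hn) (hqm_nonneg _ hn) (hqp _ hn) (hG _ hn) (hchat _ hn) c' u'
  have : Nonempty (MiscibleVEM.Vh k M) := ⟨⟨0, (MiscibleVEM.vh k M hΩ.isBounded).zero_mem⟩⟩
  have : Nonempty (MiscibleVEM.Qh k M) := ⟨⟨0, (MiscibleVEM.qh k M hΩ.isBounded).zero_mem⟩⟩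
  refine ⟨hmixed, hconc, fun hgrav => ?_⟩
  exact MiscibleVEM.existsUnique_scheme N
    (fun n c u p => MiscibleVEM.SolvesMixed k M med S (qp (n * τ)) (qm (n * τ)) c u p)
    (fun n c' u' c => MiscibleVEM.SolvesConcentration k M med S τ (qp ((n + 1 : ℕ) * τ))
      (qm ((n + 1 : ℕ) * τ)) (chat ((n + 1 : ℕ) * τ)) c' u' c)
    (fun c => MiscibleVEM.GravityL2 k M med c.1.1) c₀ hmixed hconc hgrav
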